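/- Let $X$ be a finite set, let $M(X)=\mathbb N^X$ be the free abelian monoid on $X$ (identified with the monomials in $X$ and ordered by divisibility), let $I\subseteq M(X)$ be a monoid ideal, let $G_I$ be the group of monoid automorphisms of $M(X)$ that preserve $I$, and let $\Bbbk$ be a field with prime subfield $\mathbb F$. For a $\Bbbk$-algebra $S$ we write $I\,S[X]$ for the ideal of $S[X]$ generated by the monomials in $I$. **Notation.** Let $L'$ be the (finite) poset of least common multiples of nonempty sets of minimal generators of $I$; if $I\ne M(X)$ this is the lcm-lattice of $I$ without its bottom element $1$. Let $\Delta$ be the order complex of $L'$; its $n$-faces $a_0<\dots<a_n$ are naturally oriented. For $a\in L'$ let $C_\bullet(a)=C_\bullet(\Delta_{\le a},\Delta_{<a};\mathbb F)$, with differential $d$ and with canonical basis the faces with $a_n=a$. A *matroidal splitting* of $C_\bullet(a)$ is a chain homotopy $\sigma$ obtained as follows. For each $n$ choose a subset $X_n$ of the canonical basis of $C_n(a)$ that $d$ maps bijectively onto a basis of $d(C_n(a))$; for a canonical basis element $b\notin X_n$ let $z(b)$ be the unique cycle in $b+\mathrm{span}(X_n)$; choose a set $Z_n$ of such cycles $z(b)$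 that maps bijectively onto a basis of $H_n(C_\bullet(a))$. Then $\sigma$ is determined by $\sigma(dc)=c$ for $c\in X_{n+1}$, and $\sigma=0$ on $X_n$ and on $Z_n$. Let $MSpl(a)$ be the set of all matroidal splittings of $C_\bullet(a)$ and let $m(a)=|MSpl(a)|$ (it is finite and positive). Call $a$ *critical* if $\operatorname{char}\Bbbk$ divides $m(a)$, and let $L'_{crit}$ be the set of critical elements (empty in characteristic $0$). Let $\Bbbk'$ be the fraction field of $\Bbbk[\,y_{\sigma}\mid a\in L'_{crit},\ \sigma\in MSpl(a)]\big/\big(1-\sum_{\sigma\in MSpl(a)}y_{\sigma}\ \big|\ a\in L'_{crit}\big)$, and let $R'=\Bbbk'[X]$. Let $\mathfrak F=(F_n,\phi_n)$ be the lcm-resolution of $I R'$: $F_n$ is the free $M(X)$-graded $R'$-module on the $n$-faces $a_0<\dots<a_n$ of $\Delta$, such a face having degree $a_n$; $\phi_n$ sends it to $\sum_{i<n}(-1)^i(\text{omit }a_i)+(-1)^n(x^{a_n}/x^{a_{n-1}})(\text{omit }a_n)$; and the augmentation $F_0\to IR'$ sends a vertex $a$ to $x^a$. On $C_\bullet(a)\otimes_{\mathbb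 F} R'$ let $V_a=\sum_{\sigma\in MSpl(a)}y_\sigma\,\sigma$ if $a$ is critical and $V_a=\frac1{m(a)}\sum_{\sigma\in MSpl(a)}\sigma$ otherwise, and let $W_a=V_a dV_a(\mathrm{id}-V_a d)$. Let $W$ be the map $F_n\to F_{n+1}$, for all $n$, that agrees with $W_a$ on the span of the faces with largest vertex $a$; let $\Phi=\mathrm{id}-\phi W-W\phi$; and let $\pi=\Phi^{1+\dim L'}$, where $\dim L'$ is the largest length $n$ of a chain $a_0<\dots<a_n$ in $L'$. Let $\mathfrak M=\pi(\mathfrak F)$. **Theorem.** 1. $\Bbbk'$ is a finitely generated field extension of $\Bbbk$. It is purely transcendental over $\Bbbk$ of degree $\sum_{a\in L'_{crit}}(m(a)-1)$; in characteristic zero $\Bbbk'=\Bbbk$. 2. $\mathfrak F$ is an $M(X)$-graded free resolution of $IR'$ over $R'$. The map $\pi$ is an idempotent $M(X)$-homogeneous morphism of complexes of $R'$-modules, so that it is a projection of $\mathfrak F$ onto the direct summand $\mathfrak M$. With the induced grading, differential and augmentation, $\mathfrak M$ is a minimal free $M(X)$-graded resolution of $IR'$ over $R'$ by modules of finite rank.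 3. The group $G_I$ acts on $\Bbbk'$ by field automorphisms over $\Bbbk$, with $\gamma(y_\sigma)=y_{\gamma\sigma}$ for all $\gamma \in G_I$; here $\gamma\sigma\in MSpl(\gamma(a))$ is the conjugate of $\sigma\in MSpl(a)$ by the bijection that $\gamma$ induces on faces. For $\gamma\in G_I$ denote also by $\gamma$ the ring automorphism of $R'$ that acts on coefficients by this action and on monomials by $x^m\mapsto x^{\gamma(m)}$. 4. There is a group homomorphism $G_I\to Aut_{\Bbbk}(\mathfrak M)$, $\gamma\mapsto\mathfrak M(\gamma)$, into the group of automorphisms of the complex of $\Bbbk$-vector spaces $\mathfrak M$, where $\mathfrak M(\gamma)$ is the restriction to $\mathfrak M$ of the map $\sum_c f_c\,c\mapsto\sum_c\gamma(f_c)\,\gamma(c)$ on $\mathfrak F$ ($c$ running over faces, $f_c\in R'$). For each $\gamma$ the map $\mathfrak M(\gamma)\colon\mathfrak M\to\gamma_*\mathfrak M$ is an isomorphism of complexes of free $M(X)$-graded $R'$-modules that lifts the isomorphism $\gamma\colon IR'\to\gamma_*(IR')$. Here $\gamma_*N$ is $N$ with $f\in R'$ acting as $\gamma(f)$, graded so that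 its component of degree $e$ is the component of $N$ of degree $\gamma(e)$. -/

import Mathlib

noncomputable section

namespace LcmRes

universe u v w

/-! ### Chain complexes, chain homotopies and their flows

A nonnegatively graded chain complex of `S`-modules is given by modules `N n` and maps
`d n : N (n + 1) → N n`; a chain homotopy is a family of maps `D n : N n → N (n + 1)`. -/

section Complexes

variable {S : Type*} [CommRing S] {N : ℕ → Type*} [∀ n, AddCommGroup (N n)]
  [∀ n, Module S (N n)]

/-- The composite `D d` on `N n`, where `d` is the differential (so it is zero for `n = 0`). -/
def homotopyD (d : ∀ n, N (n + 1) →ₗ[S] N n) (D : ∀ n, N n →ₗ[S] N (n + 1)) :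
    ∀ n, N n →ₗ[S] N n
  | 0 => 0
  | n + 1 => D n ∘ₗ d n

/-- The flow (deformation along `D`) `id - d D - D d`. -/
def flow (d : ∀ n, N (n + 1) →ₗ[S] N n) (D : ∀ n, N n →ₗ[S] N (n + 1)) (n : ℕ) :
    N n →ₗ[S] N n :=
  LinearMap.id - d n ∘ₗ D n - homotopyD d D n

/-- The homotopy `D d D (id - D d)`. When `d D d = d`, this is the splitting that equals
`D (d D)⁻¹` on the image of `d D` and is zero on the image of `D d` and on
`ker (D d) ∩ ker (d D)`. -/
def hat (d : ∀ n, N (n + 1) →ₗ[S] N n) (D : ∀ n, N n →ₗ[S] N (n + 1)) (n : ℕ) :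
    N n →ₗ[S] N (n + 1) :=
  D n ∘ₗ d n ∘ₗ D n ∘ₗ (LinearMap.id - homotopyD d D n)

/-- The group of automorphisms of a chain complex: degreewise linear automorphisms that
commute with the differential. -/
def complexAut (d : ∀ n, N (n + 1) →ₗ[S] N n) : Subgroup (∀ n, N n ≃ₗ[S] N n) where
  carrier := {f | ∀ n x, d n (f (n + 1) x) = f n (d n x)}
  mul_mem' {f g} hf hg n x := by
    change d n (f (n + 1) (g (n + 1) x)) = f n (g n (d n x))
    rw [hf, hg]
  one_mem' n x := rfl
  inv_mem' {f} hf n x := by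
    change d n ((f (n + 1)).symm x) = (f n).symm (d n x)
    rw [LinearEquiv.eq_symm_apply, ← hf, LinearEquiv.apply_symm_apply]

end Complexes

/-! ### Matroidal splittings of a complex of based vector spaces -/

section Matroidal

variable {K : Type*} [Field K] {B : ℕ → Type*}

/-- The differential out of homological degree `n`; it is zero for `n = 0`. -/
def dFrom (d : ∀ n, (B (n + 1) →₀ K) →ₗ[K] (B n →₀ K)) :
    ∀ n, (B n →₀ K) →ₗ[K] (B (n - 1) →₀ K)
  | 0 => 0
  | n + 1 => d n

/-- A chain homotopy `D` on the complex with components `C n = (B n →₀ K)` is a matroidal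
splitting if it is induced by some choice, for every `n`, of

* a set `X n` of canonical basis elements of `C n` which the differential maps bijectively onto
  a basis of the space of boundaries that is its image; and
* a set `Z n` of cycles, each of the form `z = b - ∑_{c ∈ X n} r_c c` with `b ∉ X n` a canonical
  basis element, which maps bijectively onto a basis of the `n`-th homology.

Here "induced" means that `D` sends `d c` to `c` for `c ∈ X (n + 1)` and is zero on
`X n` and on `Z n`; since `C n` is the direct sum of the boundaries and the spans of `Z n` and
`X n`, this determines `D`. -/
def IsMatroidal (d : ∀ n, (B (n + 1) →₀ K) →ₗ[K] (B n →₀ K))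
    (D : ∀ n, (B n →₀ K) →ₗ[K] (B (n + 1) →₀ K)) : Prop :=
  ∃ (X : ∀ n, Set (B n)) (Z : ∀ n, Set (B n →₀ K)), ∀ n,
    (LinearIndepOn K (fun b => dFrom d n (Finsupp.single b 1)) (X n) ∧
      Submodule.span K ((fun b => dFrom d n (Finsupp.single b 1)) '' X n) =
        LinearMap.range (dFrom d n)) ∧
    (∀ z ∈ Z n, dFrom d n z = 0 ∧ ∃ b, b ∉ X n ∧
      Finsupp.single b 1 - z ∈ Submodule.span K ((fun c => Finsupp.single c (1 : K)) '' X n)) ∧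
    (LinearIndepOn K (LinearMap.range (d n)).mkQ (Z n) ∧
      Submodule.span K ((LinearMap.range (d n)).mkQ '' Z n) =
        (LinearMap.ker (dFrom d n)).map (LinearMap.range (d n)).mkQ) ∧
    (∀ c ∈ X (n + 1), D n (d n (Finsupp.single c 1)) = Finsupp.single c 1) ∧
    (∀ c ∈ X n, D n (Finsupp.single c 1) = 0) ∧
    (∀ z ∈ Z n, D n z = 0)

/-- Extension of scalars of a map of based free modules along a ring homomorphism. -/
def extendScalars {K S : Type*} [CommRing K] [CommRing S] {B B' : Type*} (f : K →+* S)
    (D : (B →₀ K) →ₗ[K] (B' →₀ K)) : (B →₀ S) →ₗ[S] (B' →₀ S) :=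
  Finsupp.linearCombination S
    (fun b => (D (Finsupp.single b 1)).mapRange f (map_zero f))

/-- Transport of chain homotopies along bijections of the canonical bases. -/
def transport {B' : ℕ → Type*} (e : ∀ n, B n ≃ B' n) :
    (∀ n, (B n →₀ K) →ₗ[K] (B (n + 1) →₀ K)) ≃
      (∀ n, (B' n →₀ K) →ₗ[K] (B' (n + 1) →₀ K)) :=
  Equiv.piCongrRight fun n =>
    (LinearEquiv.arrowCongr (Finsupp.domLCongr (R := K) (M := K) (e n))
      (Finsupp.domLCongr (R := K) (M := K) (e (n + 1)))).toEquiv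

theorem transport_apply {B' : ℕ → Type*} (e : ∀ n, B n ≃ B' n)
    (D : ∀ n, (B n →₀ K) →ₗ[K] (B (n + 1) →₀ K)) (n : ℕ) (x : B n →₀ K) :
    transport e D n (Finsupp.domLCongr (R := K) (M := K) (e n) x) =
      Finsupp.domLCongr (R := K) (M := K) (e (n + 1)) (D n x) := by
  change Finsupp.domLCongr (R := K) (M := K) (e (n + 1)) (D n
    ((Finsupp.domLCongr (R := K) (M := K) (e n)).symm
      (Finsupp.domLCongr (R := K) (M := K) (e n) x))) = _
  rw [LinearEquiv.symm_apply_apply]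

theorem IsMatroidal.transport {B' : ℕ → Type*} (e : ∀ n, B n ≃ B' n)
    {d : ∀ n, (B (n + 1) →₀ K) →ₗ[K] (B n →₀ K)}
    {d' : ∀ n, (B' (n + 1) →₀ K) →ₗ[K] (B' n →₀ K)}
    (hd : ∀ n x, d' n (Finsupp.domLCongr (R := K) (M := K) (e (n + 1)) x) =
      Finsupp.domLCongr (R := K) (M := K) (e n) (d n x))
    {D : ∀ n, (B n →₀ K) →ₗ[K] (B (n + 1) →₀ K)} (hD : IsMatroidal d D) :
    IsMatroidal d' (LcmRes.transport e D) := by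
  obtain ⟨X, Z, h⟩ := hD
  set E : ∀ n, (B n →₀ K) ≃ₗ[K] (B' n →₀ K) :=
    fun n => Finsupp.domLCongr (R := K) (M := K) (e n) with hE
  have hEs : ∀ n b, E n (Finsupp.single b 1) = Finsupp.single (e n b) 1 := fun n b => by
    simp [hE]
  have hd' : ∀ n x, d' n (E (n + 1) x) = E n (d n x) := hd
  have ht : ∀ n x, LcmRes.transport e D n (E n x) = E (n + 1) (D n x) :=
    fun n x => transport_apply e D n x
  have hF : ∀ n x, dFrom d' n (E n x) = E (n - 1) (dFrom d n x) := by
    intro n x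
    cases n with
    | zero => simp [dFrom]
    | succ n => exact hd n x
  have hrF : ∀ n, LinearMap.range (dFrom d' n) =
      (LinearMap.range (dFrom d n)).map (E (n - 1)).toLinearMap := by
    intro n
    ext y
    constructor
    · rintro ⟨x, rfl⟩
      obtain ⟨x, rfl⟩ := (E n).surjective x
      exact ⟨_, ⟨x, rfl⟩, (hF n x).symm⟩
    · rintro ⟨_, ⟨x, rfl⟩, rfl⟩
      exact ⟨E n x, hF n x⟩
  have hr : ∀ n, LinearMap.range (d' n) =
      (LinearMap.range (d n)).map (E n).toLinearMap := fun n => hrF (n + 1)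
  have hker : ∀ n, LinearMap.ker (dFrom d' n) =
      (LinearMap.ker (dFrom d n)).map (E n).toLinearMap := by
    intro n
    ext y
    obtain ⟨x, rfl⟩ := (E n).surjective y
    simp [hF]
  let Q : ∀ n, ((B n →₀ K) ⧸ LinearMap.range (d n)) ≃ₗ[K]
      ((B' n →₀ K) ⧸ LinearMap.range (d' n)) := fun n =>
    Submodule.Quotient.equiv _ _ (E n) (hr n).symm
  have hQ : ∀ n x, Q n ((LinearMap.range (d n)).mkQ x) =
      (LinearMap.range (d' n)).mkQ (E n x) := fun n x => rfl
  have himg : ∀ n, (fun b => dFrom d' n (Finsupp.single b 1)) '' (e n '' X n) =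
      E (n - 1) '' ((fun b => dFrom d n (Finsupp.single b 1)) '' X n) := by
    intro n
    rw [Set.image_image, Set.image_image]
    refine Set.image_congr fun b _ => ?_
    rw [← hF, hEs]
  have hmk : ∀ n, (LinearMap.range (d' n)).mkQ '' (E n '' Z n) =
      Q n '' ((LinearMap.range (d n)).mkQ '' Z n) := by
    intro n
    rw [Set.image_image, Set.image_image]
    exact Set.image_congr fun b _ => (hQ n b).symm
  refine ⟨fun n => e n '' X n, fun n => E n '' Z n, fun n => ?_⟩
  obtain ⟨⟨h1, h2⟩, h3, ⟨h4, h5⟩, h6, h7, h8⟩ := h n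
  refine ⟨⟨?_, ?_⟩, ?_, ⟨?_, ?_⟩, ?_, ?_, ?_⟩
  · refine LinearIndepOn.image_of_comp (e n) _ ?_
    have : ((fun b => dFrom d' n (Finsupp.single b 1)) ∘ e n) =
        (E (n - 1)).toLinearMap ∘ (fun b => dFrom d n (Finsupp.single b 1)) := by
      funext b
      simp only [Function.comp_apply, LinearEquiv.coe_coe, ← hF, hEs]
    rw [this]
    exact h1.map_injOn _ (E (n - 1)).injective.injOn
  · rw [himg, hrF, ← h2, Submodule.map_span]
    rfl
  · rintro _ ⟨z, hz, rfl⟩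
    obtain ⟨hz0, b, hb, hbz⟩ := h3 z hz
    refine ⟨by rw [hF, hz0, map_zero], e n b, ?_, ?_⟩
    · rintro ⟨b', hb', hbb⟩
      exact hb ((e n).injective hbb ▸ hb')
    · have := Submodule.mem_map_of_mem (f := (E n).toLinearMap) hbz
      rw [Submodule.map_span, Set.image_image] at this
      rw [Set.image_image]
      simpa [hEs] using this
  · refine LinearIndepOn.image_of_comp (E n) _ ?_
    have : ((LinearMap.range (d' n)).mkQ ∘ E n) =
        (Q n).toLinearMap ∘ (LinearMap.range (d n)).mkQ := by
      funext b
      exact (hQ n b).symm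
    rw [this]
    exact h4.map_injOn _ (Q n).injective.injOn
  · rw [hmk]
    have : Submodule.span K (Q n '' ((LinearMap.range (d n)).mkQ '' Z n)) =
        (Submodule.span K ((LinearMap.range (d n)).mkQ '' Z n)).map (Q n).toLinearMap := by
      rw [Submodule.map_span]; rfl
    rw [this, h5, hker, ← Submodule.map_comp, ← Submodule.map_comp]
    rfl
  · rintro _ ⟨c, hc, rfl⟩
    rw [← hEs, hd', ht, h6 c hc]
  · rintro _ ⟨c, hc, rfl⟩
    rw [← hEs, ht, h7 c hc, map_zero]
  · rintro _ ⟨z, hz, rfl⟩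
    rw [ht, h8 z hz, map_zero]

end Matroidal

/-! ### The lcm-lattice and its symmetries

The free abelian monoid `M(X)` on `X` is `X →₀ ℕ`. -/

section Lattice

variable {X : Type u}

/-- The minimal generators of a monomial ideal. -/
def minGens (I : AddSemigroupIdeal (X →₀ ℕ)) : Set (X →₀ ℕ) := {m | Minimal (· ∈ I) m}

/-- The poset `L'` of all least common multiples of nonempty finite sets of minimal generators.
If the ideal is proper, this is the lcm-lattice without its bottom element `1`. -/
def lcmPoset (I : AddSemigroupIdeal (X →₀ ℕ)) : Set (X →₀ ℕ) :=
  {a | ∃ s : Finset (X →₀ ℕ), s.Nonempty ∧ (s : Set (X →₀ ℕ)) ⊆ minGens I ∧ s.sup id = a}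

/-- The group `G_I` of all automorphisms of the monoid `M(X)` that preserve the ideal `I`.
(Mathlib writes the composition of automorphisms of an additive monoid additively.) -/
def symGroup (I : AddSemigroupIdeal (X →₀ ℕ)) :
    Subgroup (Multiplicative (AddAut (X →₀ ℕ))) where
  carrier := {γ | ∀ m, γ.toAdd m ∈ I ↔ m ∈ I}
  mul_mem' {f g} hf hg m := by
    change f.toAdd (g.toAdd m) ∈ I ↔ m ∈ I
    rw [hf, hg]
  one_mem' m := Iff.rfl
  inv_mem' {f} hf m := by
    change f.toAdd.symm m ∈ I ↔ m ∈ I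
    rw [← hf, AddEquiv.apply_symm_apply]

variable {I : AddSemigroupIdeal (X →₀ ℕ)}

/-- The automorphism of the monoid `M(X)` underlying an element of `G_I`. -/
def symAut (γ : symGroup I) : (X →₀ ℕ) ≃+ (X →₀ ℕ) := γ.1.toAdd

theorem aut_le_iff (γ : (X →₀ ℕ) ≃+ (X →₀ ℕ)) (a b : X →₀ ℕ) : γ a ≤ γ b ↔ a ≤ b := by
  constructor
  · intro h
    obtain ⟨c, hc⟩ := exists_add_of_le h
    obtain ⟨c, rfl⟩ := γ.surjective c
    rw [← map_add] at hc
    exact (γ.injective hc) ▸ le_self_add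
  · intro h
    obtain ⟨c, rfl⟩ := exists_add_of_le h
    rw [map_add]
    exact le_self_add

theorem symAut_mem_minGens (γ : symGroup I) {m : X →₀ ℕ} (hm : m ∈ minGens I) :
    symAut γ m ∈ minGens I := by
  refine ⟨(γ.2 m).2 hm.1, fun y hy hle => ?_⟩
  obtain ⟨y, rfl⟩ := (symAut γ).surjective y
  rw [aut_le_iff] at hle ⊢
  exact hm.2 ((γ.2 y).1 hy) hle

theorem symAut_mem_lcmPoset (γ : symGroup I) {a : X →₀ ℕ} (ha : a ∈ lcmPoset I) :
    symAut γ a ∈ lcmPoset I := by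
  classical
  obtain ⟨s, hs, hsI, rfl⟩ := ha
  refine ⟨s.image (symAut γ), hs.image _, ?_, ?_⟩
  · intro y hy
    obtain ⟨x, hx, rfl⟩ := Finset.mem_image.1 (Finset.mem_coe.1 hy)
    exact symAut_mem_minGens γ (hsI hx)
  · apply le_antisymm
    · refine Finset.sup_le fun y hy => ?_
      obtain ⟨x, hx, rfl⟩ := Finset.mem_image.1 hy
      exact (aut_le_iff _ _ _).2 (Finset.le_sup (f := id) hx)
    · rw [← (symAut γ).apply_symm_apply ((s.image (symAut γ)).sup id), aut_le_iff]
      refine Finset.sup_le fun x hx => ?_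
      rw [← aut_le_iff (symAut γ), (symAut γ).apply_symm_apply]
      exact Finset.le_sup (f := id) (Finset.mem_image_of_mem _ hx)

/-- The action of an element of `G_I` on the poset `L'`. -/
def latticeIso (γ : symGroup I) : lcmPoset I ≃o lcmPoset I where
  toFun a := ⟨symAut γ a, symAut_mem_lcmPoset γ a.2⟩
  invFun a := ⟨symAut γ⁻¹ a, symAut_mem_lcmPoset γ⁻¹ a.2⟩
  left_inv a := Subtype.ext ((symAut γ).symm_apply_apply a)
  right_inv a := Subtype.ext ((symAut γ).apply_symm_apply a)
  map_rel_iff' := aut_le_iff _ _ _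

end Lattice

/-! ### Faces of the order complex and the strata -/

section Faces

variable {X : Type u} {I : AddSemigroupIdeal (X →₀ ℕ)}

/-- The (canonically oriented) `n`-faces `a₀ < ⋯ < aₙ` of the order complex of `L'`. -/
abbrev Face (I : AddSemigroupIdeal (X →₀ ℕ)) (n : ℕ) : Type u := Fin (n + 1) ↪o lcmPoset I

/-- The largest vertex `aₙ` of the face `a₀ < ⋯ < aₙ`. -/
def Face.top {n : ℕ} (c : Face I n) : lcmPoset I := c (Fin.last n)

/-- The face obtained by omitting the vertex `aᵢ`. -/
def Face.del {n : ℕ} (c : Face I (n + 1)) (i : Fin (n + 2)) : Face I n :=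
  (Fin.succAboveOrderEmb i).trans c

/-- The action of an element of `G_I` on faces. -/
def faceEquiv (γ : symGroup I) (n : ℕ) : Face I n ≃ Face I n where
  toFun c := c.trans (latticeIso γ).toOrderEmbedding
  invFun c := c.trans (latticeIso γ).symm.toOrderEmbedding
  left_inv c := by ext i : 1; exact (latticeIso γ).symm_apply_apply (c i)
  right_inv c := by ext i : 1; exact (latticeIso γ).apply_symm_apply (c i)

/-- The `n`-faces with largest vertex `a`: the canonical basis of the relative simplicial chains
`Cₙ(a) = Cₙ(Δ_{≤ a}, Δ_{< a})`. -/
abbrev StratumFace (a : lcmPoset I) (n : ℕ) : Type u := {c : Face I n // c.top = a}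

open Classical in
/-- The differential of the relative simplicial chain complex of `(Δ_{≤ a}, Δ_{< a})` with
coefficients in `S`; faces whose largest vertex is not `a` are zero in it. -/
def stratumD (S : Type*) [CommRing S] (a : lcmPoset I) (n : ℕ) :
    (StratumFace a (n + 1) →₀ S) →ₗ[S] (StratumFace a n →₀ S) :=
  Finsupp.linearCombination S fun c => ∑ i : Fin (n + 2),
    if h : (c.1.del i).top = a then Finsupp.single ⟨c.1.del i, h⟩ ((-1) ^ (i : ℕ)) else 0

/-- The bijection from the faces with largest vertex `a` to those with largest vertex `γ a`. -/
def stratumEquiv (γ : symGroup I) (a : lcmPoset I) (n : ℕ) :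
    StratumFace a n ≃ StratumFace (latticeIso γ a) n :=
  (faceEquiv γ n).subtypeEquiv fun c => by
    change c (Fin.last n) = a ↔ latticeIso γ (c (Fin.last n)) = latticeIso γ a
    exact (latticeIso γ).injective.eq_iff.symm

theorem stratumD_equiv (S : Type*) [CommRing S] (γ : symGroup I) (a : lcmPoset I) (n : ℕ)
    (x : StratumFace a (n + 1) →₀ S) :
    stratumD S (latticeIso γ a) n
        (Finsupp.domLCongr (R := S) (M := S) (stratumEquiv γ a (n + 1)) x) =
      Finsupp.domLCongr (R := S) (M := S) (stratumEquiv γ a n) (stratumD S a n x) := by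
  induction x using Finsupp.induction_linear with
  | zero => simp
  | add x y hx hy => simp only [map_add, hx, hy]
  | single c r =>
    rw [Finsupp.domLCongr_single]
    simp only [stratumD, Finsupp.linearCombination_single, map_smul, map_sum]
    congr 1
    refine Finset.sum_congr rfl fun i _ => ?_
    by_cases h : (c.1.del i).top = a
    · have h' : ((stratumEquiv γ a (n + 1) c).1.del i).top = latticeIso γ a := by
        exact congrArg (latticeIso γ) h
      rw [dif_pos h, dif_pos h', Finsupp.domLCongr_single]
      rfl
    · have h' : ((stratumEquiv γ a (n + 1) c).1.del i).top ≠ latticeIso γ a := fun h' =>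
        h ((latticeIso γ).injective h')
      rw [dif_neg h, dif_neg h', map_zero]

end Faces

/-! ### Matroidal splittings of the strata and the field extension -/

section Extension

variable {X : Type u} {I : AddSemigroupIdeal (X →₀ ℕ)} (k : Type v) [Field k]

/-- The chain homotopies on the stratum at `a`, over the prime subfield of `k`. -/
abbrev StratumHomotopy (a : lcmPoset I) : Type (max u v) :=
  ∀ n, (StratumFace a n →₀ (⊥ : Subfield k)) →ₗ[(⊥ : Subfield k)]
    (StratumFace a (n + 1) →₀ (⊥ : Subfield k))

/-- The set of all matroidal splittings of the relative chain complex of `(Δ_{≤ a}, Δ_{< a})`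
over the prime subfield of `k`. -/
def MSpl (a : lcmPoset I) : Set (StratumHomotopy k a) :=
  {σ | IsMatroidal (stratumD (⊥ : Subfield k) a) σ}

/-- The number `m(a)` of matroidal splittings. -/
def msplCount (a : lcmPoset I) : ℕ := (MSpl k a).ncard

/-- The element `a` is critical if the characteristic of `k` divides `m(a)`. -/
def IsCritical (a : lcmPoset I) : Prop := ringChar k ∣ msplCount k a

/-- The action of `γ` sends homotopies on the stratum at `a` to those on the stratum at `γ a`. -/
def homotopyMap (γ : symGroup I) (a : lcmPoset I) :
    StratumHomotopy k a ≃ StratumHomotopy k (latticeIso γ a) :=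
  transport (stratumEquiv γ a)

theorem homotopyMap_mem (γ : symGroup I) (a : lcmPoset I) {σ : StratumHomotopy k a}
    (h : σ ∈ MSpl k a) : homotopyMap k γ a σ ∈ MSpl k (latticeIso γ a) :=
  IsMatroidal.transport (stratumEquiv γ a) (stratumD_equiv _ γ a) h

theorem homotopyMap_mem_iff (γ : symGroup I) (a : lcmPoset I) {σ : StratumHomotopy k a} :
    homotopyMap k γ a σ ∈ MSpl k (latticeIso γ a) ↔ σ ∈ MSpl k a := by
  refine ⟨fun h => ?_, homotopyMap_mem k γ a⟩
  have hd : ∀ n x, stratumD (⊥ : Subfield k) a n (Finsupp.domLCongr (R := (⊥ : Subfield k))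
      (M := (⊥ : Subfield k)) (stratumEquiv γ a (n + 1)).symm x) =
      Finsupp.domLCongr (R := (⊥ : Subfield k)) (M := (⊥ : Subfield k))
        (stratumEquiv γ a n).symm (stratumD (⊥ : Subfield k) (latticeIso γ a) n x) := by
    intro n x
    rw [← Finsupp.domLCongr_symm, ← Finsupp.domLCongr_symm, LinearEquiv.eq_symm_apply,
      ← stratumD_equiv, LinearEquiv.apply_symm_apply]
  have := IsMatroidal.transport (fun n => (stratumEquiv γ a n).symm) hd h
  suffices hs : σ = transport (fun n => (stratumEquiv γ a n).symm) (homotopyMap k γ a σ) by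
    rw [hs]
    exact this
  funext n
  refine LinearMap.ext fun x => ?_
  obtain ⟨x, rfl⟩ := (Finsupp.domLCongr (R := (⊥ : Subfield k)) (M := (⊥ : Subfield k))
    (stratumEquiv γ a n)).symm.surjective x
  rw [Finsupp.domLCongr_symm, transport_apply, ← Finsupp.domLCongr_symm,
    ← Finsupp.domLCongr_symm, LinearEquiv.eq_symm_apply]
  exact (transport_apply (stratumEquiv γ a) σ n _).symm.trans
    (by rw [LinearEquiv.apply_symm_apply]; rfl)

theorem msplCount_latticeIso (γ : symGroup I) (a : lcmPoset I) :
    msplCount k (latticeIso γ a) = msplCount k a := by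
  have : MSpl k (latticeIso γ a) = homotopyMap k γ a '' MSpl k a := by
    ext τ
    constructor
    · intro h
      obtain ⟨σ, rfl⟩ := (homotopyMap k γ a).surjective τ
      exact ⟨σ, (homotopyMap_mem_iff k γ a).1 h, rfl⟩
    · rintro ⟨σ, h, rfl⟩
      exact homotopyMap_mem k γ a h
  rw [msplCount, this, Set.ncard_image_of_injective _ (homotopyMap k γ a).injective, msplCount]

theorem IsCritical.latticeIso (γ : symGroup I) {a : lcmPoset I} (h : IsCritical k a) :
    IsCritical k (latticeIso γ a) := by
  rw [IsCritical, msplCount_latticeIso]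
  exact h

variable (I)

/-- The set `L'_crit` of critical elements. -/
abbrev Crit : Type u := {a : lcmPoset I // IsCritical k a}

/-- The index set of the variables `y_σ`, the disjoint union of the sets of matroidal splittings
of the strata at the critical elements. -/
abbrev YIndex : Type (max u v) := Σ a : Crit I k, MSpl k a.1

/-- The ring `k[Y] / (l_a | a critical)` where `l_a = 1 - ∑_σ y_σ`, the sum being over the
matroidal splittings of the stratum at `a`. -/
abbrev CoordRing : Type (max u v) :=
  MvPolynomial (YIndex I k) k ⧸ Ideal.span (Set.range fun a : Crit I k =>
    (1 : MvPolynomial (YIndex I k) k) - ∑ᶠ σ : MSpl k a.1, MvPolynomial.X ⟨a, σ⟩)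

/-- The extension `k'` of `k`: the ring of fractions of `k[Y] / (l_a | a critical)`. -/
def ExtField : Type (max u v) := FractionRing (CoordRing I k)

instance : CommRing (ExtField I k) := inferInstanceAs (CommRing (FractionRing (CoordRing I k)))

instance : Algebra k (ExtField I k) :=
  inferInstanceAs (Algebra k (FractionRing (CoordRing I k)))

variable {I}

/-- The element `y_σ` of `k'`. -/
def yElt (y : YIndex I k) : ExtField I k :=
  algebraMap (CoordRing I k) (FractionRing (CoordRing I k))
    (Ideal.Quotient.mk _ (MvPolynomial.X y))

/-- The action of `G_I` on the variables `y_σ`. -/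
def yMap (γ : symGroup I) (y : YIndex I k) : YIndex I k :=
  ⟨⟨latticeIso γ y.1.1, y.1.2.latticeIso k γ⟩,
    ⟨homotopyMap k γ y.1.1 y.2.1, homotopyMap_mem k γ y.1.1 y.2.2⟩⟩

end Extension

/-! ### Multigraded modules and resolutions over a polynomial ring -/

section Graded

variable {X : Type u} {S : Type v} [CommRing S]

/-- The multigrading of the polynomial ring. -/
def polyDeg (X : Type u) (S : Type v) [CommRing S] (e : X →₀ ℕ) :
    Submodule S (MvPolynomial X S) :=
  Submodule.span S {MvPolynomial.monomial e 1}

open Classical in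
/-- A family of `S`-submodules is a grading by `M(X)` of a module over `S[X]`, for which this
module is a finite free graded module (i.e. it has a finite homogeneous basis). -/
structure IsGradedFree {N : Type w} [AddCommGroup N] [Module S N]
    [Module (MvPolynomial X S) N] (gr : (X →₀ ℕ) → Submodule S N) : Prop where
  isInternal : DirectSum.IsInternal gr
  monomial_smul_mem : ∀ (e e' : X →₀ ℕ), ∀ x ∈ gr e,
    MvPolynomial.monomial e' (1 : S) • x ∈ gr (e' + e)
  exists_basis : ∃ (r : ℕ) (b : Module.Basis (Fin r) (MvPolynomial X S) N),
    ∀ i, ∃ e, b i ∈ gr e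

/-- The complex of graded modules `N`, with differential `d` and augmentation `ε`, is a
`M(X)`-graded free resolution of the ideal `J` of the polynomial ring. -/
structure IsGradedFreeResolution {N : ℕ → Type w} [∀ n, AddCommGroup (N n)]
    [∀ n, Module S (N n)] [∀ n, Module (MvPolynomial X S) (N n)]
    (gr : ∀ n, (X →₀ ℕ) → Submodule S (N n))
    (d : ∀ n, N (n + 1) →ₗ[MvPolynomial X S] N n)
    (ε : N 0 →ₗ[MvPolynomial X S] MvPolynomial X S) (J : Ideal (MvPolynomial X S)) : Prop where
  isGradedFree : ∀ n, IsGradedFree (gr n)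
  d_mem : ∀ n e, ∀ x ∈ gr (n + 1) e, d n x ∈ gr n e
  aug_mem : ∀ e, ∀ x ∈ gr 0 e, ε x ∈ polyDeg X S e
  exact_d : ∀ n, Function.Exact (d (n + 1)) (d n)
  exact_aug : Function.Exact (d 0) ε
  range_aug : LinearMap.range ε = J

/-- Minimality: the differential has image in `𝔪 N`, with `𝔪` the ideal generated by the
variables. -/
def IsMinimalComplex {N : ℕ → Type w} [∀ n, AddCommGroup (N n)]
    [∀ n, Module (MvPolynomial X S) (N n)]
    (d : ∀ n, N (n + 1) →ₗ[MvPolynomial X S] N n) : Prop :=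
  ∀ n, LinearMap.range (d n) ≤
    Ideal.span (Set.range (MvPolynomial.X : X → MvPolynomial X S)) •
      (⊤ : Submodule (MvPolynomial X S) (N n))

/-- The ideal of the polynomial ring generated by the monomials in `I`. -/
def monomialIdeal (I : AddSemigroupIdeal (X →₀ ℕ)) (S : Type v) [CommRing S] :
    Ideal (MvPolynomial X S) :=
  Ideal.span ((fun m => MvPolynomial.monomial m (1 : S)) '' (I : Set (X →₀ ℕ)))

end Graded

/-! ### The lcm-resolution -/

section Resolution

variable {X : Type u} (I : AddSemigroupIdeal (X →₀ ℕ)) (S : Type v) [CommRing S]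

/-- The modules of the lcm-resolution over `S[X]`. -/
abbrev LcmMod (n : ℕ) : Type (max u v) := Face I n →₀ MvPolynomial X S

/-- The differential of the lcm-resolution. Omitting a vertex other than the largest one does
not change the degree of the face, so the monomial below is then `1`. -/
def lcmD (n : ℕ) : LcmMod I S (n + 1) →ₗ[MvPolynomial X S] LcmMod I S n :=
  Finsupp.linearCombination (MvPolynomial X S) fun c => ∑ i : Fin (n + 2),
    Finsupp.single (c.del i)
      (MvPolynomial.monomial ((c.top : X →₀ ℕ) - ((c.del i).top : X →₀ ℕ)) ((-1) ^ (i : ℕ)))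

/-- The augmentation of the lcm-resolution, sending a vertex `a` to the monomial `x ^ a`. -/
def lcmAug : LcmMod I S 0 →ₗ[MvPolynomial X S] MvPolynomial X S :=
  Finsupp.linearCombination (MvPolynomial X S) fun c =>
    MvPolynomial.monomial (c.top : X →₀ ℕ) 1

/-- The multigrading of the lcm-resolution: a face has the degree of its largest vertex. -/
def lcmDeg (n : ℕ) (e : X →₀ ℕ) : Submodule S (LcmMod I S n) :=
  Submodule.span S {x | ∃ (c : Face I n) (e' : X →₀ ℕ), e' + (c.top : X →₀ ℕ) = e ∧
    x = Finsupp.single c (MvPolynomial.monomial e' 1)}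

variable {I S}

/-- The vector field on the lcm-resolution induced by homotopies `W a` on the strata. -/
def inducedField (W : ∀ (a : lcmPoset I) (n : ℕ),
      (StratumFace a n →₀ MvPolynomial X S) →ₗ[MvPolynomial X S]
        (StratumFace a (n + 1) →₀ MvPolynomial X S)) (n : ℕ) :
    LcmMod I S n →ₗ[MvPolynomial X S] LcmMod I S (n + 1) :=
  Finsupp.linearCombination (MvPolynomial X S) fun c =>
    (W c.top n (Finsupp.single ⟨c, rfl⟩ 1)).mapDomain Subtype.val

end Resolution

/-! ### The canonical minimal resolution -/

section Canonical

variable {X : Type u} (I : AddSemigroupIdeal (X →₀ ℕ)) (k : Type v) [Field k]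

/-- The polynomial ring `R' = k'[X]`. -/
abbrev PolyExt : Type (max u v) := MvPolynomial X (ExtField I k)

/-- The inclusion of the prime subfield of `k` in `R'`. -/
def primeToPoly : (⊥ : Subfield k) →+* PolyExt I k :=
  (algebraMap k (PolyExt I k)).comp (⊥ : Subfield k).subtype

variable {I}

open Classical in
/-- The average of all matroidal splittings of the stratum at `a`, with the generic weights `y_σ`
if `a` is critical, and with the weights `1 / m(a)` otherwise. -/
def averageHomotopy (a : lcmPoset I) (n : ℕ) :
    (StratumFace a n →₀ PolyExt I k) →ₗ[PolyExt I k] (StratumFace a (n + 1) →₀ PolyExt I k) :=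
  if h : IsCritical k a then
    ∑ᶠ σ : MSpl k a, (MvPolynomial.C (yElt k ⟨⟨a, h⟩, σ⟩) : PolyExt I k) •
      extendScalars (primeToPoly I k) (σ.1 n)
  else
    algebraMap k (PolyExt I k) ((msplCount k a : k)⁻¹) •
      ∑ᶠ σ : MSpl k a, extendScalars (primeToPoly I k) (σ.1 n)

variable (I)

/-- The canonical vector field on the lcm-resolution. -/
def vectorField (n : ℕ) :
    LcmMod I (ExtField I k) n →ₗ[PolyExt I k] LcmMod I (ExtField I k) (n + 1) :=
  inducedField (fun a => hat (stratumD (PolyExt I k) a) (averageHomotopy k a)) n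

/-- The dimension of the poset `L'`, the largest length of a chain `a₀ < ⋯ < aₙ`. -/
def lcmDim : ℕ := sSup {n | Nonempty (Face I n)}

/-- The stable iterate of the flow of the canonical vector field. -/
def proj (n : ℕ) : LcmMod I (ExtField I k) n →ₗ[PolyExt I k] LcmMod I (ExtField I k) n :=
  flow (lcmD I (ExtField I k)) (vectorField I k) n ^ (1 + lcmDim I)

/-- The modules of the canonical minimal resolution. -/
def minRes (n : ℕ) : Submodule (PolyExt I k) (LcmMod I (ExtField I k) n) :=
  LinearMap.range (proj I k n)

/-- The multigrading of the canonical minimal resolution, induced by that of the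
lcm-resolution. -/
def minResDeg (n : ℕ) (e : X →₀ ℕ) : Submodule (ExtField I k) (minRes I k n) :=
  (lcmDeg I (ExtField I k) n e).comap ((minRes I k n).subtype.restrictScalars (ExtField I k))

variable {I k}

/-- The differential of the canonical minimal resolution: the restriction of the differential of
the lcm-resolution. -/
def minResD (hd : ∀ n, ∀ x ∈ minRes I k (n + 1), lcmD I (ExtField I k) n x ∈ minRes I k n)
    (n : ℕ) : minRes I k (n + 1) →ₗ[PolyExt I k] minRes I k n :=
  (lcmD I (ExtField I k) n).restrict (hd n)

variable (I k) in
/-- The augmentation of the canonical minimal resolution: the restriction of the augmentation of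
the lcm-resolution. -/
def minResAug : minRes I k 0 →ₗ[PolyExt I k] PolyExt I k :=
  (lcmAug I (ExtField I k)).domRestrict (minRes I k 0)

/-- The ring automorphism of `k'[X]` induced by `γ` and by an automorphism `τ` of `k'`: it acts
on coefficients by `τ` and sends a monomial `x ^ m` to `x ^ γ(m)`. -/
def polyMap (τ : ExtField I k ≃ₐ[k] ExtField I k) (γ : symGroup I) :
    PolyExt I k →+* PolyExt I k :=
  MvPolynomial.eval₂Hom ((MvPolynomial.C).comp (τ : ExtField I k →+* ExtField I k))
    (fun x => MvPolynomial.monomial (symAut γ (Finsupp.single x 1)) 1)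

/-- The action on the lcm-resolution, sending a linear combination `∑ f_c c` of faces to
`∑ γ(f_c) γ(c)`. -/
def lcmMap (τ : ExtField I k ≃ₐ[k] ExtField I k) (γ : symGroup I) (n : ℕ)
    (x : LcmMod I (ExtField I k) n) : LcmMod I (ExtField I k) n :=
  (x.mapRange (polyMap τ γ) (map_zero _)).mapDomain (faceEquiv γ n)

end Canonical

end LcmRes

end

open LcmRes

/-!
The simplicial contraction of the lcm-complex that adds a common upper bound as new largest vertex
shows that the lcm-resolution is a resolution. Its differential splits as `d = d₀ + d₁`, where `d₀`
preserves the largest vertex `aₙ` and is the direct sum of the differentials of the strata `C(a)`,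
while `d₁` lowers it.
A weighted average `V` of matroidal splittings with total weight `1` satisfies `d₀ V d₀ = d₀`, and
then `W = V d₀ V (id - V d₀)` satisfies `W² = 0`, `W d₀ W = W` and `d₀ W d₀ = d₀`. Hence
`Φ = id - d W - W d` gives `W Φ = -W d₁ W`, so each factor of `Φ` makes `W Φ ^ j` lower the largest
vertex once more. Thus `W Φ ^ (1 + dim L') = 0`, which makes `π = Φ ^ (1 + dim L')` idempotent.
If `x` is in the image of `π` then `W x = 0` and `W d x = 0`, hence
`d₀ x = d₀ W d₀ x = -d₀ W d₁ x`. The entries of `d₁` are nontrivial monomials, so `d x` has its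
coefficients in the ideal of the variables: the image of `π` is minimal. It is graded free because
a homogeneous idempotent is conjugate to its constant part, a matrix over a field: the two differ by
a map that strictly lowers the total degree of the generators.
The average over all splittings, with generic weights where `1 / m(a)` does not exist, commutes with
`G_I`, because `G_I` permutes the splittings and the variables `y_σ` in the same way.
-/

noncomputable section

namespace LcmRes

section MatroidalChoice

open Submodule

variable {K ι V : Type*} [Field K] [AddCommGroup V] [Module K V]

theorem range_eq_span_image_single (f : (ι →₀ K) →ₗ[K] V) :
    LinearMap.range f = span K ((fun b => f (Finsupp.single b 1)) '' Set.univ) := by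
  rw [LinearMap.range_eq_map, ← Finsupp.supported_univ, Finsupp.supported_eq_span_single,
    map_span, Set.image_image]

/-- The kernel elements of `f` that differ from a canonical basis element outside `X` by a linear
combination of elements of `X`; when `f` is injective on `span X` they are the elements `z(b)`
of the paper, one for each `b ∉ X` with `f b ∈ f (span X)`. -/
def fundamentalCycles (f : (ι →₀ K) →ₗ[K] V) (X : Set ι) : Set (ι →₀ K) :=
  {z | f z = 0 ∧ ∃ b, b ∉ X ∧
    Finsupp.single b 1 - z ∈ span K ((fun c => Finsupp.single c (1 : K)) '' X)}

/-- The choices made in one homological degree by a matroidal splitting, where `f` is the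
differential and `R` the space of boundaries. -/
structure IsMatroidalChoice (f : (ι →₀ K) →ₗ[K] V) (R : Submodule K (ι →₀ K)) (X : Set ι)
    (Z : Set (ι →₀ K)) : Prop where
  indep : LinearIndepOn K (fun b => f (Finsupp.single b 1)) X
  span_eq : span K ((fun b => f (Finsupp.single b 1)) '' X) = LinearMap.range f
  subset : Z ⊆ fundamentalCycles f X
  indep_mkQ : LinearIndepOn K R.mkQ Z
  span_mkQ : span K (R.mkQ '' Z) = (LinearMap.ker f).map R.mkQ

variable {f : (ι →₀ K) →ₗ[K] V} {R : Submodule K (ι →₀ K)} {X : Set ι} {Z : Set (ι →₀ K)}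

theorem disjoint_span_single_ker (hX : LinearIndepOn K (fun b => f (Finsupp.single b 1)) X) :
    Disjoint (span K ((fun c => Finsupp.single c (1 : K)) '' X)) (LinearMap.ker f) := by
  rw [Set.image_eq_range]
  exact range_ker_disjoint (f := f) (v := fun b : X => Finsupp.single (b : ι) (1 : K)) hX

theorem exists_mem_span_single_map_eq
    (hX : span K ((fun b => f (Finsupp.single b 1)) '' X) = LinearMap.range f) (x : ι →₀ K) :
    ∃ s ∈ span K ((fun c => Finsupp.single c (1 : K)) '' X), f s = f x := by
  have hx : f x ∈ (span K ((fun c => Finsupp.single c (1 : K)) '' X)).map f := by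
    rw [map_span, Set.image_image, hX]
    exact ⟨x, rfl⟩
  exact hx

theorem finite_fundamentalCycles [Finite ι]
    (hX : LinearIndepOn K (fun b => f (Finsupp.single b 1)) X) :
    (fundamentalCycles f X).Finite := by
  choose b hb using fun z : fundamentalCycles f X => z.2.2
  refine Set.finite_coe_iff.1 (Finite.of_injective b fun z z' hzz' => Subtype.ext ?_)
  have hspan : (z - z' : ι →₀ K) ∈ span K ((fun c => Finsupp.single c (1 : K)) '' X) := by
    simpa [hzz'] using sub_mem (hb z').2 (hb z).2
  exact sub_eq_zero.1 (disjoint_def.1 (disjoint_span_single_ker hX) _ hspan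
    (by simp [z.2.1, z'.2.1]))

theorem span_fundamentalCycles_sup_span_single
    (hX : span K ((fun b => f (Finsupp.single b 1)) '' X) = LinearMap.range f) :
    span K (fundamentalCycles f X) ⊔ span K ((fun c => Finsupp.single c (1 : K)) '' X) = ⊤ := by
  rw [eq_top_iff, ← Finsupp.supported_univ (R := K), Finsupp.supported_eq_span_single, span_le]
  rintro _ ⟨b, -, rfl⟩
  by_cases hb : b ∈ X
  · exact mem_sup_right (subset_span ⟨b, hb, rfl⟩)
  · obtain ⟨s, hs, hsb⟩ := exists_mem_span_single_map_eq hX (Finsupp.single b 1)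
    change Finsupp.single b 1 ∈ _
    rw [← sub_add_cancel (Finsupp.single b 1) s]
    refine add_mem_sup (subset_span ⟨?_, b, hb, ?_⟩) hs
    · rw [map_sub, hsb, sub_self]
    · simpa only [sub_sub_cancel] using hs

theorem span_fundamentalCycles
    (hi : LinearIndepOn K (fun b => f (Finsupp.single b 1)) X)
    (hX : span K ((fun b => f (Finsupp.single b 1)) '' X) = LinearMap.range f) :
    span K (fundamentalCycles f X) = LinearMap.ker f := by
  have hle : span K (fundamentalCycles f X) ≤ LinearMap.ker f := span_le.2 fun z hz => hz.1
  refine eq_of_le_of_inf_le_of_sup_le hle ?_ ?_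
    (z := span K ((fun c => Finsupp.single c (1 : K)) '' X))
  · rw [inf_comm, (disjoint_span_single_ker hi).eq_bot]
    exact bot_le
  · rw [span_fundamentalCycles_sup_span_single hX]
    exact le_top

theorem exists_isMatroidalChoice (f : (ι →₀ K) →ₗ[K] V) (R : Submodule K (ι →₀ K)) :
    ∃ X Z, IsMatroidalChoice f R X Z := by
  have hX := linearIndepOn_empty K fun b => f (Finsupp.single b 1)
  set X := hX.extend (Set.empty_subset Set.univ)
  have hXi := hX.linearIndepOn_extend (Set.empty_subset Set.univ)
  have hXs := (hX.span_image_extend_eq_span_image (Set.empty_subset Set.univ)).trans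
    (range_eq_span_image_single f).symm
  have hZ := linearIndepOn_empty K R.mkQ
  have hZt := Set.empty_subset (fundamentalCycles f X)
  refine ⟨X, hZ.extend hZt, hXi, hXs, hZ.extend_subset hZt, hZ.linearIndepOn_extend hZt, ?_⟩
  rw [hZ.span_image_extend_eq_span_image hZt, ← map_span, span_fundamentalCycles hXi hXs]

namespace IsMatroidalChoice

theorem span_single_sup_span_sup (h : IsMatroidalChoice f R X Z) :
    span K ((fun c => Finsupp.single c (1 : K)) '' X) ⊔ span K Z ⊔ R = ⊤ := by
  refine eq_top_iff.2 fun x _ => ?_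
  obtain ⟨s, hs, hsx⟩ := exists_mem_span_single_map_eq h.span_eq x
  have hcycle : R.mkQ (x - s) ∈ (span K Z).map R.mkQ := by
    rw [map_span, h.span_mkQ]
    exact ⟨x - s, by simp [hsx], rfl⟩
  obtain ⟨z, hz, hzx⟩ := hcycle
  have hboundary : x - s - z ∈ R := by
    rw [← ker_mkQ R, LinearMap.mem_ker, map_sub, hzx, sub_self]
  have hsum : x = s + z + (x - s - z) := by abel
  rw [hsum]
  exact add_mem_sup (add_mem_sup hs hz) hboundary

theorem linearIndependent_sumElim (h : IsMatroidalChoice f R X Z) (hR : R ≤ LinearMap.ker f)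
    {κ : Type*} {v : κ → ι →₀ K} (hv : LinearIndependent K v) (hvR : ∀ i, v i ∈ R) :
    LinearIndependent K (Sum.elim (fun c : X => Finsupp.single (c : ι) (1 : K))
      (Sum.elim (fun z : Z => (z : ι →₀ K)) v)) := by
  have hvR' : span K (Set.range v) ≤ R := span_le.2 (Set.range_subset_iff.2 hvR)
  have hZker : span K (Set.range fun z : Z => (z : ι →₀ K)) ≤ LinearMap.ker f :=
    span_le.2 (Set.range_subset_iff.2 fun z => (h.subset z.2).1)
  have hZv := range_ker_disjoint (f := R.mkQ) (v := fun z : Z => (z : ι →₀ K)) h.indep_mkQ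
  rw [ker_mkQ] at hZv
  refine (LinearIndependent.of_comp f h.indep).sum_type
    ((LinearIndependent.of_comp R.mkQ h.indep_mkQ).sum_type hv (hZv.mono_right hvR')) ?_
  refine (range_ker_disjoint (f := f) h.indep).mono_right ?_
  rw [Set.Sum.elim_range, span_union]
  exact sup_le hZker (hvR'.trans hR)

end IsMatroidalChoice

theorem finite_isMatroidalChoice [Finite ι] (f : (ι →₀ K) →ₗ[K] V)
    (R : Submodule K (ι →₀ K)) :
    {p : Set ι × Set (ι →₀ K) | IsMatroidalChoice f R p.1 p.2}.Finite := by
  let S : Set ι → Set (Set ι × Set (ι →₀ K)) := fun X =>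
    {p | p.1 = X ∧ IsMatroidalChoice f R X p.2}
  refine (Set.finite_iUnion (f := S) fun X => ?_).subset fun p hp =>
    Set.mem_iUnion.2 ⟨p.1, rfl, hp⟩
  by_cases hX : LinearIndepOn K (fun b => f (Finsupp.single b 1)) X
  · refine ((Set.finite_singleton X).prod (finite_fundamentalCycles hX).powerset).subset ?_
    exact fun p hp => ⟨hp.1, hp.2.subset⟩
  · exact Set.finite_empty.subset fun p hp => hX hp.2.indep

theorem exists_linearMap_apply_eq {W κ : Type*} [AddCommGroup W] [Module K W]
    {v : κ → V} (hv : LinearIndependent K v) (w : κ → W) :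
    ∃ g : V →ₗ[K] W, ∀ i, g (v i) = w i := by
  obtain ⟨g, hg⟩ := ((Module.Basis.span hv).constr K w).exists_extend
  refine ⟨g, fun i => ?_⟩
  have hgi := LinearMap.congr_fun hg (Module.Basis.span hv i)
  rwa [Module.Basis.constr_basis, LinearMap.comp_apply, Submodule.subtype_apply,
    Module.Basis.span_apply] at hgi

end MatroidalChoice

section MatroidalSplitting

variable {K : Type*} [Field K] {B : ℕ → Type*}
  {d : ∀ n, (B (n + 1) →₀ K) →ₗ[K] (B n →₀ K)} {D D' : ∀ n, (B n →₀ K) →ₗ[K] (B (n + 1) →₀ K)}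

theorem isMatroidal_iff : IsMatroidal d D ↔
    ∃ (X : ∀ n, Set (B n)) (Z : ∀ n, Set (B n →₀ K)), ∀ n,
      IsMatroidalChoice (dFrom d n) (LinearMap.range (d n)) (X n) (Z n) ∧
      (∀ c ∈ X (n + 1), D n (d n (Finsupp.single c 1)) = Finsupp.single c 1) ∧
      (∀ c ∈ X n, D n (Finsupp.single c 1) = 0) ∧
      (∀ z ∈ Z n, D n z = 0) := by
  constructor
  · rintro ⟨X, Z, h⟩
    refine ⟨X, Z, fun n => ?_⟩
    obtain ⟨⟨hXi, hXs⟩, hZ, ⟨hZi, hZs⟩, hD⟩ := h n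
    exact ⟨⟨hXi, hXs, hZ, hZi, hZs⟩, hD⟩
  · rintro ⟨X, Z, h⟩
    refine ⟨X, Z, fun n => ?_⟩
    obtain ⟨⟨hXi, hXs, hZ, hZi, hZs⟩, hD⟩ := h n
    exact ⟨⟨hXi, hXs⟩, hZ, ⟨hZi, hZs⟩, hD⟩

theorem IsMatroidal.d_D_d (h : IsMatroidal d D) (n : ℕ) (x : B (n + 1) →₀ K) :
    d n (D n (d n x)) = d n x := by
  obtain ⟨X, Z, h⟩ := isMatroidal_iff.1 h
  obtain ⟨s, hs, hsx⟩ := exists_mem_span_single_map_eq (h (n + 1)).1.span_eq x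
  change d n s = d n x at hsx
  have hD : Submodule.span K ((fun c => Finsupp.single c (1 : K)) '' X (n + 1)) ≤
      LinearMap.eqLocus (D n ∘ₗ d n) LinearMap.id := by
    rw [Submodule.span_le]
    rintro _ ⟨c, hc, rfl⟩
    exact (h n).2.1 c hc
  rw [← hsx]
  exact congrArg (d n) (hD hs)

theorem linearMap_eq_of_isMatroidalChoice {n : ℕ} {X : Set (B n)} {X' : Set (B (n + 1))}
    {Z : Set (B n →₀ K)}
    (hZ : IsMatroidalChoice (dFrom d n) (LinearMap.range (d n)) X Z)
    (hX' : Submodule.span K ((fun b => d n (Finsupp.single b 1)) '' X') = LinearMap.range (d n))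
    {L L' : (B n →₀ K) →ₗ[K] (B (n + 1) →₀ K)}
    (hd : ∀ c ∈ X', L (d n (Finsupp.single c 1)) = L' (d n (Finsupp.single c 1)))
    (hLX : ∀ c ∈ X, L (Finsupp.single c 1) = L' (Finsupp.single c 1))
    (hLZ : ∀ z ∈ Z, L z = L' z) : L = L' := by
  rw [← LinearMap.eqLocus_eq_top, eq_top_iff, ← hZ.span_single_sup_span_sup, ← hX']
  refine sup_le (sup_le ?_ (Submodule.span_le.2 hLZ)) ?_ <;> rw [Submodule.span_le]
  · rintro _ ⟨c, hc, rfl⟩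
    exact hLX c hc
  · rintro _ ⟨c, hc, rfl⟩
    exact hd c hc

theorem finite_setOf_isMatroidal [∀ n, Finite (B n)] {N : ℕ} (hN : ∀ n, N ≤ n → IsEmpty (B n))
    (d : ∀ n, (B (n + 1) →₀ K) →ₗ[K] (B n →₀ K)) : {D | IsMatroidal d D}.Finite := by
  choose X Z h using fun D : {D | IsMatroidal d D} => isMatroidal_iff.1 D.2
  have := fun n => (finite_isMatroidalChoice (dFrom d n) (LinearMap.range (d n))).to_subtype
  let choices : {D | IsMatroidal d D} → ∀ n : Fin (N + 1),
      {p : Set (B n) × Set (B n →₀ K) |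
        IsMatroidalChoice (dFrom d n) (LinearMap.range (d n)) p.1 p.2} :=
    fun D n => ⟨(X D n, Z D n), (h D n).1⟩
  refine Set.finite_coe_iff.1 (Finite.of_injective choices fun D D' hDD' => Subtype.ext ?_)
  have hchoice : ∀ n < N + 1, X D n = X D' n ∧ Z D n = Z D' n := fun n hn =>
    Prod.mk.inj (congrArg Subtype.val (congrFun hDD' ⟨n, hn⟩))
  funext n
  rcases le_or_gt N n with hn | hn
  · have := hN n hn
    exact Subsingleton.elim _ _
  obtain ⟨hX, hZ⟩ := hchoice n (by lia)
  have hX' := (hchoice (n + 1) (by lia)).1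
  obtain ⟨hc, hDd, hDX, hDZ⟩ := h D n
  obtain ⟨-, hDd', hDX', hDZ'⟩ := h D' n
  refine linearMap_eq_of_isMatroidalChoice hc (h D (n + 1)).1.span_eq (fun c hc => ?_)
    (fun c hc => ?_) fun z hz => ?_
  · rw [hDd c hc, hDd' c (hX' ▸ hc)]
  · rw [hDX c hc, hDX' c (hX ▸ hc)]
  · rw [hDZ z hz, hDZ' z (hZ ▸ hz)]

theorem exists_isMatroidal (hd : ∀ n x, d n (d (n + 1) x) = 0) :
    ∃ D, IsMatroidal d D := by
  choose X Z h using fun n => exists_isMatroidalChoice (dFrom d n) (LinearMap.range (d n))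
  have hcomplex : ∀ n, LinearMap.range (d n) ≤ LinearMap.ker (dFrom d n) := by
    rintro (_ | n) _ ⟨x, rfl⟩
    · rfl
    · exact hd n x
  choose D hD using fun n => exists_linearMap_apply_eq
    ((h n).linearIndependent_sumElim (hcomplex n) (h (n + 1)).indep fun _ => ⟨_, rfl⟩)
    (Sum.elim 0 (Sum.elim 0 fun c : X (n + 1) => Finsupp.single (c : B (n + 1)) (1 : K)))
  exact ⟨D, isMatroidal_iff.2 ⟨X, Z, fun n => ⟨h n, fun c hc => hD n (.inr (.inr ⟨c, hc⟩)),
    fun c hc => hD n (.inl ⟨c, hc⟩), fun z hz => hD n (.inr (.inl ⟨z, hz⟩))⟩⟩⟩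

end MatroidalSplitting

section LcmPoset

variable {X : Type*} {I : AddSemigroupIdeal (X →₀ ℕ)}

instance finite_minGens [Finite X] : Finite (minGens I) :=
  Set.Finite.to_subtype <| WellQuasiOrderedLE.finite_of_isAntichain fun _ ha _ hb hab hle =>
    hab (le_antisymm hle (hb.2 ha.1 hle))

instance finite_lcmPoset [Finite (minGens I)] : Finite (lcmPoset I) := by
  refine ((Set.toFinite (minGens I)).supClosure.subset ?_).to_subtype
  rintro _ ⟨s, hs, hsI, rfl⟩
  exact ⟨s, hs, hsI, Finset.sup'_eq_sup hs id⟩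

theorem mem_ideal_of_le {a e : X →₀ ℕ} (ha : a ∈ I) (h : a ≤ e) : e ∈ I := by
  obtain ⟨c, rfl⟩ := exists_add_of_le h
  rw [add_comm]
  exact I.add_mem c ha

theorem mem_ideal_of_mem_lcmPoset {a : X →₀ ℕ} (ha : a ∈ lcmPoset I) : a ∈ I := by
  obtain ⟨s, ⟨g, hg⟩, hs, rfl⟩ := ha
  exact mem_ideal_of_le (hs hg).1 (Finset.le_sup (f := id) hg)

theorem exists_greatest_lcmPoset_le [Finite (minGens I)] {e : X →₀ ℕ} (he : e ∈ I) :
    ∃ m : lcmPoset I, (m : X →₀ ℕ) ≤ e ∧ ∀ a : lcmPoset I, (a : X →₀ ℕ) ≤ e → a ≤ m := by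
  classical
  obtain ⟨g, hmin, hg⟩ := exists_minimal_le_of_wellFoundedLT (· ∈ I) e he
  let s := (Set.toFinite (minGens I)).toFinset.filter (· ≤ e)
  refine ⟨⟨s.sup id, s, ⟨g, by simpa [s, minGens, hg] using hmin⟩, fun x hx => ?_, rfl⟩, ?_, ?_⟩
  · simp only [s, Finset.coe_filter, Set.Finite.mem_toFinset] at hx
    exact hx.1
  · exact Finset.sup_le fun x hx => (Finset.mem_filter.1 hx).2
  · rintro ⟨a, ha⟩ hle
    obtain ⟨t, ht0, ht, rfl⟩ := ha
    refine Finset.sup_le (α := X →₀ ℕ) (s := t) fun x hx => ?_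
    refine Finset.le_sup (α := X →₀ ℕ) (f := id) (s := s) (Finset.mem_filter.2 ⟨?_, ?_⟩)
    · simpa using ht hx
    · exact (Finset.le_sup (α := X →₀ ℕ) (f := id) hx).trans hle

end LcmPoset

section Faces

variable {X : Type*} {I : AddSemigroupIdeal (X →₀ ℕ)}

instance finite_face [Finite (lcmPoset I)] (n : ℕ) : Finite (Face I n) := DFunLike.finite _

theorem Face.lt_card [Finite (lcmPoset I)] {n : ℕ} (c : Face I n) : n < Nat.card (lcmPoset I) := by
  have := Finite.card_le_of_embedding c.toEmbedding
  simpa using this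

theorem Face.le_lcmDim [Finite (lcmPoset I)] {n : ℕ} (c : Face I n) : n ≤ lcmDim I :=
  le_csSup ⟨Nat.card (lcmPoset I), fun _ ⟨c⟩ => c.lt_card.le⟩ ⟨c⟩

theorem isEmpty_stratumFace [Finite (lcmPoset I)] (a : lcmPoset I) (n : ℕ)
    (hn : Nat.card (lcmPoset I) ≤ n) : IsEmpty (StratumFace a n) :=
  ⟨fun c => hn.not_gt c.1.lt_card⟩

theorem length_le_lcmDim [Finite (lcmPoset I)] (p : LTSeries (lcmPoset I)) :
    p.length ≤ lcmDim I :=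
  Face.le_lcmDim (OrderEmbedding.ofStrictMono p.toFun p.strictMono)

theorem Face.del_top_le {n : ℕ} (c : Face I (n + 1)) (i : Fin (n + 2)) : (c.del i).top ≤ c.top :=
  c.monotone (Fin.le_last _)

theorem Face.del_castSucc_top {n : ℕ} (c : Face I (n + 1)) (i : Fin (n + 1)) :
    (c.del i.castSucc).top = c.top := by
  change c (i.castSucc.succAbove (Fin.last n)) = c (Fin.last (n + 1))
  rw [Fin.succAbove_ne_last_last (Fin.castSucc_lt_last i).ne]

theorem Face.del_last_top_lt {n : ℕ} (c : Face I (n + 1)) : (c.del (Fin.last _)).top < c.top := by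
  change c ((Fin.last _).succAbove (Fin.last n)) < c (Fin.last (n + 1))
  rw [Fin.succAbove_last, c.lt_iff_lt]
  exact Fin.castSucc_lt_last _

theorem sum_neg_one_pow_smul_del_del {A : Type*} [AddCommGroup A] {n : ℕ} (g : Face I n → A)
    (c : Face I (n + 2)) :
    ∑ i : Fin (n + 3), ∑ j : Fin (n + 2),
      ((-1 : ℤ) ^ ((i : ℕ) + (j : ℕ))) • g ((c.del i).del j) = 0 := by
  rw [← Fintype.sum_prod_type' (f := fun (i : Fin (n + 3)) (j : Fin (n + 2)) =>
    ((-1 : ℤ) ^ ((i : ℕ) + (j : ℕ))) • g ((c.del i).del j))]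
  refine Finset.sum_involution (fun p _ => (p.1.succAbove p.2, p.2.predAbove p.1)) ?_ ?_ ?_ ?_
  · rintro ⟨i, j⟩ -
    have : ((c.del (i.succAbove j)).del (j.predAbove i)) = (c.del i).del j := by
      ext k : 1
      exact congrArg c (Fin.succAbove_succAbove_succAbove_predAbove i j k)
    simp only [this, Fin.neg_one_pow_succAbove_add_predAbove, neg_smul, add_neg_cancel]
  · rintro ⟨i, j⟩ - - h
    exact Fin.succAbove_ne i j (Prod.ext_iff.1 h).1
  · intros
    exact Finset.mem_univ _
  · rintro ⟨i, j⟩ -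
    exact Prod.ext (Fin.succAbove_succAbove_predAbove i j)
      (Fin.predAbove_predAbove_succAbove i j)

open Classical in
theorem stratumD_single (S : Type*) [CommRing S] (a : lcmPoset I) (n : ℕ)
    (c : StratumFace a (n + 1)) :
    stratumD S a n (Finsupp.single c 1) = ∑ i : Fin (n + 2), ((-1 : ℤ) ^ (i : ℕ)) •
      if h : (c.1.del i).top = a then Finsupp.single ⟨c.1.del i, h⟩ (1 : S) else 0 := by
  rw [stratumD, Finsupp.linearCombination_single, one_smul]
  refine Finset.sum_congr rfl fun i _ => ?_
  split_ifs with h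
  · rw [Finsupp.smul_single]
    simp
  · rw [smul_zero]

theorem stratumD_comp (S : Type*) [CommRing S] (a : lcmPoset I) (n : ℕ)
    (x : StratumFace a (n + 2) →₀ S) : stratumD S a n (stratumD S a (n + 1) x) = 0 := by
  classical
  induction x using Finsupp.induction_linear with
  | zero => simp
  | add x y hx hy => simp [hx, hy]
  | single c r =>
    rw [← mul_one r, ← smul_eq_mul, ← Finsupp.smul_single, map_smul, map_smul, stratumD_single,
      map_sum]
    have := sum_neg_one_pow_smul_del_del (fun b : Face I n => if h : b.top = a then
      Finsupp.single (⟨b, h⟩ : StratumFace a n) (1 : S) else 0) c.1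
    refine (congrArg (r • ·) (Eq.trans (Finset.sum_congr rfl fun i _ => ?_) this)).trans
      (smul_zero r)
    rw [map_zsmul]
    simp only [pow_add, mul_smul]
    rw [← Finset.smul_sum]
    congr 1
    split_ifs with h
    · rw [stratumD_single]
    · rw [map_zero, eq_comm]
      refine Finset.sum_eq_zero fun j _ => ?_
      rw [dif_neg, smul_zero]
      intro h'
      refine h (le_antisymm ((c.1.del_top_le i).trans_eq c.2) ?_)
      exact h'.ge.trans (Face.del_top_le _ _)

theorem lcmD_single (S : Type*) [CommRing S] (n : ℕ) (c : Face I (n + 1))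
    (f : MvPolynomial X S) :
    lcmD I S n (Finsupp.single c f) = ∑ i : Fin (n + 2), ((-1 : ℤ) ^ (i : ℕ)) •
      Finsupp.single (c.del i)
        (f * MvPolynomial.monomial ((c.top : X →₀ ℕ) - ((c.del i).top : X →₀ ℕ)) (1 : S)) := by
  rw [lcmD, Finsupp.linearCombination_single, Finset.smul_sum]
  refine Finset.sum_congr rfl fun i _ => ?_
  have hsign : MvPolynomial.monomial ((c.top : X →₀ ℕ) - ((c.del i).top : X →₀ ℕ))
      ((-1 : S) ^ (i : ℕ)) = ((-1 : ℤ) ^ (i : ℕ)) •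
        MvPolynomial.monomial ((c.top : X →₀ ℕ) - ((c.del i).top : X →₀ ℕ)) (1 : S) := by
    rw [← map_zsmul, zsmul_one]
    push_cast
    rfl
  rw [hsign, Finsupp.smul_single, smul_eq_mul, mul_smul_comm, Finsupp.smul_single]

theorem lcmD_comp (S : Type*) [CommRing S] (n : ℕ) (x : LcmMod I S (n + 2)) :
    lcmD I S n (lcmD I S (n + 1) x) = 0 := by
  induction x using Finsupp.induction_linear with
  | zero => simp
  | add x y hx hy => simp [hx, hy]
  | single c f =>
    rw [lcmD_single, map_sum]
    have := sum_neg_one_pow_smul_del_del (fun b : Face I n => Finsupp.single b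
      (f * MvPolynomial.monomial ((c.top : X →₀ ℕ) - (b.top : X →₀ ℕ)) (1 : S))) c
    rw [← this]
    refine Finset.sum_congr rfl fun i _ => ?_
    rw [map_zsmul, lcmD_single, Finset.smul_sum]
    refine Finset.sum_congr rfl fun j _ => ?_
    rw [smul_smul, pow_add, mul_assoc f, MvPolynomial.monomial_mul, one_mul,
      tsub_add_tsub_cancel (α := X →₀ ℕ) (c.del_top_le i) ((c.del i).del_top_le j)]

end Faces

section Snoc

variable {X : Type*} {I : AddSemigroupIdeal (X →₀ ℕ)}

/-- The face obtained by adding a new largest vertex. -/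
def Face.snoc {n : ℕ} (c : Face I n) (m : lcmPoset I) (h : c.top < m) : Face I (n + 1) :=
  OrderEmbedding.ofStrictMono (Fin.snoc (α := fun _ => lcmPoset I) c m) (by
    intro i j hij
    induction j using Fin.lastCases with
    | last =>
      rw [Fin.snoc_last]
      obtain ⟨i, rfl⟩ := Fin.exists_castSucc_eq.2 hij.ne
      rw [Fin.snoc_castSucc]
      exact (c.monotone (Fin.le_last i)).trans_lt h
    | cast j =>
      obtain ⟨i, rfl⟩ := Fin.exists_castSucc_eq.2 (hij.trans (Fin.castSucc_lt_last j)).ne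
      rw [Fin.snoc_castSucc, Fin.snoc_castSucc]
      exact c.strictMono (Fin.castSucc_lt_castSucc_iff.1 hij))

theorem Face.snoc_top {n : ℕ} (c : Face I n) (m : lcmPoset I) (h : c.top < m) :
    (c.snoc m h).top = m :=
  Fin.snoc_last (α := fun _ => lcmPoset I) m c

theorem Face.snoc_castSucc {n : ℕ} (c : Face I n) (m : lcmPoset I) (h : c.top < m)
    (i : Fin (n + 1)) : c.snoc m h i.castSucc = c i :=
  Fin.snoc_castSucc (α := fun _ => lcmPoset I) m c i

theorem Face.snoc_del_last {n : ℕ} (c : Face I n) (m : lcmPoset I) (h : c.top < m) :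
    (c.snoc m h).del (Fin.last _) = c := by
  ext i : 1
  change c.snoc m h ((Fin.last _).succAbove i) = c i
  rw [Fin.succAbove_last, c.snoc_castSucc]

theorem Face.snoc_del_castSucc {n : ℕ} (c : Face I (n + 1)) (m : lcmPoset I) (h : c.top < m)
    (i : Fin (n + 2)) : (c.snoc m h).del i.castSucc =
      (c.del i).snoc m ((c.del_top_le i).trans_lt h) := by
  ext j : 1
  induction j using Fin.lastCases with
  | last =>
    exact (Face.del_castSucc_top (c.snoc m h) i).trans ((c.snoc_top m h).trans
      (Face.snoc_top _ _ _).symm)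
  | cast j =>
    rw [Face.snoc_castSucc]
    change c.snoc m h (i.castSucc.succAbove j.castSucc) = c (i.succAbove j)
    rw [Fin.castSucc_succAbove_castSucc, Face.snoc_castSucc]

theorem Face.del_last_snoc {n : ℕ} (c : Face I (n + 1)) :
    (c.del (Fin.last _)).snoc c.top c.del_last_top_lt = c := by
  ext j : 1
  induction j using Fin.lastCases with
  | last => exact Face.snoc_top _ _ _
  | cast j =>
    rw [Face.snoc_castSucc]
    change c ((Fin.last _).succAbove j) = _
    rw [Fin.succAbove_last]

theorem Face.ext_top {c c' : Face I 0} (h : c.top = c'.top) : c = c' := by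
  ext i : 1
  rw [Fin.eq_zero i]
  exact h

/-- The `0`-face with vertex `a`. -/
def Face.vertex (a : lcmPoset I) : Face I 0 :=
  OrderEmbedding.ofStrictMono (fun _ => a) (fun i j h => by
    rw [Fin.eq_zero i, Fin.eq_zero j] at h
    exact absurd h (lt_irrefl _))

theorem Face.vertex_top (a : lcmPoset I) : (Face.vertex a).top = a := rfl

end Snoc

section MonomialLift

variable {X S P ι : Type*} [CommRing S] [AddCommGroup P] [Module S P]

/-- The `S`-linear map out of a free `S[X]`-module that has given values on the `S`-basis of
elements `x ^ e c`. -/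
def monomialLift (g : ι → (X →₀ ℕ) → P) : (ι →₀ MvPolynomial X S) →ₗ[S] P :=
  Finsupp.lsum S fun c => (MvPolynomial.basisMonomials X S).constr S (g c)

theorem monomialLift_single_monomial (g : ι → (X →₀ ℕ) → P) (c : ι) (e : X →₀ ℕ) :
    monomialLift (S := S) g (Finsupp.single c (MvPolynomial.monomial e 1)) = g c e := by
  rw [monomialLift, Finsupp.lsum_single]
  exact (MvPolynomial.basisMonomials X S).constr_basis S (g c) e

theorem monomial_hom_ext {f g : (ι →₀ MvPolynomial X S) →ₗ[S] P}
    (h : ∀ c e, f (Finsupp.single c (MvPolynomial.monomial e 1)) =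
      g (Finsupp.single c (MvPolynomial.monomial e 1))) : f = g := by
  refine Finsupp.lhom_ext' fun c => (MvPolynomial.basisMonomials X S).ext fun e => ?_
  simpa using h c e

end MonomialLift

section Augmentation

variable {X : Type*} (I : AddSemigroupIdeal (X →₀ ℕ)) (S : Type*) [CommRing S]

theorem lcmAug_single (c : Face I 0) (f : MvPolynomial X S) :
    lcmAug I S (Finsupp.single c f) = f * MvPolynomial.monomial (c.top : X →₀ ℕ) 1 := by
  rw [lcmAug, Finsupp.linearCombination_single, smul_eq_mul]

theorem lcmD_single_monomial (n : ℕ) (c : Face I (n + 1)) (e : X →₀ ℕ) :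
    lcmD I S n (Finsupp.single c (MvPolynomial.monomial e 1)) =
      ∑ i : Fin (n + 2), ((-1 : ℤ) ^ (i : ℕ)) • Finsupp.single (c.del i)
        (MvPolynomial.monomial (e + (c.top : X →₀ ℕ) - ((c.del i).top : X →₀ ℕ)) (1 : S)) := by
  rw [lcmD_single]
  refine Finset.sum_congr rfl fun i _ => ?_
  rw [MvPolynomial.monomial_mul, one_mul, add_tsub_assoc_of_le]
  exact c.del_top_le i

theorem Face.del_top_le_add {n : ℕ} (c : Face I (n + 1)) (i : Fin (n + 2)) (e : X →₀ ℕ) :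
    ((c.del i).top : X →₀ ℕ) ≤ e + (c.top : X →₀ ℕ) :=
  le_trans (Subtype.coe_le_coe.2 (c.del_top_le i)) le_add_self

theorem lcmAug_lcmD (x : LcmMod I S 1) : lcmAug I S (lcmD I S 0 x) = 0 := by
  suffices h : (lcmAug I S).restrictScalars S ∘ₗ (lcmD I S 0).restrictScalars S = 0 from
    LinearMap.congr_fun h x
  refine monomial_hom_ext fun c e => ?_
  change lcmAug I S (lcmD I S 0 (Finsupp.single c (MvPolynomial.monomial e 1))) = 0
  rw [lcmD_single_monomial, map_sum, Fin.sum_univ_two]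
  simp [lcmAug_single, MvPolynomial.monomial_mul, tsub_add_cancel_of_le (c.del_top_le_add I _ _)]

end Augmentation

section Cone

variable {X : Type*} {I : AddSemigroupIdeal (X →₀ ℕ)} [Finite (minGens I)]

/-- The largest element of `L'` dividing the monomial `e` of `I`, the apex of the cone that
contracts the lcm-resolution in multidegree `e`. -/
def maxBelow {e : X →₀ ℕ} (he : e ∈ I) : lcmPoset I := (exists_greatest_lcmPoset_le he).choose

theorem maxBelow_le {e : X →₀ ℕ} (he : e ∈ I) : (maxBelow he : X →₀ ℕ) ≤ e :=
  (exists_greatest_lcmPoset_le he).choose_spec.1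

theorem le_maxBelow {e : X →₀ ℕ} (he : e ∈ I) {a : lcmPoset I} (ha : (a : X →₀ ℕ) ≤ e) :
    a ≤ maxBelow he :=
  (exists_greatest_lcmPoset_le he).choose_spec.2 a ha

variable (S : Type*) [CommRing S]

open Classical in
/-- The cone over the face `c` in multidegree `e`: adjoin the new largest vertex `maxBelow e`, with
a sign. It is zero if `c` already has this vertex. -/
def coneTerm {n : ℕ} (c : Face I n) {e : X →₀ ℕ} (he : e ∈ I) : LcmMod I S (n + 1) :=
  if h : c.top < maxBelow he then
    ((-1 : ℤ) ^ (n + 1)) • Finsupp.single (c.snoc (maxBelow he) h)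
      (MvPolynomial.monomial (e - (maxBelow he : X →₀ ℕ)) (1 : S))
  else 0

theorem coneTerm_of_lt {n : ℕ} (c : Face I n) {e : X →₀ ℕ} (he : e ∈ I)
    (h : c.top < maxBelow he) : coneTerm S c he =
      ((-1 : ℤ) ^ (n + 1)) • Finsupp.single (c.snoc (maxBelow he) h)
        (MvPolynomial.monomial (e - (maxBelow he : X →₀ ℕ)) (1 : S)) :=
  dif_pos h

theorem coneTerm_of_eq {n : ℕ} (c : Face I n) {e : X →₀ ℕ} (he : e ∈ I)
    (h : c.top = maxBelow he) : coneTerm S c he = 0 :=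
  dif_neg fun h' => h'.ne h

theorem lcmD_coneTerm_of_lt {n : ℕ} (c : Face I n) {e : X →₀ ℕ} (he : e ∈ I)
    (h : c.top < maxBelow he) : lcmD I S n (coneTerm S c he) =
      (∑ i : Fin (n + 1), ((-1 : ℤ) ^ (n + 1 + (i : ℕ))) •
        Finsupp.single ((c.snoc _ h).del i.castSucc)
          (MvPolynomial.monomial (e - (maxBelow he : X →₀ ℕ)) (1 : S))) +
      Finsupp.single c (MvPolynomial.monomial (e - (c.top : X →₀ ℕ)) 1) := by
  rw [coneTerm_of_lt S c he h, map_zsmul, lcmD_single_monomial, Fin.sum_univ_castSucc,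
    smul_add, Finset.smul_sum]
  congr 1
  · refine Finset.sum_congr rfl fun i _ => ?_
    rw [smul_smul, ← pow_add, Face.del_castSucc_top, add_tsub_cancel_right]
    rfl
  · rw [smul_smul, ← pow_add, Fin.val_last, ← two_mul, pow_mul, neg_one_sq, one_pow, one_smul,
      Face.snoc_del_last, Face.snoc_top, tsub_add_cancel_of_le (maxBelow_le he)]

theorem lcmD_coneTerm_add_sum_of_lt {n : ℕ} (c : Face I (n + 1)) {e : X →₀ ℕ} (he : e ∈ I)
    (h : c.top < maxBelow he) :
    lcmD I S (n + 1) (coneTerm S c he) +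
        ∑ i : Fin (n + 2), ((-1 : ℤ) ^ (i : ℕ)) • coneTerm S (c.del i) he =
      Finsupp.single c (MvPolynomial.monomial (e - (c.top : X →₀ ℕ)) 1) := by
  rw [lcmD_coneTerm_of_lt S c he h, add_right_comm, ← Finset.sum_add_distrib,
    Finset.sum_eq_zero, zero_add]
  intro i _
  have hsign : (-1 : ℤ) ^ (n + 1 + 1 + (i : ℕ)) = -(-1) ^ ((i : ℕ) + (n + 1)) := by ring
  rw [coneTerm_of_lt S (c.del i) he ((c.del_top_le i).trans_lt h), smul_smul, ← pow_add,
    Face.snoc_del_castSucc, hsign, neg_smul, neg_add_cancel]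

theorem lcmD_coneTerm_add_sum_of_eq {n : ℕ} (c : Face I (n + 1)) {e : X →₀ ℕ} (he : e ∈ I)
    (h : c.top = maxBelow he) :
    lcmD I S (n + 1) (coneTerm S c he) +
        ∑ i : Fin (n + 2), ((-1 : ℤ) ^ (i : ℕ)) • coneTerm S (c.del i) he =
      Finsupp.single c (MvPolynomial.monomial (e - (c.top : X →₀ ℕ)) 1) := by
  have hlast : (c.del (Fin.last (n + 1))).top < maxBelow he := h ▸ c.del_last_top_lt
  have hsnoc : (c.del (Fin.last (n + 1))).snoc _ hlast = c := by
    conv_rhs => rw [← c.del_last_snoc]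
    congr 1
    exact h.symm
  rw [coneTerm_of_eq S c he h, map_zero, zero_add, Fin.sum_univ_castSucc,
    Finset.sum_eq_zero, zero_add]
  · rw [coneTerm_of_lt S _ he hlast, smul_smul, ← pow_add, Fin.val_last, ← two_mul, pow_mul,
      neg_one_sq, one_pow, one_smul, hsnoc, h]
  · intro i _
    rw [coneTerm_of_eq S _ he ((Face.del_castSucc_top c i).trans h), smul_zero]

end Cone

section Contraction

variable {X : Type*} (I : AddSemigroupIdeal (X →₀ ℕ)) [Finite (minGens I)] (S : Type*) [CommRing S]

omit [Finite (minGens I)] in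
theorem add_top_mem {n : ℕ} (c : Face I n) (e : X →₀ ℕ) : e + (c.top : X →₀ ℕ) ∈ I :=
  I.add_mem e (mem_ideal_of_mem_lcmPoset c.top.2)

/-- The contracting homotopy of the lcm-resolution, `S`-linear but not `S[X]`-linear. -/
def cone (n : ℕ) : LcmMod I S n →ₗ[S] LcmMod I S (n + 1) :=
  monomialLift fun c e => coneTerm S c (add_top_mem I c e)

open Classical in
/-- The contracting homotopy of the lcm-resolution in degree `-1`; monomials outside `I` are sent
to zero. -/
def coneAug : MvPolynomial X S →ₗ[S] LcmMod I S 0 :=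
  (MvPolynomial.basisMonomials X S).constr S fun e =>
    if he : e ∈ I then Finsupp.single (Face.vertex (maxBelow he))
      (MvPolynomial.monomial (e - (maxBelow he : X →₀ ℕ)) (1 : S)) else 0

theorem cone_single {n : ℕ} (c : Face I n) (e : X →₀ ℕ) :
    cone I S n (Finsupp.single c (MvPolynomial.monomial e 1)) =
      coneTerm S c (add_top_mem I c e) :=
  monomialLift_single_monomial _ _ _

theorem coneAug_monomial {e : X →₀ ℕ} (he : e ∈ I) :
    coneAug I S (MvPolynomial.monomial e 1) = Finsupp.single (Face.vertex (maxBelow he))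
      (MvPolynomial.monomial (e - (maxBelow he : X →₀ ℕ)) (1 : S)) := by
  refine ((MvPolynomial.basisMonomials X S).constr_basis S _ e).trans ?_
  rw [dif_pos he]

theorem cone_lcmD_single (n : ℕ) (c : Face I (n + 1)) (e : X →₀ ℕ) :
    cone I S n (lcmD I S n (Finsupp.single c (MvPolynomial.monomial e 1))) =
      ∑ i : Fin (n + 2), ((-1 : ℤ) ^ (i : ℕ)) • coneTerm S (c.del i) (add_top_mem I c e) := by
  rw [lcmD_single_monomial, map_sum]
  refine Finset.sum_congr rfl fun i _ => ?_
  rw [map_zsmul, cone_single]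
  congr! 2
  exact tsub_add_cancel_of_le (c.del_top_le_add I i e)

theorem lcmD_cone_add_cone_lcmD (n : ℕ) (x : LcmMod I S (n + 1)) :
    lcmD I S (n + 1) (cone I S (n + 1) x) + cone I S n (lcmD I S n x) = x := by
  suffices h : (lcmD I S (n + 1)).restrictScalars S ∘ₗ cone I S (n + 1) +
      cone I S n ∘ₗ (lcmD I S n).restrictScalars S = LinearMap.id from LinearMap.congr_fun h x
  refine monomial_hom_ext fun c e => ?_
  change lcmD I S (n + 1) (cone I S (n + 1) (Finsupp.single c (MvPolynomial.monomial e 1))) +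
    cone I S n (lcmD I S n (Finsupp.single c (MvPolynomial.monomial e 1))) =
      Finsupp.single c (MvPolynomial.monomial e 1)
  rw [cone_single, cone_lcmD_single]
  have hsingle := add_tsub_cancel_right e (c.top : X →₀ ℕ)
  rcases (le_maxBelow (add_top_mem I c e) le_add_self : c.top ≤ _).lt_or_eq with h | h
  · rw [lcmD_coneTerm_add_sum_of_lt S c _ h, hsingle]
  · rw [lcmD_coneTerm_add_sum_of_eq S c _ h, hsingle]

theorem lcmD_cone_add_coneAug_lcmAug (x : LcmMod I S 0) :
    lcmD I S 0 (cone I S 0 x) + coneAug I S (lcmAug I S x) = x := by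
  suffices h : (lcmD I S 0).restrictScalars S ∘ₗ cone I S 0 +
      coneAug I S ∘ₗ (lcmAug I S).restrictScalars S = LinearMap.id from LinearMap.congr_fun h x
  refine monomial_hom_ext fun c e => ?_
  change lcmD I S 0 (cone I S 0 (Finsupp.single c (MvPolynomial.monomial e 1))) +
    coneAug I S (lcmAug I S (Finsupp.single c (MvPolynomial.monomial e 1))) =
      Finsupp.single c (MvPolynomial.monomial e 1)
  have he := add_top_mem I c e
  have hsingle := add_tsub_cancel_right e (c.top : X →₀ ℕ)
  rw [cone_single, lcmAug_single, MvPolynomial.monomial_mul, one_mul, coneAug_monomial I S he]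
  rcases (le_maxBelow he le_add_self : c.top ≤ _).lt_or_eq with h | h
  · have hdel : (c.snoc _ h).del (Fin.castSucc 0) = Face.vertex (maxBelow he) :=
      Face.ext_top ((Face.del_castSucc_top _ _).trans (Face.snoc_top _ _ _))
    rw [lcmD_coneTerm_of_lt S c he h, Fin.sum_univ_one, hsingle, hdel]
    simp
  · have hvertex : Face.vertex (maxBelow he) = c := Face.ext_top h.symm
    rw [coneTerm_of_eq S c he h, map_zero, zero_add, hvertex, ← h, hsingle]

theorem lcmAug_coneAug_monomial {e : X →₀ ℕ} (he : e ∈ I) :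
    lcmAug I S (coneAug I S (MvPolynomial.monomial e 1)) = MvPolynomial.monomial e 1 := by
  rw [coneAug_monomial I S he, lcmAug_single, MvPolynomial.monomial_mul, one_mul,
    Face.vertex_top, tsub_add_cancel_of_le (maxBelow_le he)]

theorem exact_lcmD (n : ℕ) : Function.Exact (lcmD I S (n + 1)) (lcmD I S n) := by
  refine fun x => ⟨fun hx => ⟨cone I S (n + 1) x, ?_⟩, ?_⟩
  · simpa only [hx, map_zero, add_zero] using lcmD_cone_add_cone_lcmD I S n x
  · rintro ⟨y, rfl⟩
    exact lcmD_comp S n y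

theorem exact_lcmAug : Function.Exact (lcmD I S 0) (lcmAug I S) := by
  refine fun x => ⟨fun hx => ⟨cone I S 0 x, ?_⟩, ?_⟩
  · simpa only [hx, map_zero, add_zero] using lcmD_cone_add_coneAug_lcmAug I S x
  · rintro ⟨y, rfl⟩
    exact lcmAug_lcmD I S y

theorem range_lcmAug : LinearMap.range (lcmAug I S) = monomialIdeal I S := by
  apply le_antisymm
  · rw [lcmAug, Finsupp.range_linearCombination]
    refine Ideal.span_mono ?_
    rintro _ ⟨c, rfl⟩
    exact ⟨_, mem_ideal_of_mem_lcmPoset c.top.2, rfl⟩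
  · refine Ideal.span_le.2 ?_
    rintro _ ⟨e, he, rfl⟩
    exact ⟨_, lcmAug_coneAug_monomial I S he⟩

end Contraction

section InternalGrading

variable {S N E : Type*} [CommRing S] [AddCommGroup N] [Module S N] {gr : E → Submodule S N}

theorem isInternal_comap_of_injective [DecidableEq E] {M : Type*} [AddCommGroup M] [Module S M]
    (hgr : iSupIndep gr) {i : M →ₗ[S] N} (hi : Function.Injective i)
    (htop : ⨆ e, (gr e).comap i = ⊤) : DirectSum.IsInternal fun e => (gr e).comap i := by
  refine (DirectSum.isInternal_submodule_iff_iSupIndep_and_iSup_eq_top _).2 ⟨fun e => ?_, htop⟩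
  rw [Submodule.disjoint_def]
  intro x hx hx'
  have hle : ⨆ j, ⨆ (_ : j ≠ e), (gr j).comap i ≤ (⨆ j, ⨆ (_ : j ≠ e), gr j).comap i :=
    iSup₂_le fun j hj => Submodule.comap_mono (le_iSup₂ (f := fun j (_ : j ≠ e) => gr j) j hj)
  exact hi ((Submodule.disjoint_def.1 (hgr e) _ hx (hle hx')).trans (map_zero i).symm)

theorem isInternal_comap_range [DecidableEq E] {R : Type*} [CommRing R] [Algebra S R] [Module R N]
    [IsScalarTower S R N] (hgr : DirectSum.IsInternal gr) (A : N →ₗ[R] N)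
    (hA : ∀ e, ∀ x ∈ gr e, A x ∈ gr e) :
    DirectSum.IsInternal fun e => (gr e).comap ((LinearMap.range A).subtype.restrictScalars S) := by
  refine isInternal_comap_of_injective hgr.submodule_iSupIndep Subtype.val_injective ?_
  have htop : (⨆ e, gr e).map (A.rangeRestrict.restrictScalars S) = ⊤ := by
    rw [hgr.submodule_iSup_eq_top, Submodule.map_top]
    exact LinearMap.range_eq_top.2 A.surjective_rangeRestrict
  rw [eq_top_iff, ← htop, Submodule.map_iSup]
  refine iSup_mono fun e => ?_
  rintro _ ⟨x, hx, rfl⟩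
  exact hA e x hx

end InternalGrading

section FinsuppGrading

variable {X S ι : Type*} [CommRing S] {deg : ι → (X →₀ ℕ)}

/-- The multigrading of the free `S[X]`-module on a set of generators with given degrees. -/
def finsuppDeg (deg : ι → (X →₀ ℕ)) (e : X →₀ ℕ) : Submodule S (ι →₀ MvPolynomial X S) :=
  Submodule.span S {x | ∃ (c : ι) (e' : X →₀ ℕ), e' + deg c = e ∧
    x = Finsupp.single c (MvPolynomial.monomial e' 1)}

theorem finsuppDeg_le_iff {e : X →₀ ℕ} {T : Submodule S (ι →₀ MvPolynomial X S)} :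
    finsuppDeg deg e ≤ T ↔
      ∀ c m, m + deg c = e → Finsupp.single c (MvPolynomial.monomial m 1) ∈ T := by
  refine Submodule.span_le.trans ⟨fun h c m hm => h ⟨c, m, hm, rfl⟩, ?_⟩
  rintro h _ ⟨c, m, hm, rfl⟩
  exact h c m hm

theorem single_monomial_mem_finsuppDeg (c : ι) (e : X →₀ ℕ) :
    Finsupp.single c (MvPolynomial.monomial e (1 : S)) ∈ finsuppDeg deg (e + deg c) :=
  Submodule.subset_span ⟨c, e, rfl, rfl⟩

theorem single_one_mem_finsuppDeg (c : ι) :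
    Finsupp.single c (1 : MvPolynomial X S) ∈ finsuppDeg deg (deg c) :=
  Submodule.subset_span ⟨c, 0, zero_add _, rfl⟩

theorem monomial_smul_mem_finsuppDeg (e e' : X →₀ ℕ) {x : ι →₀ MvPolynomial X S}
    (hx : x ∈ finsuppDeg deg e) :
    MvPolynomial.monomial e' (1 : S) • x ∈ finsuppDeg deg (e' + e) := by
  suffices h : finsuppDeg deg e ≤ (finsuppDeg deg (e' + e)).comap
      ((LinearMap.lsmul (MvPolynomial X S) (ι →₀ MvPolynomial X S)
        (MvPolynomial.monomial e' (1 : S))).restrictScalars S) from h hx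
  refine finsuppDeg_le_iff.2 fun c m hm => Submodule.subset_span ⟨c, e' + m, ?_, ?_⟩
  · rw [add_assoc, hm]
  · simp [MvPolynomial.monomial_mul]

theorem add_deg_eq_of_mem_finsuppDeg {e : X →₀ ℕ} {x : ι →₀ MvPolynomial X S}
    (hx : x ∈ finsuppDeg deg e) {c : ι} {m : X →₀ ℕ} (h : (x c).coeff m ≠ 0) :
    m + deg c = e := by
  classical
  by_contra hne
  refine h ?_
  suffices h : finsuppDeg deg e ≤ LinearMap.ker (MvPolynomial.lcoeff S m ∘ₗ
      (Finsupp.lapply (R := S) c : (ι →₀ MvPolynomial X S) →ₗ[S] MvPolynomial X S)) from h hx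
  refine finsuppDeg_le_iff.2 fun c' m' h' => ?_
  change MvPolynomial.coeff m (Finsupp.single c' (MvPolynomial.monomial m' (1 : S)) c) = 0
  rw [Finsupp.single_apply]
  split_ifs with hc
  · subst hc
    rw [MvPolynomial.coeff_monomial, if_neg]
    rintro rfl
    exact hne h'
  · exact MvPolynomial.coeff_zero m

theorem map_mem_of_map_single_mem {P : Type*} [AddCommGroup P] [Module S P]
    [Module (MvPolynomial X S) P] [IsScalarTower S (MvPolynomial X S) P]
    {gr : (X →₀ ℕ) → Submodule S P}
    (hgr : ∀ e e', ∀ x ∈ gr e, MvPolynomial.monomial e' (1 : S) • x ∈ gr (e' + e))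
    {f : (ι →₀ MvPolynomial X S) →ₗ[MvPolynomial X S] P}
    (hf : ∀ c, f (Finsupp.single c 1) ∈ gr (deg c)) {e : X →₀ ℕ} {x : ι →₀ MvPolynomial X S}
    (hx : x ∈ finsuppDeg deg e) : f x ∈ gr e := by
  suffices h : finsuppDeg deg e ≤ (gr e).comap (f.restrictScalars S) from h hx
  rw [finsuppDeg_le_iff]
  rintro c m rfl
  have := hgr _ m _ (hf c)
  rwa [← map_smul, Finsupp.smul_single, smul_eq_mul, mul_one] at this

theorem iSup_finsuppDeg : ⨆ e, finsuppDeg (S := S) deg e = ⊤ := by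
  have h : (⨆ e, finsuppDeg (S := S) deg e).mkQ = 0 := monomial_hom_ext fun c e => by
    rw [LinearMap.zero_apply, Submodule.mkQ_apply, Submodule.Quotient.mk_eq_zero]
    exact Submodule.mem_iSup_of_mem _ (single_monomial_mem_finsuppDeg c e)
  rw [← Submodule.ker_mkQ (⨆ e, finsuppDeg deg e), h, LinearMap.ker_zero]

theorem iSupIndep_finsuppDeg : iSupIndep (finsuppDeg (S := S) deg) := by
  intro e
  rw [Submodule.disjoint_def]
  intro x hx hx'
  ext c m
  by_contra hcm
  have hle : ⨆ e', ⨆ (_ : e' ≠ e), finsuppDeg deg e' ≤ LinearMap.ker (MvPolynomial.lcoeff S m ∘ₗ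
      (Finsupp.lapply (R := S) c : (ι →₀ MvPolynomial X S) →ₗ[S] MvPolynomial X S)) := by
    refine iSup₂_le fun e' hne y hy => ?_
    by_contra hy0
    exact hne ((add_deg_eq_of_mem_finsuppDeg hy hy0).symm.trans
      (add_deg_eq_of_mem_finsuppDeg hx hcm))
  exact hcm (hle hx')

open Classical in
theorem isInternal_finsuppDeg : DirectSum.IsInternal (finsuppDeg (S := S) deg) :=
  (DirectSum.isInternal_submodule_iff_iSupIndep_and_iSup_eq_top _).2
    ⟨iSupIndep_finsuppDeg, iSup_finsuppDeg⟩

theorem isGradedFree_finsuppDeg [Finite ι] : IsGradedFree (finsuppDeg (S := S) deg) where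
  isInternal := isInternal_finsuppDeg
  monomial_smul_mem e e' _ hx := monomial_smul_mem_finsuppDeg e e' hx
  exists_basis := by
    obtain ⟨r, ⟨f⟩⟩ := Finite.exists_equiv_fin ι
    refine ⟨r, Finsupp.basisSingleOne.reindex f, fun i => ⟨deg (f.symm i), ?_⟩⟩
    rw [Module.Basis.reindex_apply, Finsupp.coe_basisSingleOne]
    exact single_one_mem_finsuppDeg _

end FinsuppGrading

section IdempotentConjugation

theorem exists_isUnit_intertwining {R : Type*} [Ring R] {a p : R} (ha : IsIdempotentElem a)
    (hp : IsIdempotentElem p) (h : IsNilpotent ((a - p) * (p + p - 1))) :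
    ∃ t : R, IsUnit t ∧ t * p = a * p ∧ a * t = a * p := by
  refine ⟨1 + (a - p) * (p + p - 1), h.isUnit_one_add, ?_, ?_⟩
  · simp only [add_mul, sub_mul, mul_add, mul_sub, mul_assoc, hp.eq, one_mul, mul_one]
    abel
  · have ha' (x : R) : a * (a * x) = a * x := by rw [← mul_assoc, ha.eq]
    simp only [sub_mul, mul_add, mul_sub, ha.eq, ha', hp.eq, mul_one]
    abel

variable {R M : Type*} [Ring R] [AddCommGroup M] [Module R M] {F : ℕ → Submodule R M} {K : ℕ}

theorem pow_apply_mem_of_lowers_filtration {D : Module.End R M}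
    (hD : ∀ k, ∀ x ∈ F (k + 1), D x ∈ F k) (j : ℕ) {k : ℕ} {x : M} (hx : x ∈ F (k + j)) :
    (D ^ j) x ∈ F k := by
  induction j generalizing x with
  | zero => exact hx
  | succ j ih =>
    rw [pow_succ, Module.End.mul_apply]
    exact ih (hD _ x hx)

theorem isNilpotent_of_lowers_filtration {D : Module.End R M} (h0 : F 0 = ⊥) (hK : F K = ⊤)
    (hD : ∀ k, ∀ x ∈ F (k + 1), D x ∈ F k) : IsNilpotent D := by
  refine ⟨K, LinearMap.ext fun x => ?_⟩
  have hx : x ∈ F (0 + K) := by rw [zero_add, hK]; trivial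
  have := pow_apply_mem_of_lowers_filtration hD K hx
  rwa [h0, Submodule.mem_bot] at this

theorem exists_linearEquiv_intertwining {A P : Module.End R M} (hA : IsIdempotentElem A)
    (hP : IsIdempotentElem P) (h0 : F 0 = ⊥) (hK : F K = ⊤) (hPF : ∀ k, ∀ x ∈ F k, P x ∈ F k)
    (hAF : ∀ k, ∀ x ∈ F (k + 1), (A - P) x ∈ F k) :
    ∃ T : M ≃ₗ[R] M, (∀ x, T (P x) = A (P x)) ∧ ∀ x, A (T x) = A (P x) := by
  have hnil : IsNilpotent ((A - P) * (P + P - 1)) :=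
    isNilpotent_of_lowers_filtration h0 hK fun k x hx => hAF k _ <|
      Submodule.sub_mem _ (Submodule.add_mem _ (hPF _ x hx) (hPF _ x hx)) hx
  obtain ⟨t, ht, htP, hAt⟩ := exists_isUnit_intertwining hA hP hnil
  exact ⟨LinearEquiv.ofBijective t ((Module.End.isUnit_iff t).1 ht), LinearMap.congr_fun htP,
    LinearMap.congr_fun hAt⟩

end IdempotentConjugation

section ConstantPart

variable {X S ι : Type*} [CommRing S]

/-- Extension of scalars from `S` to `S[X]` on free modules. -/
def mapC : (ι →₀ S) →ₗ[S] (ι →₀ MvPolynomial X S) :=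
  Finsupp.mapRange.linearMap (Algebra.linearMap S (MvPolynomial X S))

theorem mapC_apply (x : ι →₀ S) (i : ι) :
    (mapC x : ι →₀ MvPolynomial X S) i = MvPolynomial.C (x i) := rfl

/-- Reduction modulo the variables on free modules. -/
def evalZero : (ι →₀ MvPolynomial X S) →ₗ[S] (ι →₀ S) :=
  Finsupp.mapRange.linearMap (MvPolynomial.lcoeff S 0)

theorem evalZero_apply (x : ι →₀ MvPolynomial X S) (i : ι) :
    evalZero x i = MvPolynomial.constantCoeff (x i) := rfl

theorem mapC_evalZero_smul (f : MvPolynomial X S) (x : ι →₀ MvPolynomial X S) :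
    (mapC (evalZero (f • x)) : ι →₀ MvPolynomial X S) =
      (MvPolynomial.C (MvPolynomial.constantCoeff f) : MvPolynomial X S) • mapC (evalZero x) := by
  ext1 i
  simp only [mapC_apply, evalZero_apply, Finsupp.smul_apply, smul_eq_mul, map_mul]

theorem mapC_evalZero_single_one (i : ι) :
    mapC (evalZero (Finsupp.single i (1 : MvPolynomial X S))) =
      Finsupp.single i (1 : MvPolynomial X S) := by
  classical
  ext1 j
  rw [mapC_apply, evalZero_apply, Finsupp.single_apply]
  split_ifs <;> simp only [map_one, map_zero]

theorem linearIndependent_mapC {κ : Type*} {v : κ → (ι →₀ S)} (hv : LinearIndependent S v) :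
    LinearIndependent (MvPolynomial X S) fun i => (mapC (v i) : ι →₀ MvPolynomial X S) := by
  rw [linearIndependent_iff'] at hv ⊢
  intro s g hg i hi
  ext m
  refine hv s (fun i => (g i).coeff m) ?_ i hi
  ext j
  have := congrArg (fun x : ι →₀ MvPolynomial X S => (x j).coeff m) hg
  simp only [Finsupp.coe_finsetSum, Finset.sum_apply, Finsupp.smul_apply, smul_eq_mul, mapC_apply,
    MvPolynomial.coeff_sum, mul_comm _ (MvPolynomial.C _), MvPolynomial.coeff_C_mul] at this
  simpa [mul_comm] using this

/-- The part of an endomorphism of a free `S[X]`-module that does not involve the variables. -/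
def constPart (A : Module.End (MvPolynomial X S) (ι →₀ MvPolynomial X S)) :
    Module.End (MvPolynomial X S) (ι →₀ MvPolynomial X S) :=
  Finsupp.linearCombination (MvPolynomial X S) fun i => mapC (evalZero (A (Finsupp.single i 1)))

variable (A : Module.End (MvPolynomial X S) (ι →₀ MvPolynomial X S))

theorem constPart_single_one (i : ι) :
    constPart A (Finsupp.single i 1) = mapC (evalZero (A (Finsupp.single i 1))) := by
  rw [constPart, Finsupp.linearCombination_single, one_smul]

theorem constPart_single_one_apply (i j : ι) : constPart A (Finsupp.single i 1) j =
    MvPolynomial.C (MvPolynomial.constantCoeff (A (Finsupp.single i 1) j)) := by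
  rw [constPart_single_one, mapC_apply, evalZero_apply]

theorem constPart_mapC_evalZero (x : ι →₀ MvPolynomial X S) :
    constPart A (mapC (evalZero x)) = mapC (evalZero (A x)) := by
  induction x using Finsupp.induction_linear with
  | zero => simp only [map_zero]
  | add x y hx hy => simp only [map_add, hx, hy]
  | single i f =>
    have hf : Finsupp.single i f = f • Finsupp.single i 1 := by
      rw [Finsupp.smul_single, smul_eq_mul, mul_one]
    rw [hf, mapC_evalZero_smul, map_smul A, mapC_evalZero_smul, map_smul (constPart A),
      mapC_evalZero_single_one, constPart_single_one]

variable {A}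

theorem isIdempotentElem_constPart (hA : IsIdempotentElem A) :
    IsIdempotentElem (constPart A) := by
  refine Finsupp.lhom_ext' fun i => LinearMap.ext_ring ?_
  change constPart A (constPart A (Finsupp.single i 1)) = constPart A (Finsupp.single i 1)
  rw [constPart_single_one, constPart_mapC_evalZero, ← Module.End.mul_apply, hA.eq]

theorem exists_basis_range_constPart {S : Type*} [Field S]
    (A : Module.End (MvPolynomial X S) (ι →₀ MvPolynomial X S)) :
    ∃ (B : Set ι) (b : Module.Basis B (MvPolynomial X S) (LinearMap.range (constPart A))),
      ∀ i, (b i : ι →₀ MvPolynomial X S) = constPart A (Finsupp.single (i : ι) 1) := by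
  let v : ι → (ι →₀ S) := fun i => evalZero (A (Finsupp.single i 1))
  have hempty : LinearIndepOn S v ∅ := linearIndepOn_empty S v
  let B : Set ι := hempty.extend (Set.empty_subset Set.univ)
  have hli : LinearIndependent (MvPolynomial X S) fun i : B =>
      (mapC (v i) : ι →₀ MvPolynomial X S) :=
    linearIndependent_mapC (hempty.linearIndepOn_extend (Set.empty_subset _))
  have hspan : Submodule.span (MvPolynomial X S) (Set.range fun i : B => mapC (v i)) =
      LinearMap.range (constPart A) := by
    rw [constPart, Finsupp.range_linearCombination]
    refine le_antisymm (Submodule.span_mono ?_) (Submodule.span_le.2 ?_)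
    · exact Set.range_comp_subset_range (Subtype.val : B → ι) fun i => mapC (v i)
    rintro _ ⟨i, rfl⟩
    have hi := Submodule.mem_map_of_mem (f := (mapC : (ι →₀ S) →ₗ[S] (ι →₀ MvPolynomial X S)))
      (hempty.image_subset_span_image_extend (Set.empty_subset _) (Set.mem_image_of_mem v
        (Set.mem_univ i)))
    rw [Submodule.map_span, Set.image_image, Set.image_eq_range] at hi
    exact Submodule.span_le_restrictScalars S (MvPolynomial X S) _ hi
  refine ⟨B, (Module.Basis.span hli).map (LinearEquiv.ofEq _ _ hspan), fun i => ?_⟩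
  rw [Module.Basis.map_apply, LinearEquiv.coe_ofEq_apply, Module.Basis.span_apply,
    constPart_single_one]

end ConstantPart

section HomogeneousImage

theorem map_mem_of_mem_supported {R M ι : Type*} [Semiring R] [AddCommMonoid M] [Module R M]
    {s : Set ι} {P : Submodule R M} {f : (ι →₀ R) →ₗ[R] M}
    (hf : ∀ i ∈ s, f (Finsupp.single i 1) ∈ P) {x : ι →₀ R} (hx : x ∈ Finsupp.supported R R s) :
    f x ∈ P := by
  rw [Finsupp.supported_eq_span_single] at hx
  refine (Submodule.span_le.2 ?_ : _ ≤ P.comap f) hx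
  rintro _ ⟨i, hi, rfl⟩
  exact hf i hi

variable {X S ι : Type*} [CommRing S] {deg : ι → (X →₀ ℕ)}

variable (S deg) in
/-- The submodule spanned by the generators of total degree less than `k`. -/
def lowDegree (k : ℕ) : Submodule (MvPolynomial X S) (ι →₀ MvPolynomial X S) :=
  Finsupp.supported (MvPolynomial X S) (MvPolynomial X S) {i | (deg i).degree < k}

theorem mem_lowDegree {k : ℕ} {x : ι →₀ MvPolynomial X S} :
    x ∈ lowDegree S deg k ↔ ∀ i, x i ≠ 0 → (deg i).degree < k := by
  simp only [lowDegree, Finsupp.mem_supported, Set.subset_def, Finset.mem_coe,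
    Finsupp.mem_support_iff, Set.mem_ofPred_eq]

theorem lowDegree_zero : lowDegree S deg 0 = ⊥ := by
  simp only [lowDegree, not_lt_zero, Set.ofPred_false, Finsupp.supported_empty]

theorem exists_lowDegree_eq_top [Finite ι] : ∃ K, lowDegree S deg K = ⊤ := by
  obtain ⟨K, hK⟩ := (Set.finite_range fun i => (deg i).degree).bddAbove
  exact ⟨K + 1, eq_top_iff.2 fun x _ =>
    mem_lowDegree.2 fun i _ => Nat.lt_succ_of_le (hK ⟨i, rfl⟩)⟩

variable {A : Module.End (MvPolynomial X S) (ι →₀ MvPolynomial X S)}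

theorem deg_eq_of_constPart_apply_ne_zero
    (hA : ∀ i, A (Finsupp.single i 1) ∈ finsuppDeg deg (deg i)) {i j : ι}
    (h : constPart A (Finsupp.single i 1) j ≠ 0) : deg j = deg i := by
  rw [constPart_single_one_apply, Ne, MvPolynomial.C_eq_zero] at h
  simpa only [zero_add] using add_deg_eq_of_mem_finsuppDeg (hA i) h

theorem constPart_single_one_mem_finsuppDeg
    (hA : ∀ i, A (Finsupp.single i 1) ∈ finsuppDeg deg (deg i)) (i : ι) :
    constPart A (Finsupp.single i 1) ∈ finsuppDeg deg (deg i) := by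
  rw [← Finsupp.sum_single (constPart A _)]
  refine Submodule.sum_mem _ fun j hj => ?_
  rw [← deg_eq_of_constPart_apply_ne_zero hA (Finsupp.mem_support_iff.1 hj),
    constPart_single_one_apply, ← mul_one (MvPolynomial.C _), ← MvPolynomial.smul_eq_C_mul,
    ← Finsupp.smul_single]
  exact Submodule.smul_mem _ _ (single_one_mem_finsuppDeg j)

theorem degree_lt_of_sub_constPart_apply_ne_zero
    (hA : ∀ i, A (Finsupp.single i 1) ∈ finsuppDeg deg (deg i)) {i j : ι}
    (h : (A - constPart A) (Finsupp.single i 1) j ≠ 0) : (deg j).degree < (deg i).degree := by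
  classical
  rw [LinearMap.sub_apply, Finsupp.sub_apply, constPart_single_one_apply] at h
  obtain ⟨m, hm⟩ := MvPolynomial.ne_zero_iff.1 h
  rw [MvPolynomial.coeff_sub] at hm
  have hm0 : m ≠ 0 := by
    rintro rfl
    rw [MvPolynomial.coeff_zero_C, ← MvPolynomial.constantCoeff_eq, sub_self] at hm
    exact hm rfl
  rw [MvPolynomial.coeff_C, if_neg hm0.symm, sub_zero] at hm
  rw [← add_deg_eq_of_mem_finsuppDeg (hA i) hm, map_add]
  exact Nat.lt_add_of_pos_left (Nat.pos_of_ne_zero (mt (Finsupp.degree_eq_zero_iff m).1 hm0))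

theorem exists_linearEquiv_intertwining_constPart [Finite ι] (hA : IsIdempotentElem A)
    (hdeg : ∀ i, A (Finsupp.single i 1) ∈ finsuppDeg deg (deg i)) :
    ∃ T : (ι →₀ MvPolynomial X S) ≃ₗ[MvPolynomial X S] (ι →₀ MvPolynomial X S),
      (∀ x, T (constPart A x) = A (constPart A x)) ∧ ∀ x, A (T x) = A (constPart A x) := by
  obtain ⟨K, hK⟩ := exists_lowDegree_eq_top (S := S) (deg := deg)
  refine exists_linearEquiv_intertwining hA (isIdempotentElem_constPart hA) lowDegree_zero hK
    (fun k x hx => map_mem_of_mem_supported (fun i hi => mem_lowDegree.2 fun j hj => ?_) hx)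
    (fun k x hx => map_mem_of_mem_supported (fun i hi => mem_lowDegree.2 fun j hj => ?_) hx)
  · rwa [deg_eq_of_constPart_apply_ne_zero hdeg hj]
  · exact (degree_lt_of_sub_constPart_apply_ne_zero hdeg hj).trans_le (Nat.lt_succ_iff.1 hi)

-- Modulo the variables `A` becomes a matrix over a field, and `A` is conjugate to that matrix.
theorem exists_homogeneous_basis_range {S : Type*} [Field S] [Finite ι]
    {A : Module.End (MvPolynomial X S) (ι →₀ MvPolynomial X S)} (hA : IsIdempotentElem A)
    (hdeg : ∀ e, ∀ x ∈ finsuppDeg deg e, A x ∈ finsuppDeg deg e) :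
    ∃ (r : ℕ) (b : Module.Basis (Fin r) (MvPolynomial X S) (LinearMap.range A)),
      ∀ i, ∃ e, (b i : ι →₀ MvPolynomial X S) ∈ finsuppDeg deg e := by
  have hAdeg (i : ι) := hdeg _ _ (single_one_mem_finsuppDeg (S := S) i)
  obtain ⟨T, hTP, hAT⟩ := exists_linearEquiv_intertwining_constPart hA hAdeg
  have hrange : (LinearMap.range (constPart A)).map (T : _ →ₗ[MvPolynomial X S] _) =
      LinearMap.range A := by
    have hcomm : T ∘ₗ constPart A = A ∘ₗ T :=
      LinearMap.ext fun x => (hTP x).trans (hAT x).symm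
    rw [← LinearMap.range_comp, hcomm, LinearMap.range_comp_of_range_eq_top _ T.range]
  obtain ⟨B, b, hb⟩ := exists_basis_range_constPart A
  obtain ⟨r, ⟨f⟩⟩ := Finite.exists_equiv_fin B
  refine ⟨r, (b.map (T.ofSubmodules _ _ hrange)).reindex f, fun i => ⟨deg (f.symm i), ?_⟩⟩
  rw [Module.Basis.reindex_apply, Module.Basis.map_apply, LinearEquiv.ofSubmodules_apply, hb, hTP]
  exact hdeg _ _ (constPart_single_one_mem_finsuppDeg hAdeg _)

open Classical in
theorem isGradedFree_range {S : Type*} [Field S] [Finite ι]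
    {A : Module.End (MvPolynomial X S) (ι →₀ MvPolynomial X S)} (hA : IsIdempotentElem A)
    (hdeg : ∀ e, ∀ x ∈ finsuppDeg deg e, A x ∈ finsuppDeg deg e) :
    IsGradedFree (N := LinearMap.range A) fun e => (finsuppDeg (S := S) deg e).comap
      ((LinearMap.range A).subtype.restrictScalars S) where
  isInternal := isInternal_comap_range isInternal_finsuppDeg A hdeg
  monomial_smul_mem e e' _ hx := monomial_smul_mem_finsuppDeg e e' hx
  exists_basis := exists_homogeneous_basis_range hA hdeg

end HomogeneousImage

section Flow

variable {S : Type*} [CommRing S] {N : ℕ → Type*} [∀ n, AddCommGroup (N n)]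
  [∀ n, Module S (N n)] {d : ∀ n, N (n + 1) →ₗ[S] N n} {D : ∀ n, N n →ₗ[S] N (n + 1)}

theorem flow_apply (n : ℕ) (x : N n) : flow d D n x = x - d n (D n x) - homotopyD d D n x := rfl

theorem homotopyD_d (hd : ∀ n x, d n (d (n + 1) x) = 0) (n : ℕ) (x : N (n + 1)) :
    homotopyD d D n (d n x) = 0 := by
  cases n with
  | zero => rfl
  | succ n =>
    change D n (d n (d (n + 1) x)) = 0
    rw [hd, map_zero]

theorem D_homotopyD (hD : ∀ n x, D (n + 1) (D n x) = 0) (n : ℕ) (x : N n) :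
    D n (homotopyD d D n x) = 0 := by
  cases n with
  | zero => exact map_zero _
  | succ n => exact hD n _

theorem d_flow (hd : ∀ n x, d n (d (n + 1) x) = 0) (n : ℕ) (x : N (n + 1)) :
    d n (flow d D (n + 1) x) = flow d D n (d n x) := by
  rw [flow_apply, flow_apply, homotopyD_d hd, map_sub, map_sub, hd]
  change d n x - 0 - d n (D n (d n x)) = _
  abel

theorem flow_D (hD : ∀ n x, D (n + 1) (D n x) = 0) (n : ℕ) (x : N n) :
    flow d D (n + 1) (D n x) = D n x - D n (d n (D n x)) := by
  rw [flow_apply, hD, map_zero, sub_zero]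
  rfl

theorem D_flow (hD : ∀ n x, D (n + 1) (D n x) = 0) (n : ℕ) (x : N n) :
    D n (flow d D n x) = flow d D (n + 1) (D n x) := by
  rw [flow_D hD, flow_apply, map_sub, map_sub, D_homotopyD hD, sub_zero]

theorem d_flow_pow (hd : ∀ n x, d n (d (n + 1) x) = 0) (j n : ℕ) (x : N (n + 1)) :
    d n ((flow d D (n + 1) ^ j) x) = (flow d D n ^ j) (d n x) := by
  induction j generalizing x with
  | zero => rfl
  | succ j ih => rw [pow_succ, pow_succ, Module.End.mul_apply, Module.End.mul_apply, ih, d_flow hd]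

theorem D_flow_pow (hD : ∀ n x, D (n + 1) (D n x) = 0) (j n : ℕ) (x : N n) :
    D n ((flow d D n ^ j) x) = (flow d D (n + 1) ^ j) (D n x) := by
  induction j generalizing x with
  | zero => rfl
  | succ j ih => rw [pow_succ, pow_succ, Module.End.mul_apply, Module.End.mul_apply, ih, D_flow hD]

theorem flow_pow_flow (hd : ∀ n x, d n (d (n + 1) x) = 0) {j : ℕ}
    (hj : ∀ n x, (flow d D (n + 1) ^ j) (D n x) = 0) (n : ℕ) (x : N n) :
    (flow d D n ^ j) (flow d D n x) = (flow d D n ^ j) x := by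
  have h : (flow d D n ^ j) (homotopyD d D n x) = 0 := by
    cases n with
    | zero => exact map_zero _
    | succ n => exact hj n _
  rw [flow_apply, map_sub, map_sub, h, ← d_flow_pow hd, hj, map_zero, sub_zero, sub_zero]

theorem isIdempotentElem_flow_pow (hd : ∀ n x, d n (d (n + 1) x) = 0) {j : ℕ}
    (hj : ∀ n x, (flow d D (n + 1) ^ j) (D n x) = 0) (n : ℕ) :
    IsIdempotentElem (flow d D n ^ j) := by
  have h (i : ℕ) : flow d D n ^ j * flow d D n ^ i = flow d D n ^ j := by
    induction i with
    | zero => rw [pow_zero, mul_one]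
    | succ i ih =>
      rw [pow_succ, ← mul_assoc, ih]
      exact LinearMap.ext (flow_pow_flow hd hj n)
  exact h j

end Flow

section Hat

variable {S : Type*} [CommRing S] {N : ℕ → Type*} [∀ n, AddCommGroup (N n)]
  [∀ n, Module S (N n)] {d : ∀ n, N (n + 1) →ₗ[S] N n} {D : ∀ n, N n →ₗ[S] N (n + 1)}

theorem hat_apply (n : ℕ) (x : N n) :
    hat d D n x = D n (d n (D n (x - homotopyD d D n x))) := rfl

theorem d_hat_d (hd : ∀ n x, d n (d (n + 1) x) = 0) (hD : ∀ n x, d n (D n (d n x)) = d n x)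
    (n : ℕ) (x : N (n + 1)) : d n (hat d D n (d n x)) = d n x := by
  rw [hat_apply, homotopyD_d hd, sub_zero, hD, hD]

theorem hat_hat (hD : ∀ n x, d n (D n (d n x)) = d n x) (n : ℕ) (x : N n) :
    hat d D (n + 1) (hat d D n x) = 0 := by
  rw [hat_apply, hat_apply]
  change D (n + 1) (d (n + 1) (D (n + 1) (_ - D n (d n _)))) = 0
  rw [hD, sub_self, map_zero, map_zero, map_zero]

theorem hat_d_hat (hd : ∀ n x, d n (d (n + 1) x) = 0) (hD : ∀ n x, d n (D n (d n x)) = d n x)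
    (n : ℕ) (x : N n) : hat d D n (d n (hat d D n x)) = hat d D n x := by
  rw [hat_apply, homotopyD_d hd, sub_zero, hD, hat_apply, hD]

end Hat

section Assembly

variable {X : Type*} {I : AddSemigroupIdeal (X →₀ ℕ)} {R : Type*} [CommRing R]

/-- Families of maps raising the degree by one on the chains of the strata of the order complex of
`L'`, with coefficients in `R`. -/
abbrev StrataMaps (I : AddSemigroupIdeal (X →₀ ℕ)) (R : Type*) [CommRing R] :=
  ∀ (a : lcmPoset I) (n : ℕ), (StratumFace a n →₀ R) →ₗ[R] (StratumFace a (n + 1) →₀ R)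

/-- The inclusion of the chains of a stratum in the chains of the order complex of `L'`. -/
def stratumIncl (R : Type*) [CommRing R] (a : lcmPoset I) (n : ℕ) :
    (StratumFace a n →₀ R) →ₗ[R] (Face I n →₀ R) :=
  Finsupp.lmapDomain _ _ Subtype.val

theorem stratumIncl_single (a : lcmPoset I) (n : ℕ) (c : StratumFace a n) (f : R) :
    stratumIncl R a n (Finsupp.single c f) = Finsupp.single c.1 f :=
  Finsupp.mapDomain_single

/-- The map on the chains of the order complex of `L'` with given restrictions to the strata. -/
def assemble {n m : ℕ}
    (L : ∀ a : lcmPoset I, (StratumFace a n →₀ R) →ₗ[R] (StratumFace a m →₀ R)) :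
    (Face I n →₀ R) →ₗ[R] (Face I m →₀ R) :=
  Finsupp.linearCombination R fun c => stratumIncl R c.top m (L c.top (Finsupp.single ⟨c, rfl⟩ 1))

theorem assemble_single_one {n m : ℕ}
    (L : ∀ a : lcmPoset I, (StratumFace a n →₀ R) →ₗ[R] (StratumFace a m →₀ R)) (c : Face I n) :
    assemble L (Finsupp.single c 1) =
      stratumIncl R c.top m (L c.top (Finsupp.single ⟨c, rfl⟩ 1)) := by
  rw [assemble, Finsupp.linearCombination_single, one_smul]

theorem assemble_stratumIncl {n m : ℕ}
    (L : ∀ a : lcmPoset I, (StratumFace a n →₀ R) →ₗ[R] (StratumFace a m →₀ R))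
    (a : lcmPoset I) (x : StratumFace a n →₀ R) :
    assemble L (stratumIncl R a n x) = stratumIncl R a m (L a x) := by
  suffices h : assemble L ∘ₗ stratumIncl R a n = stratumIncl R a m ∘ₗ L a from
    LinearMap.congr_fun h x
  refine Finsupp.lhom_ext' fun c => LinearMap.ext_ring ?_
  obtain ⟨c, rfl⟩ := c
  change assemble L (stratumIncl R _ n (Finsupp.single _ 1)) =
    stratumIncl R _ m (L _ (Finsupp.single _ 1))
  rw [stratumIncl_single, assemble_single_one]

theorem hom_ext_strata {P : Type*} [AddCommGroup P] [Module R P] {n : ℕ}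
    {f g : (Face I n →₀ R) →ₗ[R] P}
    (h : ∀ a x, f (stratumIncl R a n x) = g (stratumIncl R a n x)) : f = g := by
  refine Finsupp.lhom_ext' fun c => LinearMap.ext_ring ?_
  have := h c.top (Finsupp.single ⟨c, rfl⟩ 1)
  rwa [stratumIncl_single] at this

/-- The part of the differential of the lcm-resolution that preserves the largest vertex. -/
def strataD (I : AddSemigroupIdeal (X →₀ ℕ)) (R : Type*) [CommRing R] (n : ℕ) :
    (Face I (n + 1) →₀ R) →ₗ[R] (Face I n →₀ R) :=
  assemble fun a => stratumD R a n

theorem strataD_single_one (n : ℕ) (c : Face I (n + 1)) :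
    strataD I R n (Finsupp.single c 1) = ∑ i : Fin (n + 1), ((-1 : ℤ) ^ (i : ℕ)) •
      Finsupp.single (c.del i.castSucc) (1 : R) := by
  classical
  rw [strataD, assemble_single_one, stratumD_single, map_sum, Fin.sum_univ_castSucc,
    dif_neg c.del_last_top_lt.ne, smul_zero, map_zero, add_zero]
  refine Finset.sum_congr rfl fun i _ => ?_
  rw [dif_pos (c.del_castSucc_top i), map_zsmul, stratumIncl_single]
  rfl

theorem strataD_stratumIncl (a : lcmPoset I) (n : ℕ) (x : StratumFace a (n + 1) →₀ R) :
    strataD I R n (stratumIncl R a (n + 1) x) = stratumIncl R a n (stratumD R a n x) :=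
  assemble_stratumIncl _ a x

end Assembly

section LowerD

variable {X : Type*} {I : AddSemigroupIdeal (X →₀ ℕ)} {S : Type*} [CommRing S]

/-- The part of the differential of the lcm-resolution that lowers the largest vertex. -/
def lowerD (I : AddSemigroupIdeal (X →₀ ℕ)) (S : Type*) [CommRing S] (n : ℕ) :
    LcmMod I S (n + 1) →ₗ[MvPolynomial X S] LcmMod I S n :=
  lcmD I S n - strataD I (MvPolynomial X S) n

theorem lcmD_eq_strataD_add_lowerD (n : ℕ) (x : LcmMod I S (n + 1)) :
    lcmD I S n x = strataD I (MvPolynomial X S) n x + lowerD I S n x := by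
  rw [lowerD, LinearMap.sub_apply, add_sub_cancel]

theorem lowerD_single_one (n : ℕ) (c : Face I (n + 1)) : lowerD I S n (Finsupp.single c 1) =
    ((-1 : ℤ) ^ (n + 1)) • Finsupp.single (c.del (Fin.last _)) (MvPolynomial.monomial
      ((c.top : X →₀ ℕ) - ((c.del (Fin.last _)).top : X →₀ ℕ)) (1 : S)) := by
  have hstrata : ∑ i : Fin (n + 1), ((-1 : ℤ) ^ (i : ℕ)) • Finsupp.single (c.del i.castSucc)
      (MvPolynomial.monomial ((c.top : X →₀ ℕ) - ((c.del i.castSucc).top : X →₀ ℕ)) (1 : S)) =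
      strataD I (MvPolynomial X S) n (Finsupp.single c 1) := by
    rw [strataD_single_one]
    refine Finset.sum_congr rfl fun i _ => ?_
    rw [c.del_castSucc_top, tsub_self]
    rfl
  simp only [lowerD, LinearMap.sub_apply, lcmD_single, one_mul]
  rw [Fin.sum_univ_castSucc, Fin.val_last]
  exact sub_eq_of_eq_add' (congrArg (· + _) hstrata)

theorem monomial_mem_idealOfVars {e : X →₀ ℕ} (he : e ≠ 0) (s : S) :
    MvPolynomial.monomial e s ∈ MvPolynomial.idealOfVars X S := by
  rw [← pow_one (MvPolynomial.idealOfVars X S), MvPolynomial.mem_pow_idealOfVars_iff]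
  intro e' he'
  rw [Finset.mem_singleton.1 (MvPolynomial.support_monomial_subset he')]
  exact Nat.one_le_iff_ne_zero.2 ((Finsupp.degree_eq_zero_iff e).not.2 he)

theorem lowerD_mem (n : ℕ) (x : LcmMod I S (n + 1)) : lowerD I S n x ∈
    MvPolynomial.idealOfVars X S • (⊤ : Submodule (MvPolynomial X S) (LcmMod I S n)) := by
  refine map_mem_of_mem_supported (s := Set.univ) (fun c _ => ?_)
    (Finsupp.mem_supported _ x |>.2 (Set.subset_univ _))
  rw [lowerD_single_one, ← mul_one (MvPolynomial.monomial _ _), ← smul_eq_mul,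
    ← Finsupp.smul_single]
  refine Submodule.smul_of_tower_mem _ _ (Submodule.smul_mem_smul
    (monomial_mem_idealOfVars (fun h => ?_) 1) trivial)
  exact c.del_last_top_lt.not_ge ((tsub_eq_zero_iff_le (α := X →₀ ℕ)).1 h)

end LowerD

section CoheightFiltration

variable {X : Type*} {I : AddSemigroupIdeal (X →₀ ℕ)} {R S : Type*} [CommRing R] [CommRing S]

/-- The chains on faces with a chain of length `j` of elements of `L'` above their largest
vertex. -/
def coheightFil (I : AddSemigroupIdeal (X →₀ ℕ)) (R : Type*) [CommRing R] (n j : ℕ) :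
    Submodule R (Face I n →₀ R) :=
  Finsupp.supported R R {c | (j : ℕ∞) ≤ Order.coheight c.top}

theorem coheightFil_zero (n : ℕ) : coheightFil I R n 0 = ⊤ :=
  eq_top_iff.2 fun x _ => (Finsupp.mem_supported R x).2 fun _ _ => by
    simp only [Nat.cast_zero, zero_le, Set.ofPred_true, Set.mem_univ]

theorem coheightFil_eq_bot [Finite (lcmPoset I)] (n : ℕ) {j : ℕ} (hj : lcmDim I < j) :
    coheightFil I R n j = ⊥ := by
  suffices h : {c : Face I n | (j : ℕ∞) ≤ Order.coheight c.top} = ∅ by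
    rw [coheightFil, h, Finsupp.supported_empty]
  refine Set.eq_empty_of_forall_notMem fun c hc => hj.not_ge ?_
  exact_mod_cast (show (j : ℕ∞) ≤ _ from hc).trans
    (Order.coheight_le fun p _ => Nat.cast_le.2 (length_le_lcmDim p))

theorem assemble_mem_coheightFil {n m : ℕ}
    (L : ∀ a : lcmPoset I, (StratumFace a n →₀ R) →ₗ[R] (StratumFace a m →₀ R)) {j : ℕ}
    {x : Face I n →₀ R} (hx : x ∈ coheightFil I R n j) : assemble L x ∈ coheightFil I R m j := by
  classical
  refine map_mem_of_mem_supported (fun c hc => ?_) hx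
  rw [assemble_single_one, coheightFil, Finsupp.mem_supported]
  intro c' hc'
  obtain ⟨⟨c', htop⟩, -, rfl⟩ := Finset.mem_image.1 (Finsupp.mapDomain_support hc')
  change (j : ℕ∞) ≤ Order.coheight c'.top
  rwa [htop]

theorem lowerD_mem_coheightFil {n j : ℕ} {x : LcmMod I S (n + 1)}
    (hx : x ∈ coheightFil I (MvPolynomial X S) (n + 1) j) :
    lowerD I S n x ∈ coheightFil I (MvPolynomial X S) n (j + 1) := by
  refine map_mem_of_mem_supported (fun c (hc : (j : ℕ∞) ≤ _) => ?_) hx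
  rw [lowerD_single_one]
  refine Submodule.smul_of_tower_mem _ _ (Finsupp.single_mem_supported _ _ ?_)
  exact (add_le_add_left hc 1).trans (Order.coheight_add_one_le c.del_last_top_lt)

end CoheightFiltration

section ConstantMaps

variable {S R : Type*} [CommRing R] [CommRing S] [Algebra S R] {B B' B'' : Type*}

/-- The elements with coefficients in `S` of a based free module over the `S`-algebra `R`. -/
def constants (S R : Type*) [CommRing R] [CommRing S] [Algebra S R] (B : Type*) :
    Submodule S (B →₀ R) :=
  Submodule.span S (Set.range fun b => Finsupp.single b (1 : R))

theorem single_mem_constants (b : B) : Finsupp.single b (1 : R) ∈ constants S R B :=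
  Submodule.subset_span ⟨b, rfl⟩

/-- The property of a map of based free `R`-modules of being defined over `S`: its matrix has
coefficients in `S`. -/
def IsConstant (S : Type*) {R : Type*} [CommRing R] [CommRing S] [Algebra S R] {B B' : Type*}
    (f : (B →₀ R) →ₗ[R] (B' →₀ R)) : Prop :=
  ∀ b, f (Finsupp.single b 1) ∈ constants S R B'

theorem IsConstant.map_mem {f : (B →₀ R) →ₗ[R] (B' →₀ R)} (hf : IsConstant S f) {x : B →₀ R}
    (hx : x ∈ constants S R B) : f x ∈ constants S R B' := by
  refine (Submodule.span_le.2 ?_ : constants S R B ≤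
    (constants S R B').comap (f.restrictScalars S)) hx
  rintro _ ⟨b, rfl⟩
  exact hf b

theorem IsConstant.comp {g : (B' →₀ R) →ₗ[R] (B'' →₀ R)} {f : (B →₀ R) →ₗ[R] (B' →₀ R)}
    (hg : IsConstant S g) (hf : IsConstant S f) : IsConstant S (g ∘ₗ f) :=
  fun b => hg.map_mem (hf b)

theorem IsConstant.sub {f g : (B →₀ R) →ₗ[R] (B' →₀ R)} (hf : IsConstant S f)
    (hg : IsConstant S g) : IsConstant S (f - g) :=
  fun b => Submodule.sub_mem _ (hf b) (hg b)

theorem IsConstant.sum {ι : Type*} (s : Finset ι) {f : ι → ((B →₀ R) →ₗ[R] (B' →₀ R))}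
    (hf : ∀ i, IsConstant S (f i)) : IsConstant S (∑ i ∈ s, f i) := fun b => by
  rw [LinearMap.sum_apply]
  exact Submodule.sum_mem _ fun i _ => hf i b

theorem IsConstant.algebraMap_smul {f : (B →₀ R) →ₗ[R] (B' →₀ R)} (hf : IsConstant S f) (s : S) :
    IsConstant S (algebraMap S R s • f) := fun b => by
  rw [LinearMap.smul_apply, _root_.algebraMap_smul]
  exact Submodule.smul_mem _ _ (hf b)

theorem isConstant_id : IsConstant S (LinearMap.id : (B →₀ R) →ₗ[R] (B →₀ R)) :=
  single_mem_constants

theorem isConstant_zero : IsConstant S (0 : (B →₀ R) →ₗ[R] (B' →₀ R)) :=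
  fun _ => Submodule.zero_mem _

theorem isConstant_hat {B : ℕ → Type*} {d : ∀ n, (B (n + 1) →₀ R) →ₗ[R] (B n →₀ R)}
    {D : ∀ n, (B n →₀ R) →ₗ[R] (B (n + 1) →₀ R)} (hd : ∀ n, IsConstant S (d n))
    (hD : ∀ n, IsConstant S (D n)) (n : ℕ) : IsConstant S (hat d D n) := by
  refine (hD n).comp ((hd n).comp ((hD n).comp (isConstant_id.sub ?_)))
  cases n with
  | zero => exact isConstant_zero
  | succ n => exact (hD n).comp (hd n)

end ConstantMaps

section Splitting

variable {X : Type*} {I : AddSemigroupIdeal (X →₀ ℕ)} {R : Type*} [CommRing R]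

/-- Homotopies on the strata that contract them onto their homology, as produced by `hat`. -/
structure IsStrataSplitting (W : StrataMaps I R) : Prop where
  comp_self : ∀ a n x, W a (n + 1) (W a n x) = 0
  W_d_W : ∀ a n x, W a n (stratumD R a n (W a n x)) = W a n x
  d_W_d : ∀ a n x, stratumD R a n (W a n (stratumD R a n x)) = stratumD R a n x

theorem isStrataSplitting_hat {V : StrataMaps I R}
    (hV : ∀ a n x, stratumD R a n (V a n (stratumD R a n x)) = stratumD R a n x) :
    IsStrataSplitting fun a => hat (stratumD R a) (V a) where
  comp_self a := hat_hat (hV a)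
  W_d_W a := hat_d_hat (stratumD_comp R a) (hV a)
  d_W_d a := d_hat_d (N := fun n => StratumFace a n →₀ R) (stratumD_comp R a) (hV a)

variable {S : Type*} [CommRing S] {W : StrataMaps I (MvPolynomial X S)}

theorem inducedField_stratumIncl (a : lcmPoset I) (n : ℕ)
    (x : StratumFace a n →₀ MvPolynomial X S) :
    inducedField W n (stratumIncl _ a n x) = stratumIncl _ a (n + 1) (W a n x) :=
  assemble_stratumIncl (fun a => W a n) a x

namespace IsStrataSplitting

variable (hW : IsStrataSplitting W)
include hW

theorem field_field (n : ℕ) (x : LcmMod I S n) :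
    inducedField W (n + 1) (inducedField W n x) = 0 := by
  suffices h : inducedField W (n + 1) ∘ₗ inducedField W n = 0 from LinearMap.congr_fun h x
  refine hom_ext_strata fun a x => ?_
  simp only [LinearMap.comp_apply, inducedField_stratumIncl, hW.comp_self, map_zero,
    LinearMap.zero_apply]

theorem field_strataD_field (n : ℕ) (x : LcmMod I S n) :
    inducedField W n (strataD I _ n (inducedField W n x)) = inducedField W n x := by
  suffices h : inducedField W n ∘ₗ strataD I _ n ∘ₗ inducedField W n = inducedField W n from
    LinearMap.congr_fun h x
  refine hom_ext_strata fun a x => ?_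
  simp only [LinearMap.comp_apply, inducedField_stratumIncl, strataD_stratumIncl, hW.W_d_W]

theorem strataD_field_strataD (n : ℕ) (x : LcmMod I S (n + 1)) :
    strataD I _ n (inducedField W n (strataD I _ n x)) = strataD I _ n x := by
  suffices h : strataD I _ n ∘ₗ inducedField W n ∘ₗ strataD I _ n = strataD I _ n from
    LinearMap.congr_fun h x
  refine hom_ext_strata fun a x => ?_
  simp only [LinearMap.comp_apply, inducedField_stratumIncl, strataD_stratumIncl, hW.d_W_d]

-- As `flow W = W - W d W` and `W strataD W = W`, each factor `flow` costs one `lowerD`.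
theorem exists_flow_pow_field (j n : ℕ) (x : LcmMod I S n) :
    ∃ y ∈ coheightFil I (MvPolynomial X S) n j,
      (flow (lcmD I S) (inducedField W) (n + 1) ^ j) (inducedField W n x) =
        inducedField W n y := by
  induction j with
  | zero => exact ⟨x, by rw [coheightFil_zero]; trivial, rfl⟩
  | succ j ih =>
    obtain ⟨y, hy, h⟩ := ih
    refine ⟨-lowerD I S n (inducedField W n y), Submodule.neg_mem _
      (lowerD_mem_coheightFil (assemble_mem_coheightFil (fun a => W a n) hy)), ?_⟩
    rw [pow_succ', Module.End.mul_apply, h, flow_D hW.field_field, lcmD_eq_strataD_add_lowerD,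
      map_add, hW.field_strataD_field, map_neg, sub_add_cancel_left]

theorem flow_pow_field [Finite (lcmPoset I)] (n : ℕ) (x : LcmMod I S n) :
    (flow (lcmD I S) (inducedField W) (n + 1) ^ (1 + lcmDim I)) (inducedField W n x) = 0 := by
  obtain ⟨y, hy, h⟩ := hW.exists_flow_pow_field (1 + lcmDim I) n x
  rw [coheightFil_eq_bot n (Nat.lt_add_of_pos_left one_pos), Submodule.mem_bot] at hy
  rw [h, hy, map_zero]

theorem lcmD_mem_of_flow_pow_eq [Finite (lcmPoset I)] (n : ℕ) (x : LcmMod I S (n + 1))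
    (hx : (flow (lcmD I S) (inducedField W) (n + 1) ^ (1 + lcmDim I)) x = x) :
    lcmD I S n x ∈
      MvPolynomial.idealOfVars X S • (⊤ : Submodule (MvPolynomial X S) (LcmMod I S n)) := by
  have hfield : inducedField W n (lcmD I S n x) = 0 := by
    rw [← hx, d_flow_pow (lcmD_comp S), D_flow_pow hW.field_field, hW.flow_pow_field]
  have hstrata : strataD I _ n x = -strataD I _ n (inducedField W n (lowerD I S n x)) := by
    rw [lcmD_eq_strataD_add_lowerD, map_add] at hfield
    rw [← hW.strataD_field_strataD, eq_neg_of_add_eq_zero_left hfield, map_neg]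
  have hlower := lowerD_mem n x
  rw [lcmD_eq_strataD_add_lowerD, hstrata]
  exact Submodule.add_mem _ (Submodule.neg_mem _ <|
    Submodule.smul_top_le_comap_smul_top _ (strataD I _ n ∘ₗ inducedField W n) hlower) hlower

end IsStrataSplitting

theorem lcmAug_flow_pow (j : ℕ) (x : LcmMod I S 0) :
    lcmAug I S ((flow (lcmD I S) (inducedField W) 0 ^ j) x) = lcmAug I S x := by
  induction j generalizing x with
  | zero => rfl
  | succ j ih =>
    rw [pow_succ, Module.End.mul_apply, ih, flow_apply, map_sub, map_sub, lcmAug_lcmD, sub_zero]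
    change lcmAug I S x - lcmAug I S 0 = _
    rw [map_zero, sub_zero]

end Splitting

section Homogeneity

variable {X : Type*} {I : AddSemigroupIdeal (X →₀ ℕ)} {S : Type*} [CommRing S]

theorem map_mem_lcmDeg {n m : ℕ} {f : LcmMod I S n →ₗ[MvPolynomial X S] LcmMod I S m}
    (hf : ∀ c : Face I n, f (Finsupp.single c 1) ∈ lcmDeg I S m c.top) {e : X →₀ ℕ}
    {x : LcmMod I S n} (hx : x ∈ lcmDeg I S n e) : f x ∈ lcmDeg I S m e :=
  map_mem_of_map_single_mem (fun e e' _ h => monomial_smul_mem_finsuppDeg e e' h) hf hx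

theorem lcmD_mem_lcmDeg {n : ℕ} {e : X →₀ ℕ} {x : LcmMod I S (n + 1)}
    (hx : x ∈ lcmDeg I S (n + 1) e) : lcmD I S n x ∈ lcmDeg I S n e := by
  refine map_mem_lcmDeg (fun c => ?_) hx
  simp only [lcmD_single, one_mul]
  refine Submodule.sum_mem _ fun i _ => Submodule.smul_of_tower_mem _ _ ?_
  exact Submodule.subset_span ⟨c.del i, _, tsub_add_cancel_of_le (c.del_top_le i), rfl⟩

theorem stratumIncl_mem_lcmDeg {a : lcmPoset I} {n : ℕ} {x : StratumFace a n →₀ MvPolynomial X S}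
    (hx : x ∈ constants S (MvPolynomial X S) (StratumFace a n)) :
    stratumIncl _ a n x ∈ lcmDeg I S n a := by
  refine (Submodule.span_le.2 ?_ : constants S (MvPolynomial X S) (StratumFace a n) ≤
    (lcmDeg I S n a).comap ((stratumIncl _ a n).restrictScalars S)) hx
  rintro _ ⟨⟨c, rfl⟩, rfl⟩
  change stratumIncl _ c.top n (Finsupp.single _ 1) ∈ lcmDeg I S n c.top
  rw [stratumIncl_single]
  exact single_one_mem_finsuppDeg (deg := fun c : Face I n => (c.top : X →₀ ℕ)) c

variable {W : StrataMaps I (MvPolynomial X S)}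

theorem inducedField_mem_lcmDeg (hW : ∀ a n, IsConstant S (W a n)) {n : ℕ} {e : X →₀ ℕ}
    {x : LcmMod I S n} (hx : x ∈ lcmDeg I S n e) : inducedField W n x ∈ lcmDeg I S (n + 1) e := by
  refine map_mem_lcmDeg (fun c => ?_) hx
  have h := stratumIncl_mem_lcmDeg (hW c.top n ⟨c, rfl⟩)
  rwa [← inducedField_stratumIncl, stratumIncl_single] at h

theorem flow_mem_lcmDeg (hW : ∀ a n, IsConstant S (W a n)) {n : ℕ} {e : X →₀ ℕ}
    {x : LcmMod I S n} (hx : x ∈ lcmDeg I S n e) :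
    flow (lcmD I S) (inducedField W) n x ∈ lcmDeg I S n e := by
  rw [flow_apply]
  refine Submodule.sub_mem _ (Submodule.sub_mem _ hx
    (lcmD_mem_lcmDeg (inducedField_mem_lcmDeg hW hx))) ?_
  cases n with
  | zero => exact Submodule.zero_mem _
  | succ n => exact inducedField_mem_lcmDeg hW (lcmD_mem_lcmDeg hx)

theorem flow_pow_mem_lcmDeg (hW : ∀ a n, IsConstant S (W a n)) (j : ℕ) {n : ℕ} {e : X →₀ ℕ}
    {x : LcmMod I S n} (hx : x ∈ lcmDeg I S n e) :
    (flow (lcmD I S) (inducedField W) n ^ j) x ∈ lcmDeg I S n e := by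
  induction j with
  | zero => exact hx
  | succ j ih =>
    rw [pow_succ', Module.End.mul_apply]
    exact flow_mem_lcmDeg hW ih

theorem lcmAug_mem_polyDeg {e : X →₀ ℕ} {x : LcmMod I S 0} (hx : x ∈ lcmDeg I S 0 e) :
    lcmAug I S x ∈ polyDeg X S e := by
  refine (Submodule.span_le.2 ?_ : lcmDeg I S 0 e ≤
    (polyDeg X S e).comap ((lcmAug I S).restrictScalars S)) hx
  rintro _ ⟨c, e', rfl, rfl⟩
  change lcmAug I S _ ∈ polyDeg X S _
  rw [lcmAug_single, MvPolynomial.monomial_mul, one_mul]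
  exact Submodule.subset_span rfl

theorem isGradedFreeResolution_lcm (I : AddSemigroupIdeal (X →₀ ℕ)) [Finite (minGens I)]
    (S : Type*) [CommRing S] :
    IsGradedFreeResolution (lcmDeg I S) (lcmD I S) (lcmAug I S) (monomialIdeal I S) where
  isGradedFree _ := isGradedFree_finsuppDeg
  d_mem _ _ _ := lcmD_mem_lcmDeg
  aug_mem _ _ := lcmAug_mem_polyDeg
  exact_d := exact_lcmD I S
  exact_aug := exact_lcmAug I S
  range_aug := range_lcmAug I S

end Homogeneity

section ConstantSplitting

variable {X : Type*} {I : AddSemigroupIdeal (X →₀ ℕ)} {S R : Type*} [CommRing S] [CommRing R]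
  [Algebra S R]

theorem isConstant_stratumD (a : lcmPoset I) (n : ℕ) : IsConstant S (stratumD R a n) := fun c => by
  classical
  rw [stratumD_single]
  refine Submodule.sum_mem _ fun i _ => Submodule.smul_of_tower_mem _ _ ?_
  split_ifs with h
  · exact single_mem_constants _
  · exact Submodule.zero_mem _

end ConstantSplitting

section Transport

variable {X : Type*} {I : AddSemigroupIdeal (X →₀ ℕ)}

theorem transport_trans {K : Type*} [Field K] {B B' B'' : ℕ → Type*} (e : ∀ n, B n ≃ B' n)
    (e' : ∀ n, B' n ≃ B'' n) (D : ∀ n, (B n →₀ K) →ₗ[K] (B (n + 1) →₀ K)) :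
    transport (fun n => (e n).trans (e' n)) D = transport e' (transport e D) := by
  refine funext fun n => LinearMap.ext fun x => ?_
  obtain ⟨x, rfl⟩ := (Finsupp.domLCongr (R := K) (M := K) ((e n).trans (e' n))).surjective x
  rw [transport_apply (fun n => (e n).trans (e' n)), ← Finsupp.domLCongr_trans,
    ← Finsupp.domLCongr_trans, LinearEquiv.trans_apply, LinearEquiv.trans_apply, transport_apply,
    transport_apply]

theorem transport_refl {K : Type*} [Field K] {B : ℕ → Type*}
    (D : ∀ n, (B n →₀ K) →ₗ[K] (B (n + 1) →₀ K)) : transport (fun n => Equiv.refl (B n)) D = D := by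
  refine funext fun n => LinearMap.ext fun x => ?_
  simpa only [Finsupp.domLCongr_refl, LinearEquiv.refl_apply] using
    transport_apply (fun n => Equiv.refl (B n)) D n x

variable (k : Type*) [Field k]

theorem homotopyMap_mul (γ δ : symGroup I) (a : lcmPoset I) (σ : StratumHomotopy k a) :
    homotopyMap k (γ * δ) a σ = homotopyMap k γ (latticeIso δ a) (homotopyMap k δ a σ) :=
  transport_trans (stratumEquiv δ a) (stratumEquiv γ (latticeIso δ a)) σ

theorem homotopyMap_one (a : lcmPoset I) (σ : StratumHomotopy k a) :
    homotopyMap k (1 : symGroup I) a σ = σ :=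
  transport_refl σ

theorem yMap_mul (γ δ : symGroup I) (y : YIndex I k) :
    yMap k (γ * δ) y = yMap k γ (yMap k δ y) := by
  obtain ⟨⟨a, ha⟩, σ, hσ⟩ := y
  exact Sigma.ext rfl (heq_of_eq (Subtype.ext (homotopyMap_mul k γ δ a σ)))

theorem yMap_one (y : YIndex I k) : yMap k 1 y = y := by
  obtain ⟨⟨a, ha⟩, σ, hσ⟩ := y
  exact Sigma.ext rfl (heq_of_eq (Subtype.ext (homotopyMap_one k a σ)))

end Transport

section Elimination

theorem finsum_eq_add_finsum_ne {α M : Type*} [Finite α] [AddCommMonoid M] (f : α → M) (a : α) :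
    ∑ᶠ i, f i = f a + ∑ᶠ i : {i // i ≠ a}, f i := by
  classical
  have := Fintype.ofFinite α
  rw [finsum_eq_sum_of_fintype, finsum_eq_sum_of_fintype, Fintype.sum_eq_add_sum_subtype_ne]

/-- The ideal of the polynomial ring in variables `y_t`, `t ∈ T a`, generated by the elements
`1 - ∑ y_t`, the sums being over the blocks `T a`. -/
abbrev normIdeal (k : Type*) [CommRing k] {A : Type*} (T : A → Type*) :
    Ideal (MvPolynomial (Σ a, T a) k) :=
  Ideal.span (Set.range fun a : A =>
    (1 : MvPolynomial (Σ a, T a) k) - ∑ᶠ t : T a, MvPolynomial.X ⟨a, t⟩)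

variable (k : Type*) [CommRing k] {A : Type*} {T : A → Type*} (t₀ : ∀ a, T a)

open Classical in
/-- The substitution that eliminates the variable `t₀ a` of each block by the relation
`∑ y_t = 1`. -/
def eliminate : MvPolynomial (Σ a, T a) k →ₐ[k] MvPolynomial (Σ a, {t : T a // t ≠ t₀ a}) k :=
  MvPolynomial.aeval fun y => if h : y.2 = t₀ y.1 then
    1 - ∑ᶠ s : {t : T y.1 // t ≠ t₀ y.1}, MvPolynomial.X ⟨y.1, s⟩ else MvPolynomial.X ⟨y.1, y.2, h⟩

/-- The inclusion of the polynomial ring in the variables other than the `t₀ a`. -/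
def includeRest : MvPolynomial (Σ a, {t : T a // t ≠ t₀ a}) k →ₐ[k] MvPolynomial (Σ a, T a) k :=
  MvPolynomial.rename fun y => ⟨y.1, y.2.1⟩

theorem eliminate_X_self (a : A) : eliminate k t₀ (MvPolynomial.X ⟨a, t₀ a⟩) =
    1 - ∑ᶠ s : {t : T a // t ≠ t₀ a}, MvPolynomial.X ⟨a, s⟩ := by
  rw [eliminate, MvPolynomial.aeval_X, dif_pos rfl]

theorem eliminate_X_ne {a : A} {t : T a} (ht : t ≠ t₀ a) :
    eliminate k t₀ (MvPolynomial.X ⟨a, t⟩) = MvPolynomial.X ⟨a, t, ht⟩ := by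
  rw [eliminate, MvPolynomial.aeval_X, dif_neg ht]

theorem eliminate_includeRest (p : MvPolynomial (Σ a, {t : T a // t ≠ t₀ a}) k) :
    eliminate k t₀ (includeRest k t₀ p) = p := by
  suffices h : (eliminate k t₀).comp (includeRest k t₀) = AlgHom.id k _ from DFunLike.congr_fun h p
  refine MvPolynomial.algHom_ext fun y => ?_
  rw [AlgHom.comp_apply, includeRest, MvPolynomial.rename_X]
  exact eliminate_X_ne k t₀ y.2.2

variable [∀ a, Finite (T a)]

theorem eliminate_eq_zero_of_mem {p : MvPolynomial (Σ a, T a) k} (hp : p ∈ normIdeal k T) :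
    eliminate k t₀ p = 0 := by
  refine (Ideal.span_le.2 ?_ : normIdeal k T ≤ RingHom.ker (eliminate k t₀)) hp
  rintro _ ⟨a, rfl⟩
  rw [SetLike.mem_coe, RingHom.mem_ker, map_sub, map_one, finsum_eq_add_finsum_ne _ (t₀ a),
    map_add, eliminate_X_self, map_finsum _ (Set.toFinite _),
    finsum_congr fun s : {t // t ≠ t₀ a} => eliminate_X_ne k t₀ s.2, sub_add_cancel, sub_self]

theorem includeRest_eliminate_X_sub_mem (y : Σ a, T a) :
    includeRest k t₀ (eliminate k t₀ (MvPolynomial.X y)) - MvPolynomial.X y ∈ normIdeal k T := by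
  obtain ⟨a, t⟩ := y
  by_cases h : t = t₀ a
  · subst h
    have hrel : (1 : MvPolynomial (Σ a, T a) k) - ∑ᶠ t : T a, MvPolynomial.X ⟨a, t⟩ ∈
        normIdeal k T := Ideal.subset_span ⟨a, rfl⟩
    rw [finsum_eq_add_finsum_ne _ (t₀ a), add_comm, ← sub_sub] at hrel
    rw [eliminate_X_self, map_sub, map_one, map_finsum _ (Set.toFinite _)]
    simpa only [includeRest, MvPolynomial.rename_X] using hrel
  · rw [eliminate_X_ne k t₀ h, includeRest, MvPolynomial.rename_X, sub_self]
    exact Ideal.zero_mem _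

theorem mk_includeRest_eliminate (p : MvPolynomial (Σ a, T a) k) :
    Ideal.Quotient.mk (normIdeal k T) (includeRest k t₀ (eliminate k t₀ p)) =
      Ideal.Quotient.mk (normIdeal k T) p := by
  suffices h : (Ideal.Quotient.mkₐ k (normIdeal k T)).comp
      ((includeRest k t₀).comp (eliminate k t₀)) = Ideal.Quotient.mkₐ k (normIdeal k T) from
    DFunLike.congr_fun h p
  exact MvPolynomial.algHom_ext fun y =>
    Ideal.Quotient.eq.2 (includeRest_eliminate_X_sub_mem k t₀ y)

/-- The quotient by the relations `∑ y_t = 1` as a polynomial ring in the remaining variables. -/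
def quotientNormEquiv : (MvPolynomial (Σ a, T a) k ⧸ normIdeal k T) ≃ₐ[k]
    MvPolynomial (Σ a, {t : T a // t ≠ t₀ a}) k :=
  AlgEquiv.ofAlgHom
    (Ideal.Quotient.liftₐ (normIdeal k T) (eliminate k t₀)
      fun _ => eliminate_eq_zero_of_mem k t₀)
    ((Ideal.Quotient.mkₐ k (normIdeal k T)).comp (includeRest k t₀))
    (AlgHom.ext (eliminate_includeRest k t₀))
    (Ideal.Quotient.algHom_ext _ (AlgHom.ext (mk_includeRest_eliminate k t₀)))

end Elimination

section Counting

variable {X : Type*} {I : AddSemigroupIdeal (X →₀ ℕ)} (k : Type*) [Field k]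

theorem nonempty_MSpl (a : lcmPoset I) : (MSpl k a).Nonempty :=
  exists_isMatroidal (stratumD_comp _ a)

variable (I) in
/-- The variables that remain after the elimination of one variable for each critical element. -/
abbrev FreeIndex : Type _ :=
  Σ a : Crit I k, {σ : MSpl k a.1 // σ ≠ ⟨_, (nonempty_MSpl k a.1).some_mem⟩}

variable [Finite (lcmPoset I)]

theorem finite_MSpl (a : lcmPoset I) : (MSpl k a).Finite :=
  finite_setOf_isMatroidal (isEmpty_stratumFace a) _

instance instFiniteMSpl (a : lcmPoset I) : Finite (MSpl k a) := finite_MSpl k a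

theorem msplCount_pos (a : lcmPoset I) : 0 < msplCount k a :=
  (Set.ncard_pos (finite_MSpl k a)).2 (nonempty_MSpl k a)

variable (I)

/-- The coordinate ring of the weights as a polynomial ring. -/
def coordRingEquiv : CoordRing I k ≃ₐ[k] MvPolynomial (FreeIndex I k) k :=
  quotientNormEquiv k (A := Crit I k) (T := fun a => MSpl k a.1) _

instance instIsDomainCoordRing : IsDomain (CoordRing I k) :=
  (coordRingEquiv I k).toMulEquiv.isDomain _

theorem isField_extField : IsField (ExtField I k) :=
  Field.toIsField (FractionRing (CoordRing I k))

theorem essFiniteType_extField : Algebra.EssFiniteType k (ExtField I k) :=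
  inferInstanceAs (Algebra.EssFiniteType k (FractionRing (CoordRing I k)))

theorem card_freeIndex :
    Nat.card (FreeIndex I k) = ∑ᶠ a : Crit I k, (msplCount k a.1 - 1) := by
  classical
  have := Fintype.ofFinite (Crit I k)
  rw [Nat.card_sigma, finsum_eq_sum_of_fintype]
  refine Finset.sum_congr rfl fun a _ => ?_
  have := Fintype.ofFinite (MSpl k a.1)
  rw [Nat.card_eq_fintype_card, Fintype.card_subtype_compl, Fintype.card_subtype_eq,
    ← Nat.card_eq_fintype_card]
  rfl

theorem nonempty_extField_algEquiv : Nonempty (ExtField I k ≃ₐ[k]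
    FractionRing (MvPolynomial (Fin (∑ᶠ a : Crit I k, (msplCount k a.1 - 1))) k)) :=
  ⟨(IsFractionRing.algEquivOfAlgEquiv ((coordRingEquiv I k).trans (MvPolynomial.renameEquiv k
    (Finite.equivFinOfCardEq (card_freeIndex I k)))) : FractionRing (CoordRing I k) ≃ₐ[k] _)⟩

theorem isEmpty_crit [CharZero k] : IsEmpty (Crit I k) where
  false a := by
    have ha : ringChar k ∣ msplCount k a.1 := a.2
    rw [ringChar.eq_zero, zero_dvd_iff] at ha
    exact (msplCount_pos k a.1).ne' ha

theorem bijective_algebraMap_extField [CharZero k] :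
    Function.Bijective (algebraMap k (ExtField I k)) := by
  have := isEmpty_crit I k
  let e : FractionRing (CoordRing I k) ≃ₐ[k] k := IsFractionRing.algEquivOfAlgEquiv
    ((coordRingEquiv I k).trans (MvPolynomial.isEmptyAlgEquiv k _))
  have he : (algebraMap k (FractionRing (CoordRing I k)) : k → _) = e.symm :=
    funext fun x => (e.symm.commutes x).symm
  exact he ▸ e.symm.bijective

end Counting

section ExtendScalars

variable {K R : Type*} [CommRing K] [CommRing R] (f : K →+* R) {B B' B'' : Type*}

theorem extendScalars_single (D : (B →₀ K) →ₗ[K] (B' →₀ K)) (b : B) :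
    extendScalars f D (Finsupp.single b 1) =
      (D (Finsupp.single b 1)).mapRange f (map_zero f) := by
  rw [extendScalars, Finsupp.linearCombination_single, one_smul]

theorem extendScalars_mapRange (D : (B →₀ K) →ₗ[K] (B' →₀ K)) (x : B →₀ K) :
    extendScalars f D (x.mapRange f (map_zero f)) = (D x).mapRange f (map_zero f) := by
  induction x using Finsupp.induction_linear with
  | zero => simp only [Finsupp.mapRange_zero, map_zero]
  | add x y hx hy => simp only [Finsupp.mapRange_add (map_add f), map_add, hx, hy]
  | single b r =>
    have h : D (Finsupp.single b r) = r • D (Finsupp.single b 1) := by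
      rw [← map_smul, Finsupp.smul_single_one]
    rw [h, Finsupp.mapRange_single, extendScalars, Finsupp.linearCombination_single,
      Finsupp.mapRange_smul' r (f r) _ (map_mul f r)]

theorem extendScalars_comp (E : (B' →₀ K) →ₗ[K] (B'' →₀ K)) (D : (B →₀ K) →ₗ[K] (B' →₀ K)) :
    extendScalars f (E ∘ₗ D) = extendScalars f E ∘ₗ extendScalars f D :=
  Finsupp.lhom_ext' fun b => LinearMap.ext_ring <| by
    simp only [LinearMap.comp_apply, Finsupp.lsingle_apply, extendScalars_single,
      extendScalars_mapRange]

variable {X : Type*} {I : AddSemigroupIdeal (X →₀ ℕ)}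

theorem stratumD_eq_extendScalars (a : lcmPoset I) (n : ℕ) :
    stratumD R a n = extendScalars f (stratumD K a n) := by
  classical
  refine Finsupp.lhom_ext' fun c => LinearMap.ext_ring ?_
  rw [LinearMap.comp_apply, LinearMap.comp_apply, Finsupp.lsingle_apply, extendScalars_single,
    stratumD_single, stratumD_single]
  change _ = Finsupp.mapRange.addMonoidHom f.toAddMonoidHom _
  rw [map_sum]
  refine Finset.sum_congr rfl fun i _ => ?_
  rw [map_zsmul, apply_dite (Finsupp.mapRange.addMonoidHom f.toAddMonoidHom), map_zero]
  simp

theorem stratumD_extendScalars_stratumD {a : lcmPoset I} {n : ℕ}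
    {D : (StratumFace a n →₀ K) →ₗ[K] (StratumFace a (n + 1) →₀ K)}
    (hD : ∀ x, stratumD K a n (D (stratumD K a n x)) = stratumD K a n x)
    (x : StratumFace a (n + 1) →₀ R) :
    stratumD R a n (extendScalars f D (stratumD R a n x)) = stratumD R a n x := by
  have h : stratumD K a n ∘ₗ D ∘ₗ stratumD K a n = stratumD K a n := LinearMap.ext hD
  simpa only [extendScalars_comp, ← stratumD_eq_extendScalars, LinearMap.comp_apply] using
    LinearMap.congr_fun (congrArg (extendScalars f) h) x

theorem isConstant_extendScalars {S : Type*} [CommRing S] [Algebra S R] (g : K →+* S)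
    (D : (B →₀ K) →ₗ[K] (B' →₀ K)) :
    IsConstant S (extendScalars ((algebraMap S R).comp g) D) := fun b => by
  rw [extendScalars_single]
  induction D (Finsupp.single b 1) using Finsupp.induction_linear with
  | zero => rw [Finsupp.mapRange_zero]; exact Submodule.zero_mem _
  | add x y hx hy =>
    rw [Finsupp.mapRange_add (map_add _)]
    exact Submodule.add_mem _ hx hy
  | single c r =>
    rw [Finsupp.mapRange_single, RingHom.comp_apply, Algebra.algebraMap_eq_smul_one,
      ← Finsupp.smul_single]
    exact Submodule.smul_mem _ _ (single_mem_constants c)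

end ExtendScalars

section Average

variable {X : Type*} {I : AddSemigroupIdeal (X →₀ ℕ)} (k : Type*) [Field k]

open Classical in
/-- The weights with which the matroidal splittings of a stratum are averaged. -/
def weight (a : lcmPoset I) (σ : MSpl k a) : ExtField I k :=
  if h : IsCritical k a then yElt k ⟨⟨a, h⟩, σ⟩ else
    algebraMap k (ExtField I k) ((msplCount k a : k)⁻¹)

variable [Finite (lcmPoset I)]

theorem finsum_yElt (a : Crit I k) : ∑ᶠ σ : MSpl k a.1, yElt k ⟨a, σ⟩ = 1 := by
  have hrel : (1 : MvPolynomial (YIndex I k) k) - ∑ᶠ σ : MSpl k a.1, MvPolynomial.X ⟨a, σ⟩ ∈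
      normIdeal k (A := Crit I k) (fun a => MSpl k a.1) := Ideal.subset_span ⟨a, rfl⟩
  have hone := congrArg (algebraMap (CoordRing I k) (FractionRing (CoordRing I k)))
    (Ideal.Quotient.eq.2 hrel)
  rw [map_one, map_one, map_finsum _ (Set.toFinite _), map_finsum _ (Set.toFinite _)] at hone
  exact hone.symm

theorem finsum_weight (a : lcmPoset I) : ∑ᶠ σ : MSpl k a, weight k a σ = 1 := by
  by_cases h : IsCritical k a
  · simp only [weight, dif_pos h]
    exact finsum_yElt k ⟨a, h⟩
  · have := Fintype.ofFinite (MSpl k a)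
    have hm : (msplCount k a : k) ≠ 0 := fun h0 => h ((ringChar.spec k _).1 h0)
    simp only [weight, dif_neg h]
    rw [finsum_eq_sum_of_fintype, Finset.sum_const, Finset.card_univ, ← Nat.card_eq_fintype_card,
      show Nat.card (MSpl k a) = msplCount k a from rfl, ← map_nsmul, nsmul_eq_mul,
      mul_inv_cancel₀ hm, map_one]

theorem averageHomotopy_eq_finsum_weight (a : lcmPoset I) (n : ℕ) :
    averageHomotopy k a n = ∑ᶠ σ : MSpl k a, (MvPolynomial.C (weight k a σ) : PolyExt I k) •
      extendScalars (primeToPoly I k) (σ.1 n) := by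
  by_cases h : IsCritical k a
  · simp only [averageHomotopy, weight, dif_pos h]
  · simp only [averageHomotopy, weight, dif_neg h]
    rw [smul_finsum' _ (Set.toFinite _)]
    rfl

theorem stratumD_averageHomotopy_stratumD (a : lcmPoset I) (n : ℕ)
    (x : StratumFace a (n + 1) →₀ PolyExt I k) :
    stratumD (PolyExt I k) a n (averageHomotopy k a n (stratumD (PolyExt I k) a n x)) =
      stratumD (PolyExt I k) a n x := by
  have := Fintype.ofFinite (MSpl k a)
  have hw : ∑ σ : MSpl k a, (MvPolynomial.C (weight k a σ) : PolyExt I k) = 1 := by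
    rw [← map_sum, ← finsum_eq_sum_of_fintype, finsum_weight, map_one]
  rw [averageHomotopy_eq_finsum_weight, finsum_eq_sum_of_fintype, LinearMap.sum_apply, map_sum]
  simp only [LinearMap.smul_apply, map_smul]
  calc
    ∑ σ : MSpl k a, (MvPolynomial.C (weight k a σ) : PolyExt I k) •
        stratumD (PolyExt I k) a n (extendScalars (primeToPoly I k) (σ.1 n)
          (stratumD (PolyExt I k) a n x))
    _ = ∑ σ : MSpl k a, (MvPolynomial.C (weight k a σ) : PolyExt I k) •
        stratumD (PolyExt I k) a n x :=
      Finset.sum_congr rfl fun σ _ =>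
        congrArg _ (stratumD_extendScalars_stratumD _ (IsMatroidal.d_D_d σ.2 n) x)
    _ = stratumD (PolyExt I k) a n x := by rw [← Finset.sum_smul, hw, one_smul]

theorem isConstant_averageHomotopy (a : lcmPoset I) (n : ℕ) :
    IsConstant (ExtField I k) (averageHomotopy k a n) := by
  have := Fintype.ofFinite (MSpl k a)
  rw [averageHomotopy_eq_finsum_weight, finsum_eq_sum_of_fintype]
  exact IsConstant.sum _ fun σ => (isConstant_extendScalars
    ((algebraMap k (ExtField I k)).comp (⊥ : Subfield k).subtype) (σ.1 n)).algebraMap_smul _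

theorem isStrataSplitting_average : IsStrataSplitting (I := I)
    fun a => hat (stratumD (PolyExt I k) a) (averageHomotopy k a) :=
  isStrataSplitting_hat (stratumD_averageHomotopy_stratumD k)

theorem isConstant_hat_average (a : lcmPoset I) (n : ℕ) :
    IsConstant (ExtField I k) (hat (stratumD (PolyExt I k) a) (averageHomotopy k a) n) :=
  isConstant_hat (isConstant_stratumD a) (isConstant_averageHomotopy k a) n

end Average

section StableProjection

variable {X : Type*} (I : AddSemigroupIdeal (X →₀ ℕ)) (k : Type*) [Field k]

theorem lcmD_proj (n : ℕ) (x : LcmMod I (ExtField I k) (n + 1)) :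
    lcmD I (ExtField I k) n (proj I k (n + 1) x) = proj I k n (lcmD I (ExtField I k) n x) :=
  d_flow_pow (N := LcmMod I (ExtField I k)) (lcmD_comp _) _ n x

theorem lcmD_mem_minRes (n : ℕ) (x : LcmMod I (ExtField I k) (n + 1))
    (hx : x ∈ minRes I k (n + 1)) : lcmD I (ExtField I k) n x ∈ minRes I k n := by
  obtain ⟨y, rfl⟩ := hx
  exact ⟨_, (lcmD_proj I k n y).symm⟩

theorem lcmAug_proj (x : LcmMod I (ExtField I k) 0) :
    lcmAug I (ExtField I k) (proj I k 0 x) = lcmAug I (ExtField I k) x :=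
  lcmAug_flow_pow (W := fun a => hat (stratumD (PolyExt I k) a) (averageHomotopy k a)) _ x

variable [Finite (lcmPoset I)]

theorem isIdempotentElem_proj (n : ℕ) : IsIdempotentElem (proj I k n) :=
  isIdempotentElem_flow_pow (N := LcmMod I (ExtField I k)) (lcmD_comp _)
    (isStrataSplitting_average k).flow_pow_field n

theorem proj_proj (n : ℕ) (x : LcmMod I (ExtField I k) n) :
    proj I k n (proj I k n x) = proj I k n x :=
  LinearMap.congr_fun (isIdempotentElem_proj I k n).eq x

theorem proj_of_mem {n : ℕ} {x : LcmMod I (ExtField I k) n} (hx : x ∈ minRes I k n) :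
    proj I k n x = x := by
  obtain ⟨y, rfl⟩ := hx
  exact proj_proj I k n y

theorem proj_mem_lcmDeg (n : ℕ) (e : X →₀ ℕ) (x : LcmMod I (ExtField I k) n)
    (hx : x ∈ lcmDeg I (ExtField I k) n e) : proj I k n x ∈ lcmDeg I (ExtField I k) n e :=
  flow_pow_mem_lcmDeg (isConstant_hat_average k) _ hx

theorem isGradedFree_minRes (n : ℕ) : IsGradedFree (N := minRes I k n) (minResDeg I k n) :=
  letI := (isField_extField I k).toField
  isGradedFree_range (S := ExtField I k) (deg := fun c : Face I n => (c.top : X →₀ ℕ))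
    (isIdempotentElem_proj I k n) (proj_mem_lcmDeg I k n)

theorem isMinimalComplex_minRes : IsMinimalComplex (N := fun n => minRes I k n)
    (minResD (lcmD_mem_minRes I k)) := by
  rintro n _ ⟨x, rfl⟩
  have hdx := (isStrataSplitting_average k).lcmD_mem_of_flow_pow_eq n x (proj_of_mem I k x.2)
  have hproj : (proj I k n).rangeRestrict (lcmD I (ExtField I k) n x) =
      minResD (lcmD_mem_minRes I k) n x :=
    Subtype.ext (proj_of_mem I k (lcmD_mem_minRes I k n x x.2))
  rw [← hproj]
  exact Submodule.smul_top_le_comap_smul_top _ (proj I k n).rangeRestrict hdx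

end StableProjection

section MinimalResolution

variable {X : Type*} (I : AddSemigroupIdeal (X →₀ ℕ)) [Finite (minGens I)] (k : Type*) [Field k]

theorem exact_minResD (n : ℕ) : Function.Exact (minResD (lcmD_mem_minRes I k) (n + 1))
    (minResD (lcmD_mem_minRes I k) n) := by
  refine fun x => ⟨fun hx => ?_, ?_⟩
  · obtain ⟨y, hy⟩ := (exact_lcmD I (ExtField I k) n x).1 (congrArg Subtype.val hx)
    refine ⟨⟨proj I k (n + 2) y, y, rfl⟩, Subtype.ext ?_⟩
    change lcmD I (ExtField I k) (n + 1) (proj I k (n + 2) y) = x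
    rw [lcmD_proj, hy, proj_of_mem I k x.2]
  · rintro ⟨y, rfl⟩
    exact Subtype.ext (lcmD_comp _ n y.1)

theorem exact_minResAug :
    Function.Exact (minResD (lcmD_mem_minRes I k) 0) (minResAug I k) := by
  refine fun x => ⟨fun hx => ?_, ?_⟩
  · obtain ⟨y, hy⟩ := (exact_lcmAug I (ExtField I k) x).1 hx
    refine ⟨⟨proj I k 1 y, y, rfl⟩, Subtype.ext ?_⟩
    change lcmD I (ExtField I k) 0 (proj I k 1 y) = x
    rw [lcmD_proj, hy, proj_of_mem I k x.2]
  · rintro ⟨y, rfl⟩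
    exact lcmAug_lcmD I _ y.1

theorem range_minResAug :
    LinearMap.range (minResAug I k) = monomialIdeal I (ExtField I k) := by
  rw [← range_lcmAug]
  refine le_antisymm ?_ ?_
  · rintro _ ⟨x, rfl⟩
    exact ⟨x, rfl⟩
  · rintro _ ⟨x, rfl⟩
    exact ⟨⟨proj I k 0 x, x, rfl⟩, lcmAug_proj I k x⟩

theorem isGradedFreeResolution_minRes : IsGradedFreeResolution (N := fun n => minRes I k n)
    (minResDeg I k) (minResD (lcmD_mem_minRes I k)) (minResAug I k)
    (monomialIdeal I (ExtField I k)) where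
  isGradedFree := isGradedFree_minRes I k
  d_mem _ _ _ hx := lcmD_mem_lcmDeg hx
  aug_mem _ _ hx := lcmAug_mem_polyDeg hx
  exact_d := exact_minResD I k
  exact_aug := exact_minResAug I k
  range_aug := range_minResAug I k

end MinimalResolution

section CoefficientAction

variable {X : Type*} {I : AddSemigroupIdeal (X →₀ ℕ)} (k : Type*) [Field k]

/-- The action of `G_I` on matroidal splittings. -/
def msplEquiv (γ : symGroup I) (a : lcmPoset I) : MSpl k a ≃ MSpl k (latticeIso γ a) :=
  (homotopyMap k γ a).subtypeEquiv fun _ => (homotopyMap_mem_iff k γ a).symm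

/-- The action of `G_I` on the variables `y_σ`, as a permutation. -/
def yEquiv (γ : symGroup I) : YIndex I k ≃ YIndex I k where
  toFun := yMap k γ
  invFun := yMap k γ⁻¹
  left_inv y := by rw [← yMap_mul, inv_mul_cancel, yMap_one]
  right_inv y := by rw [← yMap_mul, mul_inv_cancel, yMap_one]

/-- The action of `G_I` on critical elements. -/
def critMap (γ : symGroup I) (a : Crit I k) : Crit I k :=
  ⟨latticeIso γ a.1, a.2.latticeIso k γ⟩

theorem critMap_surjective (γ : symGroup I) : Function.Surjective (critMap k γ) := fun a =>
  ⟨critMap k γ⁻¹ a, Subtype.ext ((latticeIso γ).apply_symm_apply a.1)⟩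

theorem isCritical_latticeIso_iff (γ : symGroup I) (a : lcmPoset I) :
    IsCritical k (latticeIso γ a) ↔ IsCritical k a := by
  rw [IsCritical, msplCount_latticeIso, IsCritical]

theorem extField_algEquiv_ext {f g : ExtField I k ≃ₐ[k] ExtField I k}
    (h : ∀ y, f (yElt k y) = g (yElt k y)) : f = g := by
  let F : FractionRing (CoordRing I k) →+* FractionRing (CoordRing I k) :=
    (f : ExtField I k →+* ExtField I k)
  let G : FractionRing (CoordRing I k) →+* FractionRing (CoordRing I k) :=
    (g : ExtField I k →+* ExtField I k)
  have hFG : F = G := by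
    refine IsLocalization.ringHom_ext (nonZeroDivisors (CoordRing I k)) ?_
    refine Ideal.Quotient.ringHom_ext (MvPolynomial.ringHom_ext (fun r => ?_) h)
    exact (f.commutes r).trans (g.commutes r).symm
  exact AlgEquiv.ext fun x => RingHom.congr_fun hFG x

variable [Finite (lcmPoset I)]

theorem rename_norm (γ : symGroup I) (a : Crit I k) :
    MvPolynomial.rename (yEquiv k γ)
      ((1 : MvPolynomial (YIndex I k) k) - ∑ᶠ σ : MSpl k a.1, MvPolynomial.X ⟨a, σ⟩) =
    1 - ∑ᶠ σ : MSpl k (critMap k γ a).1, MvPolynomial.X ⟨critMap k γ a, σ⟩ := by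
  rw [map_sub, map_one, map_finsum _ (Set.toFinite _)]
  simp only [MvPolynomial.rename_X]
  congr 1
  exact finsum_comp_equiv (msplEquiv k γ a.1)
    (f := fun σ => (MvPolynomial.X ⟨critMap k γ a, σ⟩ : MvPolynomial (YIndex I k) k))

theorem map_normIdeal (γ : symGroup I) :
    normIdeal k (A := Crit I k) (fun a => MSpl k a.1) =
      (normIdeal k (A := Crit I k) (fun a => MSpl k a.1)).map
        (MvPolynomial.renameEquiv k (yEquiv k γ) : MvPolynomial (YIndex I k) k →+* _) := by
  rw [normIdeal, Ideal.map_span, ← Set.range_comp, ← (critMap_surjective k γ).range_comp]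
  exact congrArg (fun g => Ideal.span (Set.range g)) (funext fun a => (rename_norm k γ a).symm)

/-- The action of an element of `G_I` on the coordinate ring of `k'`, by permuting the `y_σ`. -/
def coordAut (γ : symGroup I) : CoordRing I k ≃ₐ[k] CoordRing I k :=
  Ideal.quotientEquivAlg _ _ (MvPolynomial.renameEquiv k (yEquiv k γ)) (map_normIdeal k γ)

/-- The action of an element of `G_I` on `k'`, by permuting the `y_σ`. -/
def extAut (γ : symGroup I) : ExtField I k ≃ₐ[k] ExtField I k :=
  (IsFractionRing.algEquivOfAlgEquiv (coordAut k γ) :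
    FractionRing (CoordRing I k) ≃ₐ[k] FractionRing (CoordRing I k))

theorem extAut_yElt (γ : symGroup I) (y : YIndex I k) :
    extAut k γ (yElt k y) = yElt k (yMap k γ y) := by
  refine (IsFractionRing.algEquivOfAlgEquiv_algebraMap (K := FractionRing (CoordRing I k))
    (L := FractionRing (CoordRing I k)) (coordAut k γ) _).trans ?_
  refine congrArg (algebraMap (CoordRing I k) (FractionRing (CoordRing I k))) ?_
  change Ideal.Quotient.mk _ (MvPolynomial.rename (yEquiv k γ) (MvPolynomial.X y)) = _
  rw [MvPolynomial.rename_X]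
  rfl

/-- The action of `G_I` on `k'` over `k`. -/
def extAction : symGroup I →* (ExtField I k ≃ₐ[k] ExtField I k) where
  toFun := extAut k
  map_one' := extField_algEquiv_ext k fun y => by
    rw [extAut_yElt, yMap_one]
    rfl
  map_mul' γ δ := extField_algEquiv_ext k fun y => by
    rw [extAut_yElt, yMap_mul, AlgEquiv.mul_apply, extAut_yElt, extAut_yElt]

theorem extAction_yElt (γ : symGroup I) (y : YIndex I k) :
    extAction k γ (yElt k y) = yElt k (yMap k γ y) :=
  extAut_yElt k γ y

theorem extAction_weight (γ : symGroup I) (a : lcmPoset I) (σ : MSpl k a) :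
    extAction k γ (weight k a σ) = weight k (latticeIso γ a) (msplEquiv k γ a σ) := by
  by_cases h : IsCritical k a
  · rw [weight, weight, dif_pos h, dif_pos ((isCritical_latticeIso_iff k γ a).2 h),
      extAction_yElt]
    rfl
  · rw [weight, weight, dif_neg h, dif_neg (mt (isCritical_latticeIso_iff k γ a).1 h),
      msplCount_latticeIso, AlgEquiv.commutes]

end CoefficientAction

section SemilinearMaps

variable {R R' R'' : Type*} [CommRing R] [CommRing R'] [CommRing R''] {B B' B'' C C' : Type*}

/-- The semilinear map of based free modules given by a map of scalars and one of bases. -/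
def semiMap (φ : R →+* R') (e : B ≃ B') : (B →₀ R) →ₛₗ[φ] (B' →₀ R') where
  toFun x := (x.mapRange φ (map_zero φ)).mapDomain e
  map_add' x y := by rw [Finsupp.mapRange_add (map_add φ), Finsupp.mapDomain_add]
  map_smul' r x := by
    rw [Finsupp.mapRange_smul' (v := x) r (φ r) (map_mul φ r), Finsupp.mapDomain_smul]

theorem semiMap_single (φ : R →+* R') (e : B ≃ B') (b : B) (r : R) :
    semiMap φ e (Finsupp.single b r) = Finsupp.single (e b) (φ r) := by
  change (Finsupp.mapRange φ (map_zero φ) (Finsupp.single b r)).mapDomain e = _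
  rw [Finsupp.mapRange_single, Finsupp.mapDomain_single]

theorem semiMap_apply_apply (φ : R →+* R') (e : B ≃ B') (x : B →₀ R) (b : B) :
    semiMap φ e x (e b) = φ (x b) := by
  change (Finsupp.mapRange φ (map_zero φ) x).mapDomain e (e b) = _
  rw [Finsupp.mapDomain_apply e.injective, Finsupp.mapRange_apply]

theorem semilinear_ext {P : Type*} [AddCommGroup P] [Module R' P] {φ : R →+* R'}
    {F G : (B →₀ R) →ₛₗ[φ] P} (h : ∀ b, F (Finsupp.single b 1) = G (Finsupp.single b 1)) :
    F = G :=
  Finsupp.lhom_ext fun b r => by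
    rw [← mul_one r, ← smul_eq_mul, ← Finsupp.smul_single, LinearMap.map_smulₛₗ,
      LinearMap.map_smulₛₗ, h]

theorem semiMap_comp (ψ : R' →+* R'') (φ : R →+* R') (e' : B' ≃ B'') (e : B ≃ B') (x : B →₀ R) :
    semiMap (ψ.comp φ) (e.trans e') x = semiMap ψ e' (semiMap φ e x) := by
  induction x using Finsupp.induction_linear with
  | zero => simp only [map_zero]
  | add x y hx hy => simp only [map_add, hx, hy]
  | single b r =>
    rw [semiMap_single, semiMap_single, semiMap_single]
    rfl

theorem semiMap_id (x : B →₀ R) : semiMap (RingHom.id R) (Equiv.refl B) x = x := by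
  refine LinearMap.congr_fun (g := LinearMap.id) (semilinear_ext fun b => ?_) x
  rw [semiMap_single]
  rfl

theorem semiMap_comm {φ : R →+* R'} {e : B ≃ B'} {e' : C ≃ C'}
    {L : (B →₀ R) →ₗ[R] (C →₀ R)} {L' : (B' →₀ R') →ₗ[R'] (C' →₀ R')}
    (h : ∀ b, L' (Finsupp.single (e b) 1) = semiMap φ e' (L (Finsupp.single b 1)))
    (x : B →₀ R) : L' (semiMap φ e x) = semiMap φ e' (L x) := by
  refine LinearMap.congr_fun (f := L'.comp (semiMap φ e)) (g := (semiMap φ e').comp L)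
    (semilinear_ext fun b => ?_) x
  rw [LinearMap.comp_apply, semiMap_single, map_one φ, h, LinearMap.comp_apply]

theorem extendScalars_semiMap {K : Type*} [CommRing K] (f : K →+* R) (φ : R →+* R')
    {e : B ≃ B'} {e' : C ≃ C'} {L : (B →₀ K) →ₗ[K] (C →₀ K)} {L' : (B' →₀ K) →ₗ[K] (C' →₀ K)}
    (h : ∀ x, L' (Finsupp.domLCongr (R := K) (M := K) e x) =
      Finsupp.domLCongr (R := K) (M := K) e' (L x)) (x : B →₀ R) :
    extendScalars (φ.comp f) L' (semiMap φ e x) = semiMap φ e' (extendScalars f L x) := by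
  refine semiMap_comm (fun b => Finsupp.ext fun c => ?_) x
  obtain ⟨c, rfl⟩ := e'.surjective c
  rw [semiMap_apply_apply, extendScalars_single, extendScalars_single,
    ← Finsupp.domLCongr_single (R := K), h, Finsupp.mapRange_apply, Finsupp.mapRange_apply,
    Finsupp.domLCongr_apply, Finsupp.domCongr_apply, Finsupp.equivMapDomain_apply,
    e'.symm_apply_apply]
  rfl

end SemilinearMaps

section SemilinearChainMaps

variable {R R' : Type*} [CommRing R] [CommRing R'] {φ : R →+* R'} {N N' : ℕ → Type*}
  [∀ n, AddCommGroup (N n)] [∀ n, Module R (N n)]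
  [∀ n, AddCommGroup (N' n)] [∀ n, Module R' (N' n)]
  {d : ∀ n, N (n + 1) →ₗ[R] N n} {D : ∀ n, N n →ₗ[R] N (n + 1)}
  {d' : ∀ n, N' (n + 1) →ₗ[R'] N' n} {D' : ∀ n, N' n →ₗ[R'] N' (n + 1)}
  (f : ∀ n, N n →ₛₗ[φ] N' n) (hd : ∀ n x, d' n (f (n + 1) x) = f n (d n x))
  (hD : ∀ n x, D' n (f n x) = f (n + 1) (D n x))

include hd hD

theorem homotopyD_semilinear (n : ℕ) (x : N n) :
    homotopyD d' D' n (f n x) = f n (homotopyD d D n x) := by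
  cases n with
  | zero => exact (map_zero (f 0)).symm
  | succ n =>
    change D' n (d' n (f (n + 1) x)) = f (n + 1) (D n (d n x))
    rw [hd, hD]

theorem hat_semilinear (n : ℕ) (x : N n) : hat d' D' n (f n x) = f (n + 1) (hat d D n x) := by
  rw [hat_apply, hat_apply, homotopyD_semilinear f hd hD, ← map_sub, hD, hd, hD]

theorem flow_semilinear (n : ℕ) (x : N n) : flow d' D' n (f n x) = f n (flow d D n x) := by
  rw [flow_apply, flow_apply, homotopyD_semilinear f hd hD, hD, hd, map_sub, map_sub]

theorem flow_pow_semilinear (j n : ℕ) (x : N n) :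
    (flow d' D' n ^ j) (f n x) = f n ((flow d D n ^ j) x) := by
  induction j with
  | zero => rfl
  | succ j ih =>
    rw [pow_succ', pow_succ', Module.End.mul_apply, Module.End.mul_apply, ih,
      flow_semilinear f hd hD]

end SemilinearChainMaps

section Equivariance

variable {X : Type*} {I : AddSemigroupIdeal (X →₀ ℕ)} {k : Type*} [Field k]

theorem polyMap_C (τ : ExtField I k ≃ₐ[k] ExtField I k) (γ : symGroup I) (r : ExtField I k) :
    polyMap τ γ (MvPolynomial.C r) = MvPolynomial.C (τ r) := by
  rw [polyMap, MvPolynomial.eval₂Hom_C]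
  rfl

theorem polyMap_monomial_one (τ : ExtField I k ≃ₐ[k] ExtField I k) (γ : symGroup I)
    (e : X →₀ ℕ) : polyMap τ γ (MvPolynomial.monomial e 1) =
      MvPolynomial.monomial (symAut γ e) 1 := by
  induction e using Finsupp.induction_linear with
  | zero =>
    rw [map_zero]
    exact map_one (polyMap τ γ)
  | add e e' he he' =>
    have monomial_add (e e' : X →₀ ℕ) : (MvPolynomial.monomial (e + e') 1 : PolyExt I k) =
        MvPolynomial.monomial e 1 * MvPolynomial.monomial e' 1 := by
      rw [MvPolynomial.monomial_mul, one_mul]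
    rw [monomial_add, map_mul, he, he', map_add, monomial_add]
  | single i n =>
    rw [← MvPolynomial.X_pow_eq_monomial, map_pow, polyMap, MvPolynomial.eval₂Hom_X',
      MvPolynomial.monomial_pow, one_pow, ← map_nsmul, Finsupp.smul_single, smul_eq_mul, mul_one]

theorem polyMap_mul (τ τ' : ExtField I k ≃ₐ[k] ExtField I k) (γ γ' : symGroup I) :
    polyMap (τ * τ') (γ * γ') = (polyMap τ γ).comp (polyMap τ' γ') := by
  refine MvPolynomial.ringHom_ext (fun r => ?_) fun i => ?_
  · rw [RingHom.comp_apply, polyMap_C, polyMap_C, polyMap_C]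
    rfl
  · rw [RingHom.comp_apply, MvPolynomial.X, polyMap_monomial_one, polyMap_monomial_one,
      polyMap_monomial_one]
    rfl

theorem polyMap_one :
    polyMap (1 : ExtField I k ≃ₐ[k] ExtField I k) 1 = RingHom.id (PolyExt I k) := by
  refine MvPolynomial.ringHom_ext (polyMap_C _ _) fun i => ?_
  rw [MvPolynomial.X, polyMap_monomial_one]
  rfl

theorem lcmMap_mul (τ τ' : ExtField I k ≃ₐ[k] ExtField I k) (γ γ' : symGroup I) (n : ℕ)
    (x : LcmMod I (ExtField I k) n) :
    lcmMap (τ * τ') (γ * γ') n x = lcmMap τ γ n (lcmMap τ' γ' n x) := by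
  change semiMap (polyMap (τ * τ') (γ * γ')) _ x = _
  rw [polyMap_mul]
  exact semiMap_comp _ _ (faceEquiv γ n) (faceEquiv γ' n) x

theorem lcmMap_one (n : ℕ) (x : LcmMod I (ExtField I k) n) :
    lcmMap (1 : ExtField I k ≃ₐ[k] ExtField I k) 1 n x = x := by
  change semiMap (polyMap 1 1) _ x = _
  rw [polyMap_one]
  exact semiMap_id x

variable (τ : ExtField I k ≃ₐ[k] ExtField I k) (γ : symGroup I)

theorem polyMap_algebraMap (r : k) :
    polyMap τ γ (algebraMap k (PolyExt I k) r) = algebraMap k (PolyExt I k) r :=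
  (polyMap_C τ γ _).trans (congrArg MvPolynomial.C (τ.commutes r))

theorem polyMap_comp_primeToPoly : (polyMap τ γ).comp (primeToPoly I k) = primeToPoly I k :=
  RingHom.ext fun _ => polyMap_algebraMap τ γ _

theorem lcmMap_single (n : ℕ) (c : Face I n) (f : PolyExt I k) :
    lcmMap τ γ n (Finsupp.single c f) = Finsupp.single (faceEquiv γ n c) (polyMap τ γ f) :=
  semiMap_single _ _ c f

theorem lcmMap_zero (n : ℕ) : lcmMap τ γ n (0 : LcmMod I (ExtField I k) n) = 0 :=
  map_zero (semiMap (polyMap τ γ) (faceEquiv γ n))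

theorem lcmMap_add (n : ℕ) (x y : LcmMod I (ExtField I k) n) :
    lcmMap τ γ n (x + y) = lcmMap τ γ n x + lcmMap τ γ n y :=
  map_add (semiMap (polyMap τ γ) (faceEquiv γ n)) x y

theorem lcmMap_smul (n : ℕ) (f : PolyExt I k) (x : LcmMod I (ExtField I k) n) :
    lcmMap τ γ n (f • x) = polyMap τ γ f • lcmMap τ γ n x :=
  (semiMap (polyMap τ γ) (faceEquiv γ n)).map_smulₛₗ f x

theorem lcmMap_smul_coeff (n : ℕ) (r : ExtField I k) (x : LcmMod I (ExtField I k) n) :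
    lcmMap τ γ n (r • x) = τ r • lcmMap τ γ n x := by
  rw [← algebraMap_smul (PolyExt I k) r x, lcmMap_smul, MvPolynomial.algebraMap_eq, polyMap_C,
    ← MvPolynomial.algebraMap_eq, algebraMap_smul]

theorem lcmMap_smul_base (n : ℕ) (r : k) (x : LcmMod I (ExtField I k) n) :
    lcmMap τ γ n (r • x) = r • lcmMap τ γ n x := by
  rw [← algebraMap_smul (PolyExt I k) r x, lcmMap_smul, polyMap_algebraMap, algebraMap_smul]

theorem symAut_tsub {a b : X →₀ ℕ} (h : b ≤ a) :
    symAut γ (a - b) = symAut γ a - symAut γ b := by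
  rw [eq_tsub_iff_add_eq_of_le ((aut_le_iff _ _ _).2 h), ← map_add, tsub_add_cancel_of_le h]

theorem lcmD_lcmMap (n : ℕ) (x : LcmMod I (ExtField I k) (n + 1)) :
    lcmD I (ExtField I k) n (lcmMap τ γ (n + 1) x) =
      lcmMap τ γ n (lcmD I (ExtField I k) n x) := by
  refine semiMap_comm (φ := polyMap τ γ) (e := faceEquiv γ (n + 1)) (e' := faceEquiv γ n)
    (fun c => ?_) x
  rw [lcmD_single, lcmD_single, map_sum]
  refine Finset.sum_congr rfl fun i _ => ?_
  rw [map_zsmul, semiMap_single, one_mul, one_mul, polyMap_monomial_one,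
    symAut_tsub γ (c.del_top_le i)]
  rfl

theorem lcmAug_lcmMap (x : LcmMod I (ExtField I k) 0) :
    lcmAug I (ExtField I k) (lcmMap τ γ 0 x) = polyMap τ γ (lcmAug I (ExtField I k) x) := by
  refine LinearMap.congr_fun
    (f := (lcmAug I (ExtField I k)).comp (semiMap (polyMap τ γ) (faceEquiv γ 0)))
    (g := (polyMap τ γ).toSemilinearMap.comp (lcmAug I (ExtField I k)))
    (semilinear_ext fun c => ?_) x
  rw [LinearMap.comp_apply, LinearMap.comp_apply, semiMap_single, lcmAug_single, lcmAug_single,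
    map_one, one_mul, one_mul]
  exact (polyMap_monomial_one τ γ _).symm

theorem lcmMap_mem_lcmDeg {n : ℕ} {e : X →₀ ℕ} {x : LcmMod I (ExtField I k) n}
    (hx : x ∈ lcmDeg I (ExtField I k) n e) :
    lcmMap τ γ n x ∈ lcmDeg I (ExtField I k) n (symAut γ e) := by
  induction hx using Submodule.span_induction with
  | mem x hx =>
    obtain ⟨c, e', rfl, rfl⟩ := hx
    rw [lcmMap_single, polyMap_monomial_one]
    exact Submodule.subset_span ⟨faceEquiv γ n c, symAut γ e', (map_add _ _ _).symm, rfl⟩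
  | zero =>
    rw [lcmMap_zero]
    exact Submodule.zero_mem _
  | add x y _ _ hx hy =>
    rw [lcmMap_add]
    exact Submodule.add_mem _ hx hy
  | smul r x _ hx =>
    rw [lcmMap_smul_coeff]
    exact Submodule.smul_mem _ _ hx

end Equivariance

section StratumEquivariance

variable {X : Type*} {I : AddSemigroupIdeal (X →₀ ℕ)} {k : Type*} [Field k]

/-- The semilinear action of `γ` on the chains of the strata, from the stratum at `a` to the
stratum at `γ a`. -/
def stratumMap (τ : ExtField I k ≃ₐ[k] ExtField I k) (γ : symGroup I) (a : lcmPoset I) (n : ℕ) :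
    (StratumFace a n →₀ PolyExt I k) →ₛₗ[polyMap τ γ]
      (StratumFace (latticeIso γ a) n →₀ PolyExt I k) :=
  semiMap (polyMap τ γ) (stratumEquiv γ a n)

variable (τ : ExtField I k ≃ₐ[k] ExtField I k) (γ : symGroup I) (a : lcmPoset I)

theorem stratumIncl_stratumMap (n : ℕ) (x : StratumFace a n →₀ PolyExt I k) :
    stratumIncl _ (latticeIso γ a) n (stratumMap τ γ a n x) =
      lcmMap τ γ n (stratumIncl _ a n x) := by
  refine semiMap_comm (φ := polyMap τ γ) (e := stratumEquiv γ a n) (e' := faceEquiv γ n)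
    (fun c => ?_) x
  rw [stratumIncl_single, stratumIncl_single, semiMap_single, map_one]
  rfl

theorem stratumD_stratumMap (n : ℕ) (x : StratumFace a (n + 1) →₀ PolyExt I k) :
    stratumD (PolyExt I k) (latticeIso γ a) n (stratumMap τ γ a (n + 1) x) =
      stratumMap τ γ a n (stratumD (PolyExt I k) a n x) := by
  have h := extendScalars_semiMap (primeToPoly I k) (polyMap τ γ)
    (stratumD_equiv (⊥ : Subfield k) γ a n) x
  rwa [polyMap_comp_primeToPoly, ← stratumD_eq_extendScalars, ← stratumD_eq_extendScalars] at h

theorem extendScalars_stratumMap (n : ℕ) (σ : StratumHomotopy k a)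
    (x : StratumFace a n →₀ PolyExt I k) :
    extendScalars (primeToPoly I k) (homotopyMap k γ a σ n) (stratumMap τ γ a n x) =
      stratumMap τ γ a (n + 1) (extendScalars (primeToPoly I k) (σ n) x) := by
  have h := extendScalars_semiMap (primeToPoly I k) (polyMap τ γ)
    (transport_apply (stratumEquiv γ a) σ n) x
  rwa [polyMap_comp_primeToPoly] at h

variable [Finite (lcmPoset I)]

theorem averageHomotopy_stratumMap (n : ℕ) (x : StratumFace a n →₀ PolyExt I k) :
    averageHomotopy k (latticeIso γ a) n (stratumMap (extAction k γ) γ a n x) =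
      stratumMap (extAction k γ) γ a (n + 1) (averageHomotopy k a n x) := by
  have := Fintype.ofFinite (MSpl k a)
  have := Fintype.ofFinite (MSpl k (latticeIso γ a))
  rw [averageHomotopy_eq_finsum_weight, averageHomotopy_eq_finsum_weight,
    finsum_eq_sum_of_fintype, finsum_eq_sum_of_fintype, LinearMap.sum_apply,
    LinearMap.sum_apply, map_sum, ← (msplEquiv k γ a).sum_comp]
  refine Finset.sum_congr rfl fun σ _ => ?_
  rw [LinearMap.smul_apply, LinearMap.smul_apply, LinearMap.map_smulₛₗ, polyMap_C,
    extAction_weight, ← extendScalars_stratumMap]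
  rfl

theorem hat_averageHomotopy_stratumMap (n : ℕ) (x : StratumFace a n →₀ PolyExt I k) :
    hat (stratumD (PolyExt I k) (latticeIso γ a)) (averageHomotopy k (latticeIso γ a)) n
        (stratumMap (extAction k γ) γ a n x) =
      stratumMap (extAction k γ) γ a (n + 1)
        (hat (stratumD (PolyExt I k) a) (averageHomotopy k a) n x) :=
  hat_semilinear (stratumMap (extAction k γ) γ a) (stratumD_stratumMap (extAction k γ) γ a)
    (averageHomotopy_stratumMap γ a) n x

theorem vectorField_lcmMap (n : ℕ) (x : LcmMod I (ExtField I k) n) :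
    vectorField I k n (lcmMap (extAction k γ) γ n x) =
      lcmMap (extAction k γ) γ (n + 1) (vectorField I k n x) := by
  refine semiMap_comm (φ := polyMap (extAction k γ) γ) (e := faceEquiv γ n)
    (e' := faceEquiv γ (n + 1)) (fun c => ?_) x
  have hW := inducedField_stratumIncl
    (W := fun a => hat (stratumD (PolyExt I k) a) (averageHomotopy k a))
  let y : StratumFace c.top n →₀ PolyExt I k := Finsupp.single ⟨c, rfl⟩ 1
  have hy : stratumIncl _ c.top n y = Finsupp.single c 1 := stratumIncl_single c.top n _ 1
  have hγy : stratumIncl _ _ n (stratumMap (extAction k γ) γ c.top n y) =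
      Finsupp.single (faceEquiv γ n c) 1 := by
    rw [stratumIncl_stratumMap, hy, lcmMap_single, map_one]
  rw [← hγy, ← hy]
  refine (hW _ _ _).trans ((congrArg _ (hat_averageHomotopy_stratumMap γ _ n y)).trans ?_)
  exact (stratumIncl_stratumMap _ γ _ _ _).trans (congrArg (lcmMap _ γ _) (hW _ _ _).symm)

theorem proj_lcmMap (n : ℕ) (x : LcmMod I (ExtField I k) n) :
    proj I k n (lcmMap (extAction k γ) γ n x) = lcmMap (extAction k γ) γ n (proj I k n x) :=
  flow_pow_semilinear (fun n => semiMap (polyMap (extAction k γ) γ) (faceEquiv γ n))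
    (lcmD_lcmMap _ γ) (vectorField_lcmMap γ) _ n x

end StratumEquivariance

section MinimalResolutionAction

variable {X : Type*} {I : AddSemigroupIdeal (X →₀ ℕ)} [Finite (lcmPoset I)] {k : Type*} [Field k]
  (γ : symGroup I)

theorem lcmMap_mem_minRes {n : ℕ} {x : LcmMod I (ExtField I k) n} (hx : x ∈ minRes I k n) :
    lcmMap (extAction k γ) γ n x ∈ minRes I k n := by
  obtain ⟨y, rfl⟩ := hx
  exact ⟨_, proj_lcmMap γ n y⟩

/-- The action of an element of `G_I` on a module of the minimal resolution, as a linear map over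
`k`. -/
def minResMap (n : ℕ) : minRes I k n →ₗ[k] minRes I k n where
  toFun x := ⟨lcmMap (extAction k γ) γ n x, lcmMap_mem_minRes γ x.2⟩
  map_add' x y := Subtype.ext (lcmMap_add _ γ n x.1 y.1)
  map_smul' r x := Subtype.ext (lcmMap_smul_base _ γ n r x)

theorem minResMap_coe (n : ℕ) (x : minRes I k n) :
    (minResMap γ n x : LcmMod I (ExtField I k) n) = lcmMap (extAction k γ) γ n x := rfl

theorem minResMap_mul (γ δ : symGroup I) (n : ℕ) (x : minRes I k n) :
    minResMap (γ * δ) n x = minResMap γ n (minResMap δ n x) := by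
  apply Subtype.ext
  rw [minResMap_coe, map_mul, lcmMap_mul]
  rfl

theorem minResMap_one (n : ℕ) (x : minRes I k n) : minResMap (1 : symGroup I) n x = x := by
  apply Subtype.ext
  rw [minResMap_coe, map_one, lcmMap_one]

/-- The action of an element of `G_I` on a module of the minimal resolution, as an
automorphism. -/
def minResEquiv (n : ℕ) : minRes I k n ≃ₗ[k] minRes I k n :=
  LinearEquiv.ofLinearMap (minResMap γ n) (minResMap γ⁻¹ n)
    (LinearMap.ext fun x => by
      rw [LinearMap.comp_apply, ← minResMap_mul, mul_inv_cancel, minResMap_one]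
      rfl)
    (LinearMap.ext fun x => by
      rw [LinearMap.comp_apply, ← minResMap_mul, inv_mul_cancel, minResMap_one]
      rfl)

variable (I k) in
/-- The action of `G_I` on the minimal resolution by automorphisms of complexes over `k`. -/
def minResAction : symGroup I →* complexAut (N := fun n => minRes I k n)
    (fun n => (minResD (lcmD_mem_minRes I k) n).restrictScalars k) where
  toFun γ := ⟨fun n => minResEquiv γ n, fun n x => Subtype.ext (lcmD_lcmMap _ γ n x.1)⟩
  map_one' := Subtype.ext (funext fun n => LinearEquiv.ext fun x => minResMap_one n x)
  map_mul' γ δ := Subtype.ext (funext fun n => LinearEquiv.ext fun x => minResMap_mul γ δ n x)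

theorem minResAction_coe (n : ℕ) (x : minRes I k n) :
    (((minResAction I k γ).1 n x : minRes I k n) : LcmMod I (ExtField I k) n) =
      lcmMap (extAction k γ) γ n x := rfl

theorem minResAction_smul (n : ℕ) (f : PolyExt I k) (x : minRes I k n) :
    (minResAction I k γ).1 n (f • x) =
      polyMap (extAction k γ) γ f • (minResAction I k γ).1 n x :=
  Subtype.ext (lcmMap_smul _ γ n f x.1)

theorem mem_minResDeg_iff (n : ℕ) (e : X →₀ ℕ) (x : minRes I k n) :
    x ∈ minResDeg I k n e ↔ (minResAction I k γ).1 n x ∈ minResDeg I k n (symAut γ e) := by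
  refine ⟨lcmMap_mem_lcmDeg _ γ, fun h => ?_⟩
  have hx : lcmMap (extAction k γ⁻¹) γ⁻¹ n (lcmMap (extAction k γ) γ n x.1) = x.1 := by
    rw [← lcmMap_mul, ← map_mul, inv_mul_cancel, map_one, lcmMap_one]
  have he : symAut γ⁻¹ (symAut γ e) = e := (symAut γ).symm_apply_apply e
  have hmem := lcmMap_mem_lcmDeg (extAction k γ⁻¹) γ⁻¹ h
  rw [he] at hmem
  exact (congrArg (· ∈ lcmDeg I (ExtField I k) n e) hx).mp hmem

end MinimalResolutionAction

end LcmRes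

end

theorem theoremT_general {X : Type*} (I : AddSemigroupIdeal (X →₀ ℕ)) [Finite (minGens I)]
    (k : Type*) [Field k] :
    (Finite (lcmPoset I) ∧ ∀ a : lcmPoset I, 0 < msplCount k a) ∧
    (IsField (ExtField I k) ∧ Algebra.EssFiniteType k (ExtField I k)) ∧
    (CharZero k → Function.Bijective (algebraMap k (ExtField I k))) ∧
    Nonempty (ExtField I k ≃ₐ[k]
      FractionRing (MvPolynomial (Fin (∑ᶠ a : Crit I k, (msplCount k a.1 - 1))) k)) ∧
    IsGradedFreeResolution (lcmDeg I (ExtField I k)) (lcmD I (ExtField I k))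
      (lcmAug I (ExtField I k)) (monomialIdeal I (ExtField I k)) ∧
    ((∀ n x, lcmD I (ExtField I k) n (proj I k (n + 1) x) =
        proj I k n (lcmD I (ExtField I k) n x)) ∧
      (∀ n e, ∀ x ∈ lcmDeg I (ExtField I k) n e, proj I k n x ∈ lcmDeg I (ExtField I k) n e) ∧
      (∀ n x, proj I k n (proj I k n x) = proj I k n x)) ∧
    ∃ hd : ∀ n, ∀ x ∈ minRes I k (n + 1), lcmD I (ExtField I k) n x ∈ minRes I k n,
      IsGradedFreeResolution (N := fun n => minRes I k n) (minResDeg I k) (minResD hd)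
        (minResAug I k) (monomialIdeal I (ExtField I k)) ∧
      IsMinimalComplex (N := fun n => minRes I k n) (minResD hd) ∧
      ∃ ρ : symGroup I →* (ExtField I k ≃ₐ[k] ExtField I k),
        (∀ γ y, ρ γ (yElt k y) = yElt k (yMap k γ y)) ∧
        ∃ M : symGroup I →* complexAut (N := fun n => minRes I k n)
            (fun n => (minResD hd n).restrictScalars k),
          ∀ γ,
            (∀ n (x : minRes I k n), (((M γ).1 n x : minRes I k n) : LcmMod I (ExtField I k) n) =
              lcmMap (ρ γ) γ n x) ∧
            (∀ n (f : PolyExt I k) (x : minRes I k n),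
              (M γ).1 n (f • x) = polyMap (ρ γ) γ f • (M γ).1 n x) ∧
            (∀ n e (x : minRes I k n),
              x ∈ minResDeg I k n e ↔ (M γ).1 n x ∈ minResDeg I k n (symAut γ e)) ∧
            (∀ x : minRes I k 0, minResAug I k ((M γ).1 0 x) =
              polyMap (ρ γ) γ (minResAug I k x)) :=
  ⟨⟨finite_lcmPoset, msplCount_pos k⟩, ⟨isField_extField I k, essFiniteType_extField I k⟩,
    fun _ => bijective_algebraMap_extField I k, nonempty_extField_algEquiv I k,
    isGradedFreeResolution_lcm I (ExtField I k),
    ⟨lcmD_proj I k, proj_mem_lcmDeg I k, proj_proj I k⟩,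
    lcmD_mem_minRes I k, isGradedFreeResolution_minRes I k, isMinimalComplex_minRes I k,
    extAction k, extAction_yElt k, minResAction I k, fun γ =>
      ⟨minResAction_coe γ, minResAction_smul γ, mem_minResDeg_iff γ,
        fun x => lcmAug_lcmMap _ γ x.1⟩⟩

theorem theoremT {X : Type*} [Finite X] (I : AddSemigroupIdeal (X →₀ ℕ)) (k : Type*) [Field k] :
    -- the poset `L'` is finite and the numbers `m(a)` are well defined and positive
    (Finite (lcmPoset I) ∧ ∀ a : lcmPoset I, 0 < msplCount k a) ∧
    -- the extension `k'` of `k` is a finitely generated field extension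
    (IsField (ExtField I k) ∧ Algebra.EssFiniteType k (ExtField I k)) ∧
    -- it equals `k` in characteristic zero
    (CharZero k → Function.Bijective (algebraMap k (ExtField I k))) ∧
    -- it is purely transcendental of degree `∑ (m(a) - 1)`, the sum over the critical elements
    Nonempty (ExtField I k ≃ₐ[k]
      FractionRing (MvPolynomial (Fin (∑ᶠ a : Crit I k, (msplCount k a.1 - 1))) k)) ∧
    -- the lcm-resolution is a multigraded free resolution of the ideal `I k'[X]`
    IsGradedFreeResolution (lcmDeg I (ExtField I k)) (lcmD I (ExtField I k))
      (lcmAug I (ExtField I k)) (monomialIdeal I (ExtField I k)) ∧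
    -- `proj` is a multihomogeneous chain map and it is idempotent
    ((∀ n x, lcmD I (ExtField I k) n (proj I k (n + 1) x) =
        proj I k n (lcmD I (ExtField I k) n x)) ∧
      (∀ n e, ∀ x ∈ lcmDeg I (ExtField I k) n e, proj I k n x ∈ lcmDeg I (ExtField I k) n e) ∧
      (∀ n x, proj I k n (proj I k n x) = proj I k n x)) ∧
    -- the image of `proj` is a subcomplex
    ∃ hd : ∀ n, ∀ x ∈ minRes I k (n + 1), lcmD I (ExtField I k) n x ∈ minRes I k n,
      -- which is a minimal multigraded free resolution of `I k'[X]`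
      IsGradedFreeResolution (N := fun n => minRes I k n) (minResDeg I k) (minResD hd)
        (minResAug I k) (monomialIdeal I (ExtField I k)) ∧
      IsMinimalComplex (N := fun n => minRes I k n) (minResD hd) ∧
      -- `G_I` acts on `k'` over `k`, by its action on the elements `y_σ`
      ∃ ρ : symGroup I →* (ExtField I k ≃ₐ[k] ExtField I k),
        (∀ γ y, ρ γ (yElt k y) = yElt k (yMap k γ y)) ∧
        -- and on the minimal resolution, by `k`-linear automorphisms of chain complexes
        ∃ M : symGroup I →* complexAut (N := fun n => minRes I k n)
            (fun n => (minResD hd n).restrictScalars k),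
          ∀ γ,
            -- given by the action on linear combinations of faces
            (∀ n (x : minRes I k n), (((M γ).1 n x : minRes I k n) : LcmMod I (ExtField I k) n) =
              lcmMap (ρ γ) γ n x) ∧
            -- it is linear over `k'[X]` as a map to the module twisted by `γ`
            (∀ n (f : PolyExt I k) (x : minRes I k n),
              (M γ).1 n (f • x) = polyMap (ρ γ) γ f • (M γ).1 n x) ∧
            -- it preserves multidegrees, where the degree `e` part of the twisted module
            -- is the degree `γ e` part of the module
            (∀ n e (x : minRes I k n),
              x ∈ minResDeg I k n e ↔ (M γ).1 n x ∈ minResDeg I k n (symAut γ e)) ∧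
            -- it lifts the isomorphism from `I k'[X]` to its twist that is induced by `γ`
            (∀ x : minRes I k 0, minResAug I k ((M γ).1 0 x) =
              polyMap (ρ γ) γ (minResAug I k x)) :=
  theoremT_general I k
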